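/- Let $p>q\ge 2$ be integers and, for $c\in\mathbb C$, let $\mathbf f_c$ be the correspondence $z\to w\iff (w-c)^q=z^p$. A branch of $\mathbf f_c$ is a holomorphic $\varphi$ with $z\to\varphi(z)$. A cycle $z_0\to z_1\to\dots\to z_n=z_0$ in $\mathbb C\setminus\{0\}$ is repelling if $|(\varphi_n\circ\dots\circ\varphi_1)'(z_0)|>1$, where $\varphi_k$ is the branch sending $z_{k-1}$ to $z_k$; the Julia set $J_c=J(\mathbf f_c)$ is the closure of the union of the repelling cycles. Let $A_r=\{r<|z|<1/(2r)\}$. A compact $\Lambda\subset A_r\cap(c+A_r)$ each of whose points has an image and a pre-image in $\Lambda$ is an expanding hyperbolic set of $\mathbf f_c$ if there is a conformal metric $\mu(z)|dz|$ on a region $V\supset\Lambda$ with $\inf\|\varphi'(z)\|_\mu>1$, the infimum being over all $z\in V$ and all branches $\varphi$ at $z$ with $\varphi(z)\in V$. Let $0<r<1/\sqrt2$, $4|c|r<1$ and $\delta>0$; call $(r,\delta)$ admissible for $(c,\Lambda)$ if for every $z\in\Lambda$ each of the sets $r(\mathbf f_c(z)\cap\Lambda)+\delta\overline{\mathbb D}$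 and $r(\mathbf f_c^{-1}(z)\cap\Lambda)+\delta\overline{\mathbb D}$ consists of disjoint closed disks of radius $\delta$ contained in $\overline{\mathbb D}$. Then $\mathcal B(\Lambda)=\mathcal B_{r,\delta}(\Lambda)\subset\mathbb C^2$ is the set of all $(z,s)$ with $z\in\Lambda$ and $s\in\bigcap_{n>0}\mathcal D_n^+(z)$, where $\mathcal D_n^+(z)$ is the union of the disks $r(z_1+\delta z_2+\dots+\delta^{n-1}z_n)+\delta^n\overline{\mathbb D}$ over all orbits $z\to z_1\to z_2\to\cdots$ in $\Lambda$ (so the points of $\mathcal B(\Lambda)$ are the points $(z_0,r\sum_{n\ge1}\delta^{n-1}z_n)$ with $z_0\to z_1\to\cdots$ an orbit in $\Lambda$). Put $\pi(z,s)=z$. The bundle map $f_c$ of $\Lambda$ is the holomorphic map $f_c(z,w)=(\varphi(z),\delta^{-1}w-r\delta^{-1}\varphi(z))$ on a sufficiently small neighbourhood of $\mathcal B(\Lambda)$, where near $(z_0,r\sum_{n\ge 1}\delta^{n-1}z_n)$ the map $\varphi$ is the branch of $\mathbf f_c$ sending $z_0$ to $z_1$; $J(f_c)$ is the closure of its periodic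 points (those whose whole cycle lies in that neighbourhood). **Theorem.** Suppose that $J_{c_0}$ is an expanding hyperbolic set of $\mathbf f_{c_0}$ in $A_r\cap(c_0+A_r)$ and that $(r,\delta)$ is admissible for $(c_0,J_{c_0})$. There are a bounded region $U\ni c_0$ and a unique map $h:U\times\mathcal B(J_{c_0})\to\mathbb C^2$, $h_c=h(c,\cdot)$, such that $h_{c_0}=\mathrm{id}$, every $h_c$ is injective, $c\mapsto h_c(x)$ is holomorphic on $U$ for every $x$ (that is, $h$ is a holomorphic motion), and * for $c\in U$ the set $\Lambda_c=\pi h_c(\mathcal B(J_{c_0}))$ is an expanding hyperbolic set of $\mathbf f_c$ in $A_r\cap(c+A_r)$, $(r,\delta)$ is admissible for $(c,\Lambda_c)$, and $\Lambda_c$ is continuous in $c$ for the Hausdorff metric; * for $c\in U$ the image of $h_c$ is contained in $\mathcal B(\Lambda_c)$ and invariant under the bundle map $f_c$ of $\Lambda_c$, and $h_c\circ f_{c_0}=f_c\circ h_c$ on $\mathcal B(J_{c_0})$; * there is $C_0>0$ with $|h_u(x)-h_v(x)|\le C_0|u-v|$ for all $u,v\in U$ and $x\in\mathcal B(J_{c_0})$.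 For every $c\in U$, the bundle map $f_c$ exists on a neighbourhood of $\mathcal B(\Lambda_c)$, and if the neighbourhood on which $f_c$ is considered is chosen sufficiently small (depending on $c$), then $J(f_c)\subset\mathcal B(\Lambda_c)$ and $h_c$ restricts to a homeomorphism $J(f_{c_0})\to J(f_c)$. The set $S=J(f_{c_0})$ satisfies $f_{c_0}(S)\subset S$, and $\mathbf h(c,z)=\mathbf h_c(z)=\{\pi h_c(x): x\in S,\ \pi(x)=z\}$ is a branched holomorphic motion on $U\times J_{c_0}$ based at $c_0$: $\mathbf h_c(z)\neq\emptyset$, $\mathbf h_{c_0}(z)=\{z\}$, and $\{(c,w): c\in U,\ w\in\mathbf h_c(J_{c_0})\}$ is a union of graphs of holomorphic functions $U\to\mathbb C$. Finally, there is an open set $\Omega\supset J_{c_0}$ such that, for every $c\in U$, $$\mathbf h_c(J_{c_0})=J_c\cap\Omega=\pi J(f_c).$$ -/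

import Mathlib

open Filter Topology Metric Set

namespace BranchedJulia

noncomputable section

/-- The correspondence `𝐟_c`, as the relation `z → w` given by `(w - c) ^ q = z ^ p`.
The point at infinity is omitted: its only image and its only preimage are itself. -/
def Corr (p q : ℕ) (c z w : ℂ) : Prop := (w - c) ^ q = z ^ p

/-- `φ` is (the germ of) a holomorphic branch of `𝐟_c` at `z`. -/
def IsBranchAt (p q : ℕ) (c : ℂ) (φ : ℂ → ℂ) (z : ℂ) : Prop :=
  AnalyticAt ℂ φ z ∧ ∀ᶠ x in 𝓝 z, Corr p q c x (φ x)

/-- `branchComp φ n = φ (n - 1) ∘ ⋯ ∘ φ 0`. -/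
def branchComp (φ : ℕ → ℂ → ℂ) : ℕ → ℂ → ℂ
  | 0 => id
  | n + 1 => φ n ∘ branchComp φ n

/-- `z 0 → z 1 → ⋯ → z n = z 0` is a repelling cycle of `𝐟_c`: it avoids `0`, and the composition
of the branches along the cycle has derivative of modulus larger than one. -/
def IsRepellingCycle (p q : ℕ) (c : ℂ) (n : ℕ) (z : ℕ → ℂ) : Prop :=
  0 < n ∧ z n = z 0 ∧ (∀ k < n, Corr p q c (z k) (z (k + 1))) ∧ (∀ k ≤ n, z k ≠ 0) ∧
    ∃ φ : ℕ → ℂ → ℂ, (∀ k < n, IsBranchAt p q c (φ k) (z k) ∧ φ k (z k) = z (k + 1)) ∧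
      1 < ‖deriv (branchComp φ n) (z 0)‖

/-- The Julia set `J_c`: the closure of the union of all repelling cycles of `𝐟_c`. -/
def julia (p q : ℕ) (c : ℂ) : Set ℂ :=
  closure {x | ∃ (n : ℕ) (z : ℕ → ℂ), IsRepellingCycle p q c n z ∧ ∃ k ≤ n, z k = x}

/-- The annulus `A_r = {r < |z| < 1 / (2 r)}`. -/
def annulus (r : ℝ) : Set ℂ := {z | r < ‖z‖ ∧ ‖z‖ < 1 / (2 * r)}

/-- The class `inv(A_r, c)` of semi-invariant compact subsets of `A_r ∩ (c + A_r)`. -/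
structure IsSemiInvariant (p q : ℕ) (c : ℂ) (r : ℝ) (Λ : Set ℂ) : Prop where
  isCompact : IsCompact Λ
  mem_annulus : ∀ z ∈ Λ, z ∈ annulus r ∧ z - c ∈ annulus r
  exists_image : ∀ z ∈ Λ, ∃ w ∈ Λ, Corr p q c z w
  exists_preimage : ∀ z ∈ Λ, ∃ w ∈ Λ, Corr p q c w z

/-- `Λ` is an expanding hyperbolic set of `𝐟_c` in `A_r ∩ (c + A_r)`: for some conformal metric
`μ(z)|dz|` on a region `V ⊇ Λ`, the infimum of `‖φ'(z)‖_μ`, over all `z ∈ V` and all branches `φ`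
of `𝐟_c` at `z` with `φ z ∈ V`, is larger than one. -/
def IsExpandingHyperbolic (p q : ℕ) (c : ℂ) (r : ℝ) (Λ : Set ℂ) : Prop :=
  IsSemiInvariant p q c r Λ ∧
    ∃ (V : Set ℂ) (μ : ℂ → ℝ), IsOpen V ∧ IsPreconnected V ∧ Λ ⊆ V ∧
      ContinuousOn μ V ∧ (∀ z ∈ V, 0 < μ z) ∧
      ∃ κ : ℝ, 1 < κ ∧ ∀ z ∈ V, ∀ φ : ℂ → ℂ, IsBranchAt p q c φ z → φ z ∈ V →
        κ ≤ μ (φ z) * ‖deriv φ z‖ / μ z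

/-- `(r, δ)` may be used as the parameters of the Cantor bundle of `Λ`: for every `z ∈ Λ`, each of
the sets `r (𝐟_c(z) ∩ Λ) + δ 𝔻̄` and `r (𝐟_c⁻¹(z) ∩ Λ) + δ 𝔻̄` consists of disjoint closed disks
contained in the closed unit disk. -/
structure IsScale (p q : ℕ) (c : ℂ) (r δ : ℝ) (Λ : Set ℂ) : Prop where
  r_pos : 0 < r
  r_lt : r < 1 / √2
  r_mul_lt : 4 * ‖c‖ * r < 1
  δ_pos : 0 < δ
  forward_disjoint : ∀ z ∈ Λ, ∀ w ∈ Λ, ∀ w' ∈ Λ, Corr p q c z w → Corr p q c z w' → w ≠ w' →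
    Disjoint (closedBall ((r : ℂ) * w) δ) (closedBall ((r : ℂ) * w') δ)
  forward_subset : ∀ z ∈ Λ, ∀ w ∈ Λ, Corr p q c z w →
    closedBall ((r : ℂ) * w) δ ⊆ closedBall (0 : ℂ) 1
  backward_disjoint : ∀ z ∈ Λ, ∀ w ∈ Λ, ∀ w' ∈ Λ, Corr p q c w z → Corr p q c w' z → w ≠ w' →
    Disjoint (closedBall ((r : ℂ) * w) δ) (closedBall ((r : ℂ) * w') δ)
  backward_subset : ∀ z ∈ Λ, ∀ w ∈ Λ, Corr p q c w z →
    closedBall ((r : ℂ) * w) δ ⊆ closedBall (0 : ℂ) 1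

/-- `z 0 → z 1 → z 2 → ⋯` is an orbit of `𝐟_c` contained in `Λ`. -/
def IsOrbitIn (p q : ℕ) (c : ℂ) (Λ : Set ℂ) (z : ℕ → ℂ) : Prop :=
  ∀ n, z n ∈ Λ ∧ Corr p q c (z n) (z (n + 1))

/-- `𝒟_n⁺(z)`: the union of the disks `r (z₁ + δ z₂ + ⋯ + δ ^ (n - 1) z_n) + δ ^ n 𝔻̄` over all
orbits `z → z₁ → z₂ → ⋯` in `Λ`. -/
def diskUnion (p q : ℕ) (c : ℂ) (r δ : ℝ) (Λ : Set ℂ) (n : ℕ) (z : ℂ) : Set ℂ :=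
  {s | ∃ x : ℕ → ℂ, IsOrbitIn p q c Λ x ∧ x 0 = z ∧
    s ∈ closedBall ((r : ℂ) * ∑ k ∈ Finset.range n, (δ : ℂ) ^ k * x (k + 1)) (δ ^ n)}

/-- The Cantor bundle `ℬ(Λ) = ⋃_{z ∈ Λ} {z} × 𝒞⁺(z)`, with `𝒞⁺(z) = ⋂_{n > 0} 𝒟_n⁺(z)`, of an
expanding hyperbolic set. -/
def cantorBundle (p q : ℕ) (c : ℂ) (r δ : ℝ) (Λ : Set ℂ) : Set (ℂ × ℂ) :=
  {x | x.1 ∈ Λ ∧ ∀ n : ℕ, 0 < n → x.2 ∈ diskUnion p q c r δ Λ n x.1}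

/-- The point `(z₀, r (z₁ + δ z₂ + δ² z₃ + ⋯))` of the bundle determined by an orbit `z`. -/
def bundlePoint (r δ : ℝ) (z : ℕ → ℂ) : ℂ × ℂ :=
  (z 0, (r : ℂ) * ∑' n : ℕ, (δ : ℂ) ^ n * z (n + 1))

/-- `f` is the bundle map of `Λ` on the `η`-neighbourhood of `ℬ(Λ)`: there it is holomorphic and of
the form `f(z, w) = (φ(z), δ⁻¹ w - r δ⁻¹ φ(z))`, where `φ` is locally the branch of `𝐟_c` that
sends `x₀` to `x₁` near the bundle point of the orbit `x₀ → x₁ → ⋯` in `Λ`.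
(A continuous `(f x).1` with `x.1 → (f x).1` is locally a branch of `𝐟_c` in the variable `x.1`, and
every point of the neighbourhood lies in a ball centred on `ℬ(Λ)`, so `f` is unique there.) -/
structure IsBundleMap (p q : ℕ) (c : ℂ) (r δ : ℝ) (Λ : Set ℂ) (η : ℝ) (f : ℂ × ℂ → ℂ × ℂ) :
    Prop where
  differentiableOn : DifferentiableOn ℂ f (thickening η (cantorBundle p q c r δ Λ))
  corr : ∀ x ∈ thickening η (cantorBundle p q c r δ Λ), Corr p q c x.1 (f x).1
  snd_eq : ∀ x ∈ thickening η (cantorBundle p q c r δ Λ),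
    (f x).2 = (δ : ℂ)⁻¹ * x.2 - (r : ℂ) * (δ : ℂ)⁻¹ * (f x).1
  branch : ∀ z : ℕ → ℂ, IsOrbitIn p q c Λ z → (f (bundlePoint r δ z)).1 = z 1

/-- The closure of the set of periodic points of `f : W → ℂ²`; by definition the cycle of a periodic
point is contained in `W`. -/
def mapJulia (W : Set (ℂ × ℂ)) (f : ℂ × ℂ → ℂ × ℂ) : Set (ℂ × ℂ) :=
  closure {x | ∃ n : ℕ, 0 < n ∧ (∀ k, f^[k] x ∈ W) ∧ f^[n] x = x}

/-- The Julia set `J(f_c) ⊆ ℂ²` of the bundle map `f` of `Λ`, taken on the `ρ`-neighbourhood of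
`ℬ(Λ)`. -/
def bundleJulia (p q : ℕ) (c : ℂ) (r δ : ℝ) (Λ : Set ℂ) (ρ : ℝ) (f : ℂ × ℂ → ℂ × ℂ) :
    Set (ℂ × ℂ) :=
  mapJulia (thickening ρ (cantorBundle p q c r δ Λ)) f

/-- `h : U × A → ℂ²` is a holomorphic motion with base point `c₀`. -/
structure IsHolomorphicMotion (U : Set ℂ) (A : Set (ℂ × ℂ)) (c₀ : ℂ) (h : ℂ → ℂ × ℂ → ℂ × ℂ) :
    Prop where
  isOpen : IsOpen U
  isConnected : IsConnected U
  base_mem : c₀ ∈ U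
  base : ∀ x ∈ A, h c₀ x = x
  injOn : ∀ c ∈ U, InjOn (h c) A
  holomorphic : ∀ x ∈ A, DifferentiableOn ℂ (fun c => h c x) U

/-- The projection `Λ_c = π h_c (A)`, where `π (z, w) = z`. -/
def movedSet (h : ℂ → ℂ × ℂ → ℂ × ℂ) (A : Set (ℂ × ℂ)) (c : ℂ) : Set ℂ :=
  Prod.fst '' (h c '' A)

/-- `h : U × ℬ(Λ₀) → ℂ²` is a holomorphic motion of the Cantor bundle of the expanding hyperbolic
set `Λ₀` of `𝐟_{c₀}` by conjugacies of bundle maps; `f c` is the bundle map of the moved hyperbolic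
set `Λ_c = π h_c (ℬ(Λ₀))`, on the `η c`-neighbourhood of `ℬ(Λ_c)`. -/
structure IsBundleMotion (p q : ℕ) (c₀ : ℂ) (r δ : ℝ) (Λ₀ : Set ℂ) (U : Set ℂ)
    (h : ℂ → ℂ × ℂ → ℂ × ℂ) (η : ℂ → ℝ) (f : ℂ → ℂ × ℂ → ℂ × ℂ) : Prop where
  motion : IsHolomorphicMotion U (cantorBundle p q c₀ r δ Λ₀) c₀ h
  hyperbolic : ∀ c ∈ U,
    IsExpandingHyperbolic p q c r (movedSet h (cantorBundle p q c₀ r δ Λ₀) c)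
  scale : ∀ c ∈ U, IsScale p q c r δ (movedSet h (cantorBundle p q c₀ r δ Λ₀) c)
  /-- `Λ_c` depends continuously on `c ∈ U` in the Hausdorff metric. -/
  continuous : ∀ c ∈ U,
    Tendsto (fun u => hausdorffEDist (movedSet h (cantorBundle p q c₀ r δ Λ₀) u)
      (movedSet h (cantorBundle p q c₀ r δ Λ₀) c)) (𝓝[U] c) (𝓝 0)
  η_pos : ∀ c ∈ U, 0 < η c
  bundleMap : ∀ c ∈ U,
    IsBundleMap p q c r δ (movedSet h (cantorBundle p q c₀ r δ Λ₀) c) (η c) (f c)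
  mapsTo : ∀ c ∈ U, MapsTo (h c) (cantorBundle p q c₀ r δ Λ₀)
    (cantorBundle p q c r δ (movedSet h (cantorBundle p q c₀ r δ Λ₀) c))
  invariant : ∀ c ∈ U, MapsTo (f c) (h c '' cantorBundle p q c₀ r δ Λ₀)
    (h c '' cantorBundle p q c₀ r δ Λ₀)
  conj : ∀ c ∈ U, ∀ x ∈ cantorBundle p q c₀ r δ Λ₀, h c (f c₀ x) = f c (h c x)
  lipschitz : ∃ C : ℝ, 0 < C ∧ ∀ u ∈ U, ∀ v ∈ U, ∀ x ∈ cantorBundle p q c₀ r δ Λ₀,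
    ‖h u x - h v x‖ ≤ C * ‖u - v‖

/-- The multifunction `𝐡(c, z) = π ∘ h_c ∘ (π|_S)⁻¹ (z)` induced by `S`. -/
def inducedMotion (h : ℂ → ℂ × ℂ → ℂ × ℂ) (S : Set (ℂ × ℂ)) (c z : ℂ) : Set ℂ :=
  {w | ∃ x ∈ S, x.1 = z ∧ (h c x).1 = w}

/-- The multifunction `H : U × A → ℂ` is a branched holomorphic motion with base point `c₀`. -/
structure IsBranchedHolomorphicMotion (U A : Set ℂ) (c₀ : ℂ) (H : ℂ → ℂ → Set ℂ) : Prop where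
  isOpen : IsOpen U
  isConnected : IsConnected U
  base_mem : c₀ ∈ U
  nonempty : ∀ c ∈ U, ∀ z ∈ A, (H c z).Nonempty
  base : ∀ z ∈ A, H c₀ z = {z}
  graphs : ∃ G : Set (ℂ → ℂ), (∀ g ∈ G, DifferentiableOn ℂ g U) ∧
    {x : ℂ × ℂ | x.1 ∈ U ∧ ∃ z ∈ A, x.2 ∈ H x.1 z} = {x | x.1 ∈ U ∧ ∃ g ∈ G, x.2 = g x.1}

end

end BranchedJulia

open BranchedJulia

/-! All branches of `𝐟_c` at `z ≠ 0` have derivative of the same modulus `expansion p q z`, so along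
orbits in an expanding hyperbolic set the inverse branches contract uniformly. Take an orbit `z` of
`𝐟_{c₀}` in `J = J_{c₀}` and solve backwards along it with `c₀` replaced by a nearby `c`: the
solutions converge to the only orbit of `𝐟_c` staying close to `z`, its `shadow`. A uniform limit of
holomorphic functions of `c`, it is holomorphic; the contraction also makes it Lipschitz in `c`,
injective in `z` and compatible with the shift (`Shadowing.dist_of_orbits`, `Shadowing.eq_shadow`,
`Shadowing.shadow_injective`).

Points of the Cantor bundle are coded homeomorphically by orbits (`bundlePoint_injOn`,
`cantorBundle_eq`, `continuousOn_orbitOf`), and in this coding the bundle map is the shift. The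
motion sends the point coded by `z` to the point coded by the shadow of `z`. Any other admissible
motion also yields orbits of `𝐟_c` close to `z` when `c` is close to `c₀`, hence the shadows, and
the identity theorem spreads the equality over the disc `U`.

The delicate point is to recognise `J_c` near `J`. It requires that `J` be backward invariant
(`julia_backward_invariant`). Then a neighbourhood `Ω` of `J` is backward invariant under every
nearby `𝐟_c`, each orbit in `Ω` is a shadow (`Shadowing.exists_eq_shadow`), and a repelling cycle of
`𝐟_c` meeting `Ω` lies in `Ω`, so it shadows a periodic orbit in `J`. Conversely, periodic orbits in
an expanding hyperbolic set are repelling. Thus `J_c ∩ Ω` and `π J(f_c)` are both the projection of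
the shadows of the closure of the periodic orbits in `J` (`Shadowing.bundleJulia_eq`,
`Shadowing.image_closure_periodicOrbits_eq`).

Backward invariance comes from transitivity: orbits starting arbitrarily near a repelling periodic
point reach every `w ≠ c` (`exists_reflTransGen_mem_ball`). An Ahlfors metric on the plane punctured
twice plays the role of Montel's theorem; the maximum principle is applied on a compact space of
orbit segments because iterates are multivalued. Let `w` be a preimage of a repelling periodic point
`z`. If the orbit from near `z` to `w` avoids `0`, the homoclinic loop can be closed up into
repelling cycles near `w` (`mem_julia_of_homoclinic`). Otherwise `z` is post-critical and repelling
cycles accumulate at `0` (`zero_mem_julia_of_postcritical`), which is impossible since `J` lies in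
an annulus. -/

namespace BranchedJulia

noncomputable section

/-! ### Branches and their derivatives -/

/-- The modulus of the derivative at `z` of every branch of `𝐟_c`. -/
def expansion (p q : ℕ) (z : ℂ) : ℝ := (p / q : ℝ) * ‖z‖ ^ ((p / q : ℝ) - 1)

section

variable {p q : ℕ} {c : ℂ}

theorem expansion_pos (hp : 0 < p) (hq : 0 < q) {z : ℂ} (hz : z ≠ 0) : 0 < expansion p q z := by
  unfold expansion
  have : 0 < ‖z‖ := norm_pos_iff.2 hz
  positivity

theorem expansion_zero (hq : 0 < q) (hpq : q < p) : expansion p q 0 = 0 := by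
  unfold expansion
  have hq' : (0 : ℝ) < q := by exact_mod_cast hq
  have : (p / q : ℝ) - 1 ≠ 0 := by
    have : (1 : ℝ) < p / q := by rw [lt_div_iff₀ hq']; simpa using (by exact_mod_cast hpq : (q : ℝ) < p)
    linarith
  simp [Real.zero_rpow this]

theorem expansion_nonneg (z : ℂ) : 0 ≤ expansion p q z := by
  unfold expansion; positivity

theorem continuous_expansion (hq : 0 < q) (hpq : q < p) : Continuous (expansion p q) := by
  unfold expansion
  have hq' : (0 : ℝ) < q := by exact_mod_cast hq
  have : 0 ≤ (p / q : ℝ) - 1 := by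
    have : (1 : ℝ) < p / q := by rw [lt_div_iff₀ hq']; simpa using (by exact_mod_cast hpq : (q : ℝ) < p)
    linarith
  exact continuous_const.mul (continuous_norm.rpow_const fun x => Or.inr this)

theorem Corr.norm_sub (hq : 0 < q) {z w : ℂ} (h : Corr p q c z w) :
    ‖w - c‖ = ‖z‖ ^ (p / q : ℝ) := by
  have h1 : ‖w - c‖ ^ q = ‖z‖ ^ p := by rw [← norm_pow, ← norm_pow, h]
  have h2 : (‖z‖ ^ (p / q : ℝ)) ^ q = ‖z‖ ^ p := by
    rw [← Real.rpow_natCast, ← Real.rpow_mul (norm_nonneg _), div_mul_cancel₀, Real.rpow_natCast]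
    exact_mod_cast hq.ne'
  exact (pow_left_inj₀ (norm_nonneg _) (by positivity) hq.ne').1 (h1.trans h2.symm)

theorem Corr.ne_of_ne_zero (hq : 0 < q) {z w : ℂ} (h : Corr p q c z w) (hz : z ≠ 0) : w ≠ c := by
  rintro rfl
  unfold Corr at h
  rw [sub_self, zero_pow hq.ne'] at h
  exact pow_ne_zero p hz h.symm

theorem Corr.ne_zero (hq : 0 < q) (hpq : q < p) {z w : ℂ} (h : Corr p q c z w) (hw : w ≠ c) :
    z ≠ 0 := by
  rintro rfl
  unfold Corr at h
  rw [zero_pow (by omega)] at h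
  exact hw (sub_eq_zero.1 ((pow_eq_zero_iff hq.ne').1 h))

theorem Corr.eq_of_zero (hq : 0 < q) (hpq : q < p) {w : ℂ} (h : Corr p q c 0 w) : w = c := by
  by_contra hw
  exact h.ne_zero hq hpq hw rfl

/-- Implicit differentiation of `(w - c) ^ q = z ^ p` in absolute values; it yields the modulus of
the derivative without choosing a branch. -/
theorem Corr.mul_expansion (hq : 0 < q) {z w : ℂ} (h : Corr p q c z w) (hz : z ≠ 0) :
    q * ‖w - c‖ ^ (q - 1) * expansion p q z = p * ‖z‖ ^ (p - 1 : ℝ) := by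
  have hq' : (q : ℝ) ≠ 0 := by exact_mod_cast hq.ne'
  have hz' : 0 < ‖z‖ := norm_pos_iff.2 hz
  rw [h.norm_sub hq, expansion, ← Real.rpow_natCast, ← Real.rpow_mul hz'.le,
    Nat.cast_sub (by omega : 1 ≤ q)]
  have : (p / q : ℝ) * ((q : ℝ) - (1 : ℕ)) + (p / q - 1) = p - 1 := by
    field_simp; push_cast; ring
  rw [← this, Real.rpow_add hz']
  field_simp

/-- The expansion in terms of both end points of a step. -/
theorem Corr.expansion_eq (hq : 0 < q) {z w : ℂ} (h : Corr p q c z w) (hz : z ≠ 0) :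
    expansion p q z = p / q * (‖w - c‖ / ‖z‖) := by
  have hz' : 0 < ‖z‖ := norm_pos_iff.2 hz
  rw [h.norm_sub hq, expansion, Real.rpow_sub hz', Real.rpow_one]

/-- If `a → b` pointwise under `𝐟_c` then `|b'| = |φ'| |a'|`. -/
theorem norm_deriv_of_corr (hq : 0 < q) (hpq : q < p) {a b : ℂ → ℂ} {u : ℂ}
    (ha : DifferentiableAt ℂ a u) (hb : DifferentiableAt ℂ b u)
    (h : ∀ᶠ v in 𝓝 u, Corr p q c (a v) (b v)) (h0 : a u ≠ 0) :
    ‖deriv b u‖ = expansion p q (a u) * ‖deriv a u‖ := by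
  have hc : Corr p q c (a u) (b u) := h.self_of_nhds
  have hbc : b u - c ≠ 0 := sub_ne_zero.2 (hc.ne_of_ne_zero hq h0)
  have h1 : HasDerivAt (fun v => (b v - c) ^ q) (q * (b u - c) ^ (q - 1) * deriv b u) u :=
    (hb.hasDerivAt.sub_const c).pow q
  have h2 : HasDerivAt (fun v => (a v) ^ p) (p * (a u) ^ (p - 1) * deriv a u) u :=
    ha.hasDerivAt.pow p
  have h3 : HasDerivAt (fun v => (b v - c) ^ q) (p * (a u) ^ (p - 1) * deriv a u) u :=
    h2.congr_of_eventuallyEq h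
  have h4 := congrArg norm (h1.unique h3)
  simp only [norm_mul, norm_pow, Complex.norm_natCast] at h4
  have h5 := hc.mul_expansion hq h0
  have h6 : ‖a u‖ ^ (p - 1 : ℝ) = ‖a u‖ ^ (p - 1) := by
    rw [← Real.rpow_natCast, Nat.cast_sub (by omega : 1 ≤ p)]; simp
  rw [h6] at h5
  rw [← h5] at h4
  have h7 : (q : ℝ) * ‖b u - c‖ ^ (q - 1) ≠ 0 := by
    have : (q : ℝ) ≠ 0 := by exact_mod_cast hq.ne'
    have := norm_ne_zero_iff.2 hbc
    positivity
  apply mul_left_cancel₀ h7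
  rw [h4]; ring

theorem IsBranchAt.norm_deriv (hq : 0 < q) (hpq : q < p) {φ : ℂ → ℂ} {z : ℂ}
    (h : IsBranchAt p q c φ z) (hz : z ≠ 0) : ‖deriv φ z‖ = expansion p q z := by
  simpa using norm_deriv_of_corr hq hpq (a := id) differentiableAt_id
    h.1.differentiableAt h.2 hz

end

/-- A nonvanishing analytic germ has an analytic `n`-th root with any prescribed value. -/
theorem exists_analyticAt_root {n : ℕ} (hn : n ≠ 0) {a : ℂ → ℂ} {u x : ℂ} (ha : AnalyticAt ℂ a u)
    (h : x ^ n = a u) (hx : x ≠ 0) :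
    ∃ b : ℂ → ℂ, AnalyticAt ℂ b u ∧ b u = x ∧ ∀ᶠ v in 𝓝 u, b v ^ n = a v := by
  have h0 : a u ≠ 0 := h ▸ pow_ne_zero n hx
  -- The quotient equals `1` at `u`, away from the branch cut; the factor `x` selects the prescribed
  -- root.
  refine ⟨fun v => x * (a v / a u) ^ (1 / n : ℂ), ?_, ?_, ?_⟩
  · refine analyticAt_const.mul ((ha.div analyticAt_const h0).cpow analyticAt_const ?_)
    simp [h0]
  · simp [h0]
  · refine Eventually.of_forall fun v => ?_
    rw [mul_pow, h, ← Complex.cpow_mul_nat, one_div, inv_mul_cancel₀ (by exact_mod_cast hn),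
      Complex.cpow_one, mul_div_cancel₀ _ h0]

/-- Distinct `n`-th roots of unity are separated from one. -/
theorem exists_root_separation {n : ℕ} (hn : 0 < n) :
    ∃ s : ℝ, 0 < s ∧ s ≤ 1 ∧ ∀ x y : ℂ, x ^ n = y ^ n → ‖x - y‖ < s * ‖x‖ → x = y := by
  have hfin : {ω : ℂ | ω ^ n = 1}.Finite := by
    have := (Polynomial.nthRootsFinset n (1 : ℂ)).finite_toSet
    refine this.subset fun ω hω => ?_
    simpa [Polynomial.mem_nthRootsFinset hn] using hω
  have hfin2 : ({ω : ℂ | ω ^ n = 1} \ {1}).Finite := hfin.subset sdiff_subset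
  obtain ⟨s, hs, hs'⟩ : ∃ s : ℝ, 0 < s ∧ ball (1 : ℂ) s ⊆ ({ω : ℂ | ω ^ n = 1} \ {1})ᶜ :=
    Metric.isOpen_iff.1 hfin2.isClosed.isOpen_compl 1 (by simp)
  refine ⟨min s 1, by positivity, min_le_right _ _, fun x y hxy hlt => ?_⟩
  have hx : x ≠ 0 := by
    rintro rfl
    simp at hlt
    exact absurd hlt (not_lt.2 (norm_nonneg y))
  by_contra hne
  have h1 : y / x ∈ ball (1 : ℂ) s := by
    rw [mem_ball, dist_eq_norm, div_sub_one hx, norm_div, norm_sub_rev,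
      div_lt_iff₀ (norm_pos_iff.2 hx)]
    exact hlt.trans_le (mul_le_mul_of_nonneg_right (min_le_left _ _) (norm_nonneg _))
  apply hs' h1
  refine ⟨?_, ?_⟩
  · rw [mem_ofPred_eq, div_pow, hxy, div_self]
    rw [← hxy]; exact pow_ne_zero n hx
  · rw [mem_singleton_iff, div_eq_one_iff_eq hx]
    exact fun h => hne h.symm

/-! ### Paths avoiding the critical point -/

/-- `Path p q c z w m`: there is a finite path `z → z₁ → ⋯ → w` of `𝐟_c`, all points of which except
possibly the last one are nonzero; the derivative of the corresponding composition of branches has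
modulus `m`. -/
inductive Path (p q : ℕ) (c : ℂ) : ℂ → ℂ → ℝ → Prop
  | nil (z : ℂ) : Path p q c z z 1
  | cons {z w y : ℂ} {m : ℝ} (hz : z ≠ 0) (h : Corr p q c z w) (hp : Path p q c w y m) :
      Path p q c z y (expansion p q z * m)

/-- `γ` is, at `v`, an inverse of a composition of branches along a path ending at `v`. -/
def IsInverseBranch (p q : ℕ) (c : ℂ) (γ : ℂ → ℂ) (v : ℂ) : Prop :=
  AnalyticAt ℂ γ v ∧ ∃ m, Path p q c (γ v) v m ∧ m * ‖deriv γ v‖ = 1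

theorem IsInverseBranch.deriv_ne_zero {p q : ℕ} {c v : ℂ} {γ : ℂ → ℂ}
    (h : IsInverseBranch p q c γ v) : deriv γ v ≠ 0 := by
  intro h0
  obtain ⟨-, m, -, hm⟩ := h
  simp [h0] at hm

namespace Path

variable {p q : ℕ} {c : ℂ}

theorem trans {x y z : ℂ} {m n : ℝ} (h : Path p q c x y m) (h' : Path p q c y z n) :
    Path p q c x z (m * n) := by
  induction h with
  | nil z => simpa using h'
  | cons hz hc _ ih => rw [mul_assoc]; exact cons hz hc (ih h')

theorem single {z w : ℂ} (hz : z ≠ 0) (h : Corr p q c z w) : Path p q c z w (expansion p q z) := by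
  simpa using cons hz h (nil w)

theorem pos (hq : 0 < q) (hpq : q < p) {x y : ℂ} {m : ℝ} (h : Path p q c x y m) : 0 < m := by
  induction h with
  | nil z => norm_num
  | cons hz hc _ ih => exact mul_pos (expansion_pos (by omega) hq hz) ih

theorem ne_zero {x y : ℂ} {m : ℝ} (h : Path p q c x y m) (hm : m ≠ 1) : x ≠ 0 := by
  cases h with
  | nil z => exact absurd rfl hm
  | cons hz hc _ => exact hz

theorem iterate {x : ℂ} {m : ℝ} (h : Path p q c x x m) (k : ℕ) : Path p q c x x (m ^ k) := by
  induction k with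
  | zero => simpa using nil x
  | succ k ih => rw [pow_succ]; exact ih.trans h

/-- A path as a sequence. -/
theorem exists_seq {x y : ℂ} {m : ℝ} (h : Path p q c x y m) :
    ∃ (n : ℕ) (ζ : ℕ → ℂ), ζ 0 = x ∧ ζ n = y ∧ (∀ k < n, ζ k ≠ 0 ∧ Corr p q c (ζ k) (ζ (k + 1))) ∧
      (∀ k, n < k → ζ k = 0) ∧ ∏ k ∈ Finset.range n, expansion p q (ζ k) = m := by
  induction h with
  | nil z =>
    refine ⟨0, fun k => if k = 0 then z else 0, by simp, by simp, by simp, ?_, by simp⟩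
    intro k hk
    simp [hk.ne']
  | @cons z w y m hz hc _ ih =>
    obtain ⟨n, ζ, h0, hn, hs, ht, hm⟩ := ih
    refine ⟨n + 1, fun k => Nat.casesOn k z ζ, rfl, hn, ?_, ?_, ?_⟩
    · rintro (_ | k) hk
      · exact ⟨hz, by simpa [h0] using hc⟩
      · exact hs k (by omega)
    · rintro (_ | k) hk
      · omega
      · exact ht k (by omega)
    · rw [Finset.prod_range_succ', mul_comm]
      simp [hm]

/-- Inverse branches along a path. -/
theorem exists_inverse (hq : 0 < q) (hpq : q < p) {x y : ℂ} {m : ℝ} (h : Path p q c x y m) :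
    ∃ γ : ℂ → ℂ, γ y = x ∧ m * ‖deriv γ y‖ = 1 ∧ ∀ᶠ v in 𝓝 y, IsInverseBranch p q c γ v := by
  induction h with
  | nil z => exact ⟨id, rfl, by simp, Eventually.of_forall fun v =>
      ⟨analyticAt_id, 1, nil v, by simp⟩⟩
  | @cons z w y m hz hc _ ih =>
    obtain ⟨γ, hγy, hγm, hev⟩ := ih
    have hw : w - c ≠ 0 := sub_ne_zero.2 (hc.ne_of_ne_zero hq hz)
    have hγ : AnalyticAt ℂ γ y := hev.self_of_nhds.1
    obtain ⟨b, hb, hbz, hbp⟩ := exists_analyticAt_root (n := p) (by omega)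
      (a := fun v => (γ v - c) ^ q) (u := y) (x := z)
      ((hγ.sub analyticAt_const).pow q) (by rw [hγy]; exact hc.symm) hz
    have hb0 : ∀ᶠ v in 𝓝 y, b v ≠ 0 := hb.continuousAt.eventually_ne (by rw [hbz]; exact hz)
    -- The identity is recorded at all nearby `v` and not only at `y`: the cycles constructed later
    -- run close to the given path, not along it.
    have hd : ∀ᶠ v in 𝓝 y, ‖deriv γ v‖ = expansion p q (b v) * ‖deriv b v‖ := by
      filter_upwards [hev, hbp.eventually_nhds, hb0, hb.eventually_analyticAt]
        with v hγv hv hv0 hba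
      exact norm_deriv_of_corr hq hpq hba.differentiableAt hγv.1.differentiableAt
        (hv.mono fun x hx => hx.symm) hv0 (c := c)
    refine ⟨b, hbz, ?_, ?_⟩
    · rw [← hγm, hd.self_of_nhds, hbz]; ring
    · filter_upwards [hev, hbp, hb0, hb.eventually_analyticAt, hd]
        with v ⟨hγa, m', hm', hm1⟩ hv hv0 hba hdv
      refine ⟨hba, expansion p q (b v) * m', cons hv0 (hv.symm : Corr p q c (b v) (γ v)) hm', ?_⟩
      rw [← hm1, hdv]; ring

end Path

theorem IsInverseBranch.comp {p q : ℕ} {c v : ℂ} {γ γ' : ℂ → ℂ} (h' : IsInverseBranch p q c γ' (γ v))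
    (h : IsInverseBranch p q c γ v) : IsInverseBranch p q c (γ' ∘ γ) v := by
  obtain ⟨ha', m', hp', hm'⟩ := h'
  obtain ⟨ha, m, hp, hm⟩ := h
  refine ⟨ha'.comp ha, m' * m, hp'.trans hp, ?_⟩
  rw [deriv_comp v ha'.differentiableAt ha.differentiableAt, norm_mul]
  calc _ = (m' * ‖deriv γ' (γ v)‖) * (m * ‖deriv γ v‖) := by ring
    _ = 1 := by rw [hm, hm', one_mul]

/-- Forward branches along a sequence. -/
theorem exists_forward_branches {p q : ℕ} {c : ℂ} (hq : 0 < q) (hpq : q < p) (ζ : ℕ → ℂ) (n : ℕ)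
    (h : ∀ k < n, ζ k ≠ 0 ∧ Corr p q c (ζ k) (ζ (k + 1))) :
    ∃ ψ : ℕ → ℂ → ℂ, ψ 0 = id ∧ (∀ k ≤ n, AnalyticAt ℂ (ψ k) (ζ 0) ∧ ψ k (ζ 0) = ζ k) ∧
      ∀ᶠ u in 𝓝 (ζ 0), (∀ k < n, ψ k u ≠ 0 ∧ Corr p q c (ψ k u) (ψ (k + 1) u)) ∧
        ‖deriv (ψ n) u‖ = ∏ k ∈ Finset.range n, expansion p q (ψ k u) := by
  induction n with
  | zero => exact ⟨fun _ => id, rfl, fun k hk => by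
      obtain rfl : k = 0 := by omega
      exact ⟨analyticAt_id, rfl⟩, Eventually.of_forall fun u => by simp⟩
  | succ n ih =>
    obtain ⟨ψ, h0, hψ, hev⟩ := ih fun k hk => h k (by omega)
    obtain ⟨hz, hc⟩ := h n (by omega)
    have hw : ζ (n + 1) - c ≠ 0 := sub_ne_zero.2 (hc.ne_of_ne_zero hq hz)
    obtain ⟨b, hb, hbz, hbp⟩ := exists_analyticAt_root (n := q) (by omega)
      (a := fun v => (ψ n v) ^ p) (u := ζ 0) (x := ζ (n + 1) - c)
      ((hψ n le_rfl).1.pow p) (by rw [(hψ n le_rfl).2]; exact hc) hw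
    refine ⟨fun k => if k = n + 1 then fun v => b v + c else ψ k, by simp [h0], ?_, ?_⟩
    · intro k hk
      by_cases hkn : k = n + 1
      · subst hkn
        simp only [if_true]
        exact ⟨hb.add analyticAt_const, by rw [hbz]; ring⟩
      · simp only [hkn, if_false]
        exact hψ k (by omega)
    · have hn0 : ∀ᶠ v in 𝓝 (ζ 0), ψ n v ≠ 0 :=
        (hψ n le_rfl).1.continuousAt.eventually_ne (by rw [(hψ n le_rfl).2]; exact hz)
      filter_upwards [hev, hbp.eventually_nhds, hn0, hb.eventually_analyticAt,
        (hψ n le_rfl).1.eventually_analyticAt] with v ⟨hv, hd⟩ hbv hv0 hba hψa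
      have hcorr : ∀ᶠ x in 𝓝 v, Corr p q c (ψ n x) (b x + c) := hbv.mono fun x hx => by
        simpa [Corr] using hx
      constructor
      · intro k hk
        by_cases hkn : k = n
        · subst hkn
          simp only [if_true, show ¬ (k = k + 1) by omega, if_false]
          exact ⟨hv0, hcorr.self_of_nhds⟩
        · simp only [show ¬ (k = n + 1) by omega, show ¬ (k + 1 = n + 1) by omega, if_false]
          exact hv k (by omega)
      · have hder := norm_deriv_of_corr hq hpq hψa.differentiableAt
          (hba.differentiableAt.add_const c) hcorr hv0
        simp only [if_true]
        rw [hder, hd, Finset.prod_range_succ, mul_comm]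
        congr 1
        · refine Finset.prod_congr rfl fun k hk => ?_
          have : k < n := Finset.mem_range.1 hk
          simp [show ¬ (k = n + 1) by omega]
        · simp

/-! ### Repelling cycles -/

theorem deriv_branchComp {p q : ℕ} {c : ℂ} (hq : 0 < q) (hpq : q < p) {z : ℕ → ℂ} {φ : ℕ → ℂ → ℂ}
    (n : ℕ) (h : ∀ k < n, IsBranchAt p q c (φ k) (z k) ∧ φ k (z k) = z (k + 1))
    (h0 : ∀ k < n, z k ≠ 0) :
    branchComp φ n (z 0) = z n ∧ DifferentiableAt ℂ (branchComp φ n) (z 0) ∧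
      ‖deriv (branchComp φ n) (z 0)‖ = ∏ k ∈ Finset.range n, expansion p q (z k) := by
  induction n with
  | zero => simp [branchComp]
  | succ n ih =>
    obtain ⟨h1, h2, h3⟩ := ih (fun k hk => h k (by omega)) (fun k hk => h0 k (by omega))
    obtain ⟨hb, hz⟩ := h n (by omega)
    have hd : DifferentiableAt ℂ (φ n) (branchComp φ n (z 0)) := by
      rw [h1]; exact hb.1.differentiableAt
    refine ⟨by simp [branchComp, h1, hz], hd.comp _ h2, ?_⟩
    rw [branchComp, deriv_comp _ hd h2, norm_mul, h1, hb.norm_deriv hq hpq (h0 n (by omega)), h3,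
      Finset.prod_range_succ, mul_comm]

theorem exists_branch {p q : ℕ} {c : ℂ} (hq : 0 < q) {z w : ℂ} (hz : z ≠ 0)
    (h : Corr p q c z w) : ∃ φ : ℂ → ℂ, IsBranchAt p q c φ z ∧ φ z = w := by
  obtain ⟨b, hb, hbz, hbp⟩ := exists_analyticAt_root (n := q) (by omega)
    (a := fun v => v ^ p) (u := z) (x := w - c) (analyticAt_id.pow p) h
    (sub_ne_zero.2 (h.ne_of_ne_zero hq hz))
  exact ⟨fun v => b v + c, ⟨hb.add analyticAt_const, hbp.mono fun v hv => by simpa [Corr] using hv⟩,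
    by simp [hbz]⟩

/-- A closed path of nonzero points is repelling iff the product of the expansions is `> 1`. -/
theorem isRepellingCycle_iff {p q : ℕ} {c : ℂ} (hq : 0 < q) (hpq : q < p) {n : ℕ} {z : ℕ → ℂ} :
    IsRepellingCycle p q c n z ↔ 0 < n ∧ z n = z 0 ∧ (∀ k < n, Corr p q c (z k) (z (k + 1))) ∧
      (∀ k ≤ n, z k ≠ 0) ∧ 1 < ∏ k ∈ Finset.range n, expansion p q (z k) := by
  constructor
  · rintro ⟨hn, hz, hc, h0, φ, hφ, hd⟩
    rw [(deriv_branchComp hq hpq n hφ fun k hk => h0 k hk.le).2.2] at hd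
    exact ⟨hn, hz, hc, h0, hd⟩
  · rintro ⟨hn, hz, hc, h0, hd⟩
    have : ∀ k, ∃ φ : ℂ → ℂ, k < n → IsBranchAt p q c φ (z k) ∧ φ (z k) = z (k + 1) := by
      intro k
      by_cases hk : k < n
      · obtain ⟨φ, hφ⟩ := exists_branch hq (h0 k hk.le) (hc k hk)
        exact ⟨φ, fun _ => hφ⟩
      · exact ⟨id, fun h => absurd h hk⟩
    choose φ hφ using this
    refine ⟨hn, hz, hc, h0, φ, hφ, ?_⟩
    rw [(deriv_branchComp hq hpq n hφ fun k hk => h0 k hk.le).2.2]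
    exact hd

theorem Path.mem_julia {p q : ℕ} {c : ℂ} (hq : 0 < q) (hpq : q < p) {x : ℂ} {m : ℝ}
    (h : Path p q c x x m) (hm : 1 < m) : x ∈ julia p q c := by
  obtain ⟨n, ζ, h0, hn, hs, -, hp⟩ := h.exists_seq
  refine subset_closure ⟨n, ζ, (isRepellingCycle_iff hq hpq).2 ⟨?_, by rw [hn, h0],
    fun k hk => (hs k hk).2, ?_, by rwa [hp]⟩, 0, by omega, h0⟩
  · rcases Nat.eq_zero_or_pos n with rfl | hn'
    · simp at hp; linarith
    · exact hn'
  · intro k hk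
    rcases hk.lt_or_eq with hk | rfl
    · exact (hs k hk).1
    · rw [hn]; exact h.ne_zero hm.ne'

/-- A stretch of a sequence is a path. -/
theorem Path.of_seq {p q : ℕ} {c : ℂ} {z : ℕ → ℂ} (a n : ℕ)
    (h : ∀ k < n, z (a + k) ≠ 0 ∧ Corr p q c (z (a + k)) (z (a + k + 1))) :
    Path p q c (z a) (z (a + n)) (∏ k ∈ Finset.range n, expansion p q (z (a + k))) := by
  induction n with
  | zero => simpa using Path.nil (z a)
  | succ n ih =>
    rw [Finset.prod_range_succ]
    exact (ih fun k hk => h k (by omega)).trans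
      (Path.single (h n (by omega)).1 (h n (by omega)).2)

/-- Cutting the cycle at `z k` and exchanging the two arcs only permutes the factors, so the
multiplier does not depend on the base point. -/
theorem IsRepellingCycle.exists_path {p q : ℕ} {c : ℂ} (hq : 0 < q) (hpq : q < p) {n : ℕ}
    {z : ℕ → ℂ} (h : IsRepellingCycle p q c n z) {k : ℕ} (hk : k ≤ n) :
    ∃ m, 1 < m ∧ Path p q c (z k) (z k) m := by
  obtain ⟨hn, hz, hc, h0, hd⟩ := (isRepellingCycle_iff hq hpq).1 h
  have h1 := Path.of_seq (p := p) (q := q) (c := c) (z := z) 0 k fun j hj => by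
    rw [zero_add]; exact ⟨h0 j (by omega), hc j (by omega)⟩
  have h2 := Path.of_seq (p := p) (q := q) (c := c) (z := z) k (n - k) fun j hj =>
    ⟨h0 _ (by omega), hc _ (by omega)⟩
  rw [show k + (n - k) = n by omega, hz] at h2
  simp only [zero_add] at h1
  refine ⟨_, ?_, h2.trans h1⟩
  convert hd using 1
  rw [mul_comm, ← Finset.prod_range_mul_prod_Ico _ hk, Finset.prod_Ico_eq_prod_range]

/-! ### An Ahlfors-type estimate on the plane punctured at two points -/

/-- This replaces the curvature comparison in Ahlfors' lemma. If the conclusion failed, second order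
expansion would give `(1 - ‖m₀‖²)² (1 + ‖m‖²) > 1` at all nearby points other than `u₀`. Maximality
would then make `u₀` a local maximum of `‖h‖`, so `h` would be locally constant by the maximum
principle, and the strict inequality would contradict maximality. -/
theorem norm_deriv_sq_le_of_local_max {h m₀ m : ℂ → ℂ} {u₀ : ℂ} (hh : AnalyticAt ℂ h u₀)
    (hm₀ : AnalyticAt ℂ m₀ u₀) (hm : AnalyticAt ℂ m u₀) (h0 : m₀ u₀ = 0) (h1 : m u₀ = 0)
    (hne : h u₀ ≠ 0)
    (hmax : ∀ᶠ u in 𝓝 u₀, ‖h u‖ ^ 2 * (1 - ‖m₀ u‖ ^ 2) ^ 2 * (1 + ‖m u‖ ^ 2) ≤ ‖h u₀‖ ^ 2) :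
    ‖deriv m u₀‖ ^ 2 ≤ 2 * ‖deriv m₀ u₀‖ ^ 2 := by
  by_contra! hlt
  set n₀ := dslope m₀ u₀
  set n := dslope m u₀
  have hn₀ : ContinuousAt n₀ u₀ := continuousAt_dslope_same.2 hm₀.differentiableAt
  have hn : ContinuousAt n u₀ := continuousAt_dslope_same.2 hm.differentiableAt
  have e0 : n₀ u₀ = deriv m₀ u₀ := dslope_same _ _
  have e1 : n u₀ = deriv m u₀ := dslope_same _ _
  have hF : ContinuousAt (fun u => ‖n u‖ ^ 2 - 2 * ‖n₀ u‖ ^ 2 -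
      2 * ‖u - u₀‖ ^ 2 * ‖n₀ u‖ ^ 2 * ‖n u‖ ^ 2) u₀ := by fun_prop
  have hF0 : ∀ᶠ u in 𝓝 u₀, 0 < ‖n u‖ ^ 2 - 2 * ‖n₀ u‖ ^ 2 -
      2 * ‖u - u₀‖ ^ 2 * ‖n₀ u‖ ^ 2 * ‖n u‖ ^ 2 := by
    refine hF.eventually (lt_mem_nhds ?_)
    simp only [sub_self, norm_zero, e0, e1]
    nlinarith
  have hm₀u : ∀ u, m₀ u = (u - u₀) * n₀ u := fun u => by
    have := sub_smul_dslope m₀ u₀ u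
    rw [h0, sub_zero] at this
    simpa [n₀] using this.symm
  have hmu : ∀ u, m u = (u - u₀) * n u := fun u => by
    have := sub_smul_dslope m u₀ u
    rw [h1, sub_zero] at this
    simpa [n] using this.symm
  have key : ∀ᶠ u in 𝓝 u₀, u ≠ u₀ → 1 < (1 - ‖m₀ u‖ ^ 2) ^ 2 * (1 + ‖m u‖ ^ 2) := by
    filter_upwards [hF0] with u hu hne'
    have hd : 0 < ‖u - u₀‖ ^ 2 := by
      have := norm_pos_iff.2 (sub_ne_zero.2 hne'); positivity
    rw [hm₀u, hmu, norm_mul, norm_mul, mul_pow, mul_pow]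
    set D := ‖u - u₀‖ ^ 2
    set a := ‖n₀ u‖ ^ 2 with ha
    set b := ‖n u‖ ^ 2 with hb
    have ha' : 0 ≤ a := by positivity
    have hb' : 0 ≤ b := by positivity
    have h3 : 0 < D * (b - 2 * a - 2 * D * a * b) := mul_pos hd hu
    nlinarith [mul_nonneg (sq_nonneg (D * a)) (by positivity : 0 ≤ 1 + D * b)]
  have hle : ∀ᶠ u in 𝓝 u₀, ‖h u‖ ≤ ‖h u₀‖ := by
    filter_upwards [hmax, key] with u hu hk
    by_cases hu0 : u = u₀
    · rw [hu0]
    · have := hk hu0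
      refine le_of_sq_le_sq ?_ (norm_nonneg _)
      nlinarith [sq_nonneg ‖h u‖]
  have hconst : ∀ᶠ u in 𝓝 u₀, h u = h u₀ :=
    Complex.eventually_eq_of_isLocalMax_norm
      (hh.eventually_analyticAt.mono fun u hu => hu.differentiableAt) hle
  obtain ⟨u, hu, hu1, hu2, hu3⟩ := ((eventually_mem_nhdsWithin (a := u₀) (s := {u₀}ᶜ)).and
    (((hmax.and (key.and hconst))).filter_mono nhdsWithin_le_nhds)).exists
  have h4 := hu2 hu
  rw [hu3] at hu1
  have : 0 < ‖h u₀‖ ^ 2 := by have := norm_pos_iff.2 hne; positivity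
  nlinarith

/-- The square of the density at `y` of the factor at `A` of the Ahlfors metric. -/
def ahlforsDensity (A y : ℂ) : ℝ :=
  (1 + (‖y - A‖ ^ (1 / 6 : ℝ)) ^ 2) / (‖y - A‖ ^ (1 / 6 : ℝ)) ^ 10

theorem ahlforsDensity_pos {A y : ℂ} (h : y ≠ A) : 0 < ahlforsDensity A y := by
  have := norm_pos_iff.2 (sub_ne_zero.2 h)
  unfold ahlforsDensity
  positivity

theorem continuousAt_ahlforsDensity {A y : ℂ} (h : y ≠ A) :
    ContinuousAt (ahlforsDensity A) y := by
  have h0 := norm_pos_iff.2 (sub_ne_zero.2 h)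
  have h1 : ContinuousAt (fun y : ℂ => ‖y - A‖ ^ (1 / 6 : ℝ)) y :=
    ContinuousAt.rpow_const (by fun_prop) (Or.inr (by norm_num))
  unfold ahlforsDensity
  refine ContinuousAt.div (by fun_prop) (by fun_prop) ?_
  positivity

/-- With `a` fixed, this writes `1 + ‖b‖²`, up to a constant, as `‖1 + ā b‖² (1 + ‖m‖²)`, where `m`
is a Möbius function of `b` vanishing at `a`. It separates the modulus of a holomorphic function
from a factor that is stationary at `a`. The next identity is the hyperbolic counterpart on a disc
of radius `s`. -/
theorem one_add_norm_sq_mul (a b : ℂ) :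
    (1 + ‖b‖ ^ 2) * (1 + ‖a‖ ^ 2) = ‖1 + starRingEnd ℂ a * b‖ ^ 2 + ‖b - a‖ ^ 2 := by
  simp only [← Complex.normSq_eq_norm_sq, Complex.normSq_apply]
  simp
  ring

theorem sub_norm_sq_mul (s : ℝ) (a b : ℂ) :
    (s ^ 2 - ‖b‖ ^ 2) * (s ^ 2 - ‖a‖ ^ 2) =
      ‖(s : ℂ) ^ 2 - starRingEnd ℂ a * b‖ ^ 2 - s ^ 2 * ‖b - a‖ ^ 2 := by
  rw [← Complex.ofReal_pow]
  generalize s ^ 2 = t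
  simp only [← Complex.normSq_eq_norm_sq, Complex.normSq_apply]
  simp
  ring

/-- A sixth root of `X - A` near a point where it does not vanish. -/
theorem exists_sixth_root {X : ℂ → ℂ} {u₀ A : ℂ} (hX : AnalyticAt ℂ X u₀) (hA : X u₀ ≠ A) :
    ∃ τ : ℂ → ℂ, AnalyticAt ℂ τ u₀ ∧ τ u₀ ≠ 0 ∧ (∀ᶠ u in 𝓝 u₀, τ u ^ 6 = X u - A) ∧
      deriv X u₀ = 6 * τ u₀ ^ 5 * deriv τ u₀ := by
  obtain ⟨t, ht⟩ := IsAlgClosed.exists_pow_nat_eq (X u₀ - A) (n := 6) (by norm_num)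
  have ht0 : t ≠ 0 := by
    rintro rfl
    exact hA (sub_eq_zero.1 (by rw [← ht]; norm_num))
  obtain ⟨τ, hτ, hτ0, hev⟩ := exists_analyticAt_root (n := 6) (by norm_num)
    (a := fun u => X u - A) (hX.sub analyticAt_const) ht ht0
  refine ⟨τ, hτ, by rwa [hτ0], hev, ?_⟩
  have h1 : HasDerivAt (fun u => τ u ^ 6) ((6 : ℕ) * τ u₀ ^ (6 - 1) * deriv τ u₀) u₀ :=
    hτ.differentiableAt.hasDerivAt.pow 6
  have h2 : HasDerivAt (fun u => X u - A) (deriv X u₀) u₀ :=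
    hX.differentiableAt.hasDerivAt.sub_const A
  have := h2.unique (h1.congr_of_eventuallyEq (hev.mono fun u hu => hu.symm))
  simpa using this

theorem ahlforsDensity_eq_of_pow {A y t : ℂ} (h : t ^ 6 = y - A) :
    ahlforsDensity A y = (1 + ‖t‖ ^ 2) / ‖t‖ ^ 10 := by
  have : ‖y - A‖ ^ (1 / 6 : ℝ) = ‖t‖ := by
    rw [← h, norm_pow, ← Real.rpow_natCast, ← Real.rpow_mul (norm_nonneg _)]
    norm_num
  rw [ahlforsDensity, this]

/-- The ratio by which a local maximum of the density is controlled by one of the punctures. -/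
theorem sq_le_of_local_max {X : ℂ → ℂ} {u₀ x A₁ A₂ : ℂ} {s : ℝ} (hX : AnalyticAt ℂ X u₀)
    (h1 : X u₀ ≠ A₁) (h2 : X u₀ ≠ A₂) (hX' : deriv X u₀ ≠ 0) (hs : ‖u₀ - x‖ < s)
    (hmax : ∀ᶠ u in 𝓝 u₀, (s ^ 2 - ‖u - x‖ ^ 2) ^ 2 * ‖deriv X u‖ ^ 2 *
        (ahlforsDensity A₁ (X u) * ahlforsDensity A₂ (X u)) ≤
      (s ^ 2 - ‖u₀ - x‖ ^ 2) ^ 2 * ‖deriv X u₀‖ ^ 2 *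
        (ahlforsDensity A₁ (X u₀) * ahlforsDensity A₂ (X u₀))) :
    (s ^ 2 - ‖u₀ - x‖ ^ 2) ^ 2 * ‖deriv X u₀‖ ^ 2 ≤
      72 * s ^ 2 * ((‖X u₀ - A₁‖ ^ (1 / 6 : ℝ)) ^ 10 * (1 + (‖X u₀ - A₁‖ ^ (1 / 6 : ℝ)) ^ 2) ^ 2) := by
  obtain ⟨τ₁, hτ₁, n₁, e₁, d₁⟩ := exists_sixth_root hX h1
  obtain ⟨τ₂, hτ₂, n₂, e₂, d₂⟩ := exists_sixth_root hX h2
  have hs0 : 0 < s := (norm_nonneg _).trans_lt hs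
  have hpos : 0 < s ^ 2 - ‖u₀ - x‖ ^ 2 := by nlinarith [norm_nonneg (u₀ - x)]
  have ha : ‖X u₀ - A₁‖ ^ (1 / 6 : ℝ) = ‖τ₁ u₀‖ := by
    rw [← e₁.self_of_nhds, norm_pow, ← Real.rpow_natCast, ← Real.rpow_mul (norm_nonneg _)]
    norm_num
  rw [ha]
  have hc : ∀ a : ℂ, 1 + starRingEnd ℂ a * a = ((1 + ‖a‖ ^ 2 : ℝ) : ℂ) := fun a => by
    rw [mul_comm, Complex.mul_conj, Complex.normSq_eq_norm_sq]; push_cast; ring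
  have hc' : ∀ a : ℂ, (s : ℂ) ^ 2 - starRingEnd ℂ a * a = ((s ^ 2 - ‖a‖ ^ 2 : ℝ) : ℂ) := fun a => by
    rw [mul_comm, Complex.mul_conj, Complex.normSq_eq_norm_sq]; push_cast; ring
  have hn : ∀ a : ℂ, ((1 + ‖a‖ ^ 2 : ℝ) : ℂ) ≠ 0 := fun a => by
    exact_mod_cast (by positivity : (1 + ‖a‖ ^ 2 : ℝ) ≠ 0)
  have hn0 : ((s ^ 2 - ‖u₀ - x‖ ^ 2 : ℝ) : ℂ) ≠ 0 := by exact_mod_cast hpos.ne'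
  -- Denominators of the Möbius maps that carry `τ₁ u₀`, `τ₂ u₀` and `u₀ - x` to `0`.
  set k₁ : ℂ → ℂ := fun u => 1 + starRingEnd ℂ (τ₁ u₀) * τ₁ u
  set k₂ : ℂ → ℂ := fun u => 1 + starRingEnd ℂ (τ₂ u₀) * τ₂ u
  set k₀ : ℂ → ℂ := fun u => (s : ℂ) ^ 2 - starRingEnd ℂ (u₀ - x) * (u - x)
  have ak₁ : AnalyticAt ℂ k₁ u₀ := analyticAt_const.add (analyticAt_const.mul hτ₁)
  have ak₂ : AnalyticAt ℂ k₂ u₀ := analyticAt_const.add (analyticAt_const.mul hτ₂)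
  have ak₀ : AnalyticAt ℂ k₀ u₀ :=
    analyticAt_const.sub (analyticAt_const.mul (analyticAt_id.sub analyticAt_const))
  have v₁ : k₁ u₀ = ((1 + ‖τ₁ u₀‖ ^ 2 : ℝ) : ℂ) := hc _
  have v₂ : k₂ u₀ = ((1 + ‖τ₂ u₀‖ ^ 2 : ℝ) : ℂ) := hc _
  have v₀ : k₀ u₀ = ((s ^ 2 - ‖u₀ - x‖ ^ 2 : ℝ) : ℂ) := hc' _
  have w₁ : k₁ u₀ ≠ 0 := v₁ ▸ hn _
  have w₂ : k₂ u₀ ≠ 0 := v₂ ▸ hn _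
  have w₀ : k₀ u₀ ≠ 0 := v₀ ▸ hn0
  set m₁ : ℂ → ℂ := fun u => (τ₁ u - τ₁ u₀) / k₁ u
  set m₀ : ℂ → ℂ := fun u => s * (u - u₀) / k₀ u
  have am₁ : AnalyticAt ℂ m₁ u₀ := (hτ₁.sub analyticAt_const).div ak₁ w₁
  have am₀ : AnalyticAt ℂ m₀ u₀ :=
    (analyticAt_const.mul (analyticAt_id.sub analyticAt_const)).div ak₀ w₀
  -- The holomorphic part of the density: apart from the constants at `u₀`, the pulled back density
  -- bounds `‖h‖² (1 - ‖m₀‖²)² (1 + ‖m₁‖²)` from above, with equality at `u₀`.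
  set h : ℂ → ℂ := fun u => k₀ u ^ 2 * deriv X u * (k₁ u / τ₁ u ^ 5) * (k₂ u / τ₂ u ^ 5)
  have ah : AnalyticAt ℂ h u₀ :=
    ((((ak₀.pow 2).mul hX.deriv).mul (ak₁.div (hτ₁.pow 5) (pow_ne_zero 5 n₁))).mul
      (ak₂.div (hτ₂.pow 5) (pow_ne_zero 5 n₂)))
  have hh0 : h u₀ ≠ 0 := by
    simp only [h]
    exact mul_ne_zero (mul_ne_zero (mul_ne_zero (pow_ne_zero 2 w₀) hX')
      (div_ne_zero w₁ (pow_ne_zero 5 n₁))) (div_ne_zero w₂ (pow_ne_zero 5 n₂))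
  have dm₁ : deriv m₁ u₀ = deriv τ₁ u₀ / k₁ u₀ := by
    have : HasDerivAt m₁ _ u₀ :=
      (hτ₁.differentiableAt.hasDerivAt.sub_const (τ₁ u₀)).div ak₁.differentiableAt.hasDerivAt w₁
    rw [this.deriv, sub_self, zero_mul, sub_zero]
    field_simp
  have dm₀ : deriv m₀ u₀ = s / k₀ u₀ := by
    have : HasDerivAt m₀ _ u₀ :=
      (((hasDerivAt_id u₀).sub_const u₀).const_mul (s : ℂ)).div ak₀.differentiableAt.hasDerivAt w₀
    rw [this.deriv]
    simp
    field_simp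
  have key := norm_deriv_sq_le_of_local_max ah am₀ am₁ (by simp [m₀]) (by simp [m₁]) hh0 ?_
  · rw [dm₁, dm₀, norm_div, norm_div, v₁, v₀, Complex.norm_real, Complex.norm_real,
      Complex.norm_real, Real.norm_of_nonneg hs0.le, Real.norm_of_nonneg hpos.le,
      Real.norm_of_nonneg (by positivity), div_pow, div_pow, ← mul_div_assoc,
      div_le_div_iff₀ (by positivity) (by positivity)] at key
    rw [d₁, norm_mul, norm_mul, norm_pow]
    have : ‖(6 : ℂ)‖ = 6 := by simp
    rw [this]
    -- `36` is the square of the `6` in the derivative of a sixth power; the extra `2` comes from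
    -- the local maximum lemma.
    calc _ = 36 * ‖τ₁ u₀‖ ^ 10 * (‖deriv τ₁ u₀‖ ^ 2 * (s ^ 2 - ‖u₀ - x‖ ^ 2) ^ 2) := by ring
      _ ≤ 36 * ‖τ₁ u₀‖ ^ 10 * (2 * s ^ 2 * (1 + ‖τ₁ u₀‖ ^ 2) ^ 2) := by gcongr
      _ = _ := by ring
  · have ev : ∀ {k : ℂ → ℂ}, AnalyticAt ℂ k u₀ → k u₀ ≠ 0 → ∀ᶠ u in 𝓝 u₀, k u ≠ 0 :=
      fun hk h0 => hk.continuousAt.eventually_ne h0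
    filter_upwards [hmax, e₁, e₂, ev hτ₁ n₁, ev hτ₂ n₂, ev ak₁ w₁, ev ak₂ w₂, ev ak₀ w₀]
      with u hu e₁u e₂u n₁u n₂u w₁u w₂u w₀u
    rw [ahlforsDensity_eq_of_pow e₁u, ahlforsDensity_eq_of_pow e₂u,
      ahlforsDensity_eq_of_pow e₁.self_of_nhds, ahlforsDensity_eq_of_pow e₂.self_of_nhds] at hu
    have f₁ := one_add_norm_sq_mul (τ₁ u₀) (τ₁ u)
    have f₂ := one_add_norm_sq_mul (τ₂ u₀) (τ₂ u)
    have f₀ := sub_norm_sq_mul s (u₀ - x) (u - x)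
    change _ = ‖k₁ u‖ ^ 2 + _ at f₁
    change _ = ‖k₂ u‖ ^ 2 + _ at f₂
    change _ = ‖k₀ u‖ ^ 2 - _ at f₀
    rw [sub_sub_sub_cancel_right] at f₀
    have g₁ : 0 < ‖k₁ u‖ := norm_pos_iff.2 w₁u
    have g₂ : 0 < ‖k₂ u‖ := norm_pos_iff.2 w₂u
    have g₀ : 0 < ‖k₀ u‖ := norm_pos_iff.2 w₀u
    have t₁ : 0 < ‖τ₁ u‖ := norm_pos_iff.2 n₁u
    have t₂ : 0 < ‖τ₂ u‖ := norm_pos_iff.2 n₂u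
    have t₁' : 0 < ‖τ₁ u₀‖ := norm_pos_iff.2 n₁
    have t₂' : 0 < ‖τ₂ u₀‖ := norm_pos_iff.2 n₂
    have nk₁ : ‖k₁ u₀‖ = 1 + ‖τ₁ u₀‖ ^ 2 := by
      rw [v₁, Complex.norm_real, Real.norm_of_nonneg (by positivity)]
    have nk₂ : ‖k₂ u₀‖ = 1 + ‖τ₂ u₀‖ ^ 2 := by
      rw [v₂, Complex.norm_real, Real.norm_of_nonneg (by positivity)]
    have nk₀ : ‖k₀ u₀‖ = s ^ 2 - ‖u₀ - x‖ ^ 2 := by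
      rw [v₀, Complex.norm_real, Real.norm_of_nonneg hpos.le]
    have q₁ : 1 + ‖m₁ u‖ ^ 2 = (1 + ‖τ₁ u‖ ^ 2) * (1 + ‖τ₁ u₀‖ ^ 2) / ‖k₁ u‖ ^ 2 := by
      rw [f₁]; simp only [m₁]; rw [norm_div, div_pow]; field_simp
    have q₀ : 1 - ‖m₀ u‖ ^ 2 = (s ^ 2 - ‖u - x‖ ^ 2) * (s ^ 2 - ‖u₀ - x‖ ^ 2) / ‖k₀ u‖ ^ 2 := by
      rw [f₀]; simp only [m₀]; rw [norm_div, div_pow, norm_mul, Complex.norm_real,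
        Real.norm_of_nonneg hs0.le, mul_pow]; field_simp
    -- Discarding `‖τ₂ u - τ₂ u₀‖²` loses nothing at `u₀` and is in the right direction elsewhere;
    -- only the first puncture is used to produce curvature.
    have q₂ : ‖k₂ u‖ ^ 2 ≤ (1 + ‖τ₂ u‖ ^ 2) * (1 + ‖τ₂ u₀‖ ^ 2) := by
      rw [f₂]; linarith [sq_nonneg ‖τ₂ u - τ₂ u₀‖]
    rw [q₁, q₀]
    simp only [h, norm_mul, norm_div, norm_pow]
    rw [nk₀, nk₁, nk₂]
    set D := ‖deriv X u‖
    set D₀ := ‖deriv X u₀‖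
    set S := s ^ 2 - ‖u - x‖ ^ 2
    set S₀ := s ^ 2 - ‖u₀ - x‖ ^ 2
    calc _ = S ^ 2 * D ^ 2 * ((1 + ‖τ₁ u‖ ^ 2) / ‖τ₁ u‖ ^ 10 / ‖τ₂ u‖ ^ 10) *
          (S₀ ^ 2 * (1 + ‖τ₁ u₀‖ ^ 2)) * ‖k₂ u‖ ^ 2 := by field_simp
      _ ≤ S ^ 2 * D ^ 2 * ((1 + ‖τ₁ u‖ ^ 2) / ‖τ₁ u‖ ^ 10 / ‖τ₂ u‖ ^ 10) *
          (S₀ ^ 2 * (1 + ‖τ₁ u₀‖ ^ 2)) * ((1 + ‖τ₂ u‖ ^ 2) * (1 + ‖τ₂ u₀‖ ^ 2)) := by gcongr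
      _ = S ^ 2 * D ^ 2 * ((1 + ‖τ₁ u‖ ^ 2) / ‖τ₁ u‖ ^ 10 * ((1 + ‖τ₂ u‖ ^ 2) / ‖τ₂ u‖ ^ 10)) *
          (S₀ ^ 2 * (1 + ‖τ₁ u₀‖ ^ 2) * (1 + ‖τ₂ u₀‖ ^ 2)) := by field_simp
      _ ≤ S₀ ^ 2 * D₀ ^ 2 * ((1 + ‖τ₁ u₀‖ ^ 2) / ‖τ₁ u₀‖ ^ 10 *
            ((1 + ‖τ₂ u₀‖ ^ 2) / ‖τ₂ u₀‖ ^ 10)) *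
          (S₀ ^ 2 * (1 + ‖τ₁ u₀‖ ^ 2) * (1 + ‖τ₂ u₀‖ ^ 2)) := by gcongr
      _ = _ := by field_simp

/-- The constant in the Ahlfors estimate for the plane punctured at points at distance `d`. -/
def ahlforsConst (d : ℝ) : ℝ :=
  72 * ((1 + 1 / ((d / 2) ^ (1 / 6 : ℝ)) ^ 2) ^ 4 / ((d / 2) ^ (1 / 6 : ℝ)) ^ 2)

/-- Use the estimate at the nearer puncture `A₁`. Its factor `a ^ 10` cancels the singularity of the
density there and leaves a multiple of `(1 + a²)³ (1 + b²) / b ^ 10` with `a ≤ b`. This is at most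
`(1 + b²)⁴ / b ^ 10`, which decreases in `b`, and `b` is bounded below because the farther puncture
is at distance at least `‖A₁ - A₂‖ / 2`. -/
theorem le_ahlforsConst_of_local_max {X : ℂ → ℂ} {u₀ x A₁ A₂ : ℂ} {s : ℝ} (hX : AnalyticAt ℂ X u₀)
    (h1 : X u₀ ≠ A₁) (h2 : X u₀ ≠ A₂) (hX' : deriv X u₀ ≠ 0) (hs : ‖u₀ - x‖ < s) (hA : A₁ ≠ A₂)
    (hmax : ∀ᶠ u in 𝓝 u₀, (s ^ 2 - ‖u - x‖ ^ 2) ^ 2 * ‖deriv X u‖ ^ 2 *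
        (ahlforsDensity A₁ (X u) * ahlforsDensity A₂ (X u)) ≤
      (s ^ 2 - ‖u₀ - x‖ ^ 2) ^ 2 * ‖deriv X u₀‖ ^ 2 *
        (ahlforsDensity A₁ (X u₀) * ahlforsDensity A₂ (X u₀))) :
    (s ^ 2 - ‖u₀ - x‖ ^ 2) ^ 2 * ‖deriv X u₀‖ ^ 2 *
        (ahlforsDensity A₁ (X u₀) * ahlforsDensity A₂ (X u₀)) ≤ s ^ 2 * ahlforsConst ‖A₁ - A₂‖ := by
  wlog hle : ‖X u₀ - A₁‖ ≤ ‖X u₀ - A₂‖ generalizing A₁ A₂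
  · have := this h2 h1 hA.symm (by simpa only [mul_comm (ahlforsDensity A₂ _)] using hmax)
      (not_le.1 hle).le
    rw [norm_sub_rev A₁, mul_comm (ahlforsDensity A₁ _)]
    exact this
  have key := sq_le_of_local_max hX h1 h2 hX' hs hmax
  have hp₁ := norm_pos_iff.2 (sub_ne_zero.2 h1)
  have hp₂ := norm_pos_iff.2 (sub_ne_zero.2 h2)
  have hd : ‖A₁ - A₂‖ / 2 ≤ ‖X u₀ - A₂‖ := by
    have : ‖A₁ - A₂‖ ≤ ‖X u₀ - A₁‖ + ‖X u₀ - A₂‖ := by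
      calc ‖A₁ - A₂‖ = ‖(X u₀ - A₂) - (X u₀ - A₁)‖ := by congr 1; ring
        _ ≤ _ := by rw [add_comm]; exact norm_sub_le _ _
    linarith
  have hd0 : 0 < ‖A₁ - A₂‖ := norm_pos_iff.2 (sub_ne_zero.2 hA)
  have hab := Real.rpow_le_rpow hp₁.le hle (by norm_num : (0 : ℝ) ≤ 1 / 6)
  have hβ := Real.rpow_le_rpow (by positivity) hd (by norm_num : (0 : ℝ) ≤ 1 / 6)
  have ha0 : 0 < ‖X u₀ - A₁‖ ^ (1 / 6 : ℝ) := by positivity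
  have hβ0 : 0 < (‖A₁ - A₂‖ / 2) ^ (1 / 6 : ℝ) := by positivity
  unfold ahlforsDensity ahlforsConst
  set a := ‖X u₀ - A₁‖ ^ (1 / 6 : ℝ)
  set b := ‖X u₀ - A₂‖ ^ (1 / 6 : ℝ)
  set β := (‖A₁ - A₂‖ / 2) ^ (1 / 6 : ℝ)
  have hb0 : 0 < b := hβ0.trans_le hβ
  calc _ ≤ 72 * s ^ 2 * (a ^ 10 * (1 + a ^ 2) ^ 2) *
        ((1 + a ^ 2) / a ^ 10 * ((1 + b ^ 2) / b ^ 10)) := by gcongr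
    _ = 72 * s ^ 2 * ((1 + a ^ 2) ^ 3 * ((1 + b ^ 2) / b ^ 10)) := by field_simp
    _ ≤ 72 * s ^ 2 * ((1 + b ^ 2) ^ 3 * ((1 + b ^ 2) / b ^ 10)) := by gcongr
    _ = s ^ 2 * (72 * ((1 + 1 / b ^ 2) ^ 4 / b ^ 2)) := by field_simp; ring
    _ ≤ _ := by gcongr

/-! ### Forward orbits of small discs -/

section

variable {p q : ℕ} {c : ℂ}

theorem Corr.norm_le (hq : 0 < q) {z w : ℂ} (h : Corr p q c z w) : ‖w‖ ≤ ‖c‖ + 1 + ‖z‖ ^ p := by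
  have h1 : ‖w - c‖ ^ q = ‖z‖ ^ p := by rw [← norm_pow, ← norm_pow, h]
  have h2 : ‖w - c‖ ≤ 1 + ‖z‖ ^ p := by
    by_cases hle : ‖w - c‖ ≤ 1
    · linarith [pow_nonneg (norm_nonneg z) p]
    · rw [← h1]
      linarith [le_self_pow₀ (not_le.1 hle).le hq.ne']
  calc ‖w‖ = ‖c + (w - c)‖ := by congr 1; ring
    _ ≤ ‖c‖ + ‖w - c‖ := norm_add_le _ _
    _ ≤ _ := by linarith

theorem isClosed_corr {α : Type*} [TopologicalSpace α] {a b : α → ℂ} (ha : Continuous a)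
    (hb : Continuous b) : IsClosed {x | Corr p q c (a x) (b x)} :=
  isClosed_eq ((hb.sub continuous_const).pow q) (ha.pow p)

/-- The space of orbit segments of length `n` starting in a closed disc, padded by zero. -/
def segments (p q : ℕ) (c x : ℂ) (s : ℝ) (n : ℕ) : Set (ℕ → ℂ) :=
  {ζ | ζ 0 ∈ closedBall x s ∧ (∀ k < n, Corr p q c (ζ k) (ζ (k + 1))) ∧ ∀ k, n < k → ζ k = 0}

theorem isCompact_segments (hq : 0 < q) (x : ℂ) (s : ℝ) (n : ℕ) :
    IsCompact (segments p q c x s n) := by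
  -- The a priori growth of orbits: `R k` dominates every `ζ k`, so Tychonoff's theorem applies.
  obtain ⟨R, hRz, hRs⟩ : ∃ R : ℕ → ℝ, R 0 = ‖x‖ + s ∧ ∀ k, R (k + 1) = ‖c‖ + 1 + R k ^ p :=
    ⟨fun k => Nat.rec (‖x‖ + s) (fun _ R => ‖c‖ + 1 + R ^ p) k, rfl, fun _ => rfl⟩
  refine (isCompact_univ_pi fun k => isCompact_closedBall (0 : ℂ) (R k)).of_isClosed_subset ?_ ?_
  · have e : segments p q c x s n = (fun ζ : ℕ → ℂ => ζ 0) ⁻¹' closedBall x s ∩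
        ((⋂ k, ⋂ (_ : k < n), {ζ | Corr p q c (ζ k) (ζ (k + 1))}) ∩
          ⋂ k, ⋂ (_ : n < k), {ζ | ζ k = 0}) := by
      ext ζ
      simp [segments]
    rw [e]
    refine (isClosed_closedBall.preimage (continuous_apply 0)).inter (IsClosed.inter ?_ ?_)
    · exact isClosed_iInter fun k => isClosed_iInter fun _ =>
        isClosed_corr (continuous_apply k) (continuous_apply (k + 1))
    · exact isClosed_iInter fun k => isClosed_iInter fun _ =>
        isClosed_eq (continuous_apply k) continuous_const
  · rintro ζ ⟨h0, hc, ht⟩ k -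
    have hR0 : 0 ≤ R 0 := by
      have : 0 ≤ s := dist_nonneg.trans h0
      rw [hRz]; positivity
    have hR : ∀ k, 0 ≤ R k := by
      intro k
      induction k with
      | zero => exact hR0
      | succ k ih => rw [hRs]; exact add_nonneg (by positivity) (pow_nonneg ih p)
    rw [mem_closedBall_zero_iff]
    induction k with
    | zero =>
      have : ‖ζ 0 - x‖ ≤ s := by rw [← dist_eq_norm]; exact h0
      calc ‖ζ 0‖ = ‖x + (ζ 0 - x)‖ := by congr 1; ring
        _ ≤ ‖x‖ + ‖ζ 0 - x‖ := norm_add_le _ _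
        _ ≤ _ := by rw [hRz]; linarith
    | succ k ih =>
      by_cases hk : k < n
      · refine ((hc k hk).norm_le hq).trans ?_
        rw [hRs]
        gcongr
      · rw [ht (k + 1) (by omega), norm_zero]
        exact hR (k + 1)

theorem segments.reflTransGen {x : ℂ} {s : ℝ} {n : ℕ} {ζ : ℕ → ℂ} (h : ζ ∈ segments p q c x s n) :
    Relation.ReflTransGen (Corr p q c) (ζ 0) (ζ n) := by
  have : ∀ k ≤ n, Relation.ReflTransGen (Corr p q c) (ζ 0) (ζ k) := by
    intro k hk
    induction k with
    | zero => exact .refl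
    | succ k ih => exact (ih (by omega)).tail (h.2.1 k (by omega))
  exact this n le_rfl

/-- The square of the density of the pulled back Ahlfors metric relative to the hyperbolic metric
of the disc. -/
def segmentWeight (p q : ℕ) (x : ℂ) (s : ℝ) (A₁ A₂ : ℂ) (n : ℕ) (ζ : ℕ → ℂ) : ℝ :=
  (s ^ 2 - ‖ζ 0 - x‖ ^ 2) ^ 2 *
    (p * ‖ζ n‖ ^ (p - 1) * ∏ k ∈ Finset.range n, expansion p q (ζ k)) ^ 2 *
    (ahlforsDensity A₁ (ζ n ^ p) * ahlforsDensity A₂ (ζ n ^ p))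

/-- Iterates of `𝐟_c` are multivalued, so the weight is maximized over the compact space of orbit
segments instead of over the disc. At a maximum of positive weight no point of the segment is
critical, so the segment moves holomorphically with its first point; the weight of the moving
segments has a local maximum and the Ahlfors estimate applies. The bound does not depend on the
length `n`. -/
theorem segmentWeight_le (hq : 0 < q) (hpq : q < p) (hp : 1 < p) {x A₁ A₂ : ℂ} {s : ℝ}
    (hA : A₁ ≠ A₂)
    (h : ∀ b ∈ closedBall x s, ∀ ζ, Relation.ReflTransGen (Corr p q c) b ζ →
      ζ ^ p ≠ A₁ ∧ ζ ^ p ≠ A₂) {n : ℕ} {ξ : ℕ → ℂ} (hξ : ξ ∈ segments p q c x s n) (hs : 0 < s) :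
    segmentWeight p q x s A₁ A₂ n ξ ≤ s ^ 2 * ahlforsConst ‖A₁ - A₂‖ := by
  have hav : ∀ ζ ∈ segments p q c x s n, ζ n ^ p ≠ A₁ ∧ ζ n ^ p ≠ A₂ := fun ζ hζ =>
    h _ hζ.1 _ (segments.reflTransGen hζ)
  have hcont : ContinuousOn (segmentWeight p q x s A₁ A₂ n) (segments p q c x s n) := by
    intro ζ hζ
    have hE : Continuous fun ζ : ℕ → ℂ => ∏ k ∈ Finset.range n, expansion p q (ζ k) :=
      continuous_finsetProd _ fun k _ => (continuous_expansion hq hpq).comp (continuous_apply k)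
    have h1 : ContinuousAt (fun ζ : ℕ → ℂ => ahlforsDensity A₁ (ζ n ^ p)) ζ :=
      ContinuousAt.comp (f := fun ζ : ℕ → ℂ => ζ n ^ p)
        (continuousAt_ahlforsDensity (hav ζ hζ).1) ((continuous_apply n).pow p).continuousAt
    have h2 : ContinuousAt (fun ζ : ℕ → ℂ => ahlforsDensity A₂ (ζ n ^ p)) ζ :=
      ContinuousAt.comp (f := fun ζ : ℕ → ℂ => ζ n ^ p)
        (continuousAt_ahlforsDensity (hav ζ hζ).2) ((continuous_apply n).pow p).continuousAt
    unfold segmentWeight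
    refine ContinuousAt.continuousWithinAt ?_
    have h3 : Continuous fun ζ : ℕ → ℂ => (s ^ 2 - ‖ζ 0 - x‖ ^ 2) ^ 2 *
        (p * ‖ζ n‖ ^ (p - 1) * ∏ k ∈ Finset.range n, expansion p q (ζ k)) ^ 2 := by fun_prop
    exact h3.continuousAt.mul (h1.mul h2)
  obtain ⟨ζ, hζ, hmax⟩ := (isCompact_segments hq x s n).exists_isMaxOn ⟨ξ, hξ⟩ hcont
  refine (hmax hξ).trans ?_
  have hK : 0 ≤ s ^ 2 * ahlforsConst ‖A₁ - A₂‖ := by unfold ahlforsConst; positivity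
  rcases le_or_gt (segmentWeight p q x s A₁ A₂ n ζ) 0 with hle | hpos
  · exact hle.trans hK
  -- The weight vanishes on the boundary circle, at `ζ n = 0` because `p > 1`, and at `ζ k = 0`
  -- because `p > q` makes the expansion vanish at `0`.
  have hne : (s ^ 2 - ‖ζ 0 - x‖ ^ 2) ≠ 0 ∧ ζ n ≠ 0 ∧ ∀ k < n, ζ k ≠ 0 := by
    refine ⟨fun h0 => ?_, fun h0 => ?_, fun k hk h0 => ?_⟩
    · simp [segmentWeight, h0] at hpos
    · simp [segmentWeight, h0, zero_pow (by omega : p - 1 ≠ 0)] at hpos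
    · have : ∏ k ∈ Finset.range n, expansion p q (ζ k) = 0 :=
        Finset.prod_eq_zero (Finset.mem_range.2 hk) (by rw [h0, expansion_zero hq hpq])
      simp [segmentWeight, this] at hpos
  have hlt : ‖ζ 0 - x‖ < s := by
    have h1 : ‖ζ 0 - x‖ ≤ s := by rw [← dist_eq_norm]; exact hζ.1
    refine lt_of_le_of_ne h1 fun he => hne.1 (by rw [he, sub_self])
  obtain ⟨ψ, hψ0, hψ, hev⟩ := exists_forward_branches hq hpq ζ n
    fun k hk => ⟨hne.2.2 k hk, hζ.2.1 k hk⟩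
  set X : ℂ → ℂ := fun u => ψ n u ^ p
  have hX : AnalyticAt ℂ X (ζ 0) := (hψ n le_rfl).1.pow p
  have hder : ∀ᶠ u in 𝓝 (ζ 0), ‖deriv X u‖ =
      p * ‖ψ n u‖ ^ (p - 1) * ∏ k ∈ Finset.range n, expansion p q (ψ k u) := by
    filter_upwards [hev, (hψ n le_rfl).1.eventually_analyticAt] with u hu ha
    have : HasDerivAt X _ u := ha.differentiableAt.hasDerivAt.pow p
    rw [this.deriv, norm_mul, norm_mul, norm_pow, Complex.norm_natCast, hu.2]
  have hw : ∀ᶠ u in 𝓝 (ζ 0), (s ^ 2 - ‖u - x‖ ^ 2) ^ 2 * ‖deriv X u‖ ^ 2 *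
        (ahlforsDensity A₁ (X u) * ahlforsDensity A₂ (X u)) =
      segmentWeight p q x s A₁ A₂ n (fun k => if k ≤ n then ψ k u else 0) := by
    filter_upwards [hder] with u hu
    rw [hu]
    have : ∏ k ∈ Finset.range n, expansion p q (if k ≤ n then ψ k u else 0) =
        ∏ k ∈ Finset.range n, expansion p q (ψ k u) :=
      Finset.prod_congr rfl fun k hk => by rw [if_pos (Finset.mem_range.1 hk).le]
    simp [segmentWeight, this, hψ0, X]
  have hζe : (fun k => if k ≤ n then ψ k (ζ 0) else 0) = ζ := by
    funext k
    by_cases hk : k ≤ n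
    · simp [hk, (hψ k hk).2]
    · simp [hk, hζ.2.2 k (by omega)]
  have hw0 := hw.self_of_nhds
  rw [hζe] at hw0
  rw [← hw0]
  have hXn : X (ζ 0) = ζ n ^ p := by simp only [X, (hψ n le_rfl).2]
  refine le_ahlforsConst_of_local_max hX ?_ ?_ ?_ hlt hA ?_
  · rw [hXn]; exact (hav ζ hζ).1
  · rw [hXn]; exact (hav ζ hζ).2
  · intro h0
    rw [h0] at hw0
    simp at hw0
    linarith
  · have hin : ∀ᶠ u in 𝓝 (ζ 0), u ∈ ball x s :=
      isOpen_ball.mem_nhds (by rw [mem_ball, dist_eq_norm]; exact hlt)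
    filter_upwards [hev, hw, hin] with u hu hwu hb
    rw [hwu, hw0]
    refine hmax ⟨?_, ?_, ?_⟩
    · simpa [hψ0] using ball_subset_closedBall hb
    · intro k hk
      simpa [hk.le, Nat.succ_le_of_lt hk] using (hu.1 k hk).2
    · intro k hk
      simp [not_le.2 hk]

/-- Every neighbourhood of a repelling periodic point has orbits which do not omit two values. -/
theorem exists_reflTransGen_pow_eq (hq : 0 < q) (hpq : q < p) {x A₁ A₂ : ℂ} {m s : ℝ}
    (hx : Path p q c x x m) (hm : 1 < m) (hs : 0 < s) (hA : A₁ ≠ A₂) :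
    ∃ b ∈ closedBall x s, ∃ ζ, Relation.ReflTransGen (Corr p q c) b ζ ∧
      (ζ ^ p = A₁ ∨ ζ ^ p = A₂) := by
  by_contra! h
  have hx0 : x ≠ 0 := hx.ne_zero hm.ne'
  obtain ⟨h1, h2⟩ := h x (mem_closedBall_self hs.le) x .refl
  set B : ℝ := (s ^ 2) ^ 2 * (p * ‖x‖ ^ (p - 1)) ^ 2 *
    (ahlforsDensity A₁ (x ^ p) * ahlforsDensity A₂ (x ^ p))
  have hB : 0 < B := by
    have := norm_pos_iff.2 hx0
    have := ahlforsDensity_pos h1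
    have := ahlforsDensity_pos h2
    have : (0 : ℝ) < p := by exact_mod_cast (by omega : 0 < p)
    positivity
  -- Running `k` times round the cycle multiplies the weight at the centre by `m ^ (2 * k)`, while
  -- the bound is the same for all lengths.
  have key : ∀ k : ℕ, B * (m ^ 2) ^ k ≤ s ^ 2 * ahlforsConst ‖A₁ - A₂‖ := by
    intro k
    obtain ⟨n, ζ, h0, hn, hc, ht, hp⟩ := (hx.iterate k).exists_seq
    have := segmentWeight_le hq hpq (by omega) hA h (n := n) (ξ := ζ)
      ⟨by rw [h0]; exact mem_closedBall_self hs.le, fun k hk => (hc k hk).2, ht⟩ hs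
    rw [segmentWeight, h0, hn, hp, sub_self, norm_zero] at this
    refine le_of_eq_of_le ?_ this
    simp only [B]
    ring
  have hm2 : 1 < m ^ 2 := one_lt_pow₀ hm (by norm_num)
  have := (tendsto_pow_atTop_atTop_of_one_lt hm2).const_mul_atTop hB
  obtain ⟨k, hk⟩ := (this.eventually (eventually_gt_atTop (s ^ 2 * ahlforsConst ‖A₁ - A₂‖))).exists
  exact absurd (key k) (not_le.2 hk)

/-- A point `w ≠ c` has `p` distinct preimages, but `(v - c) ^ q = A` has at most `q < p` solutions.
-/
theorem exists_preimages_ne (hq : 0 < q) (hpq : q < p) {w : ℂ} (hw : w ≠ c) (A : ℂ) :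
    ∃ v, Corr p q c v w ∧ (v - c) ^ q ≠ A := by
  by_contra! h
  obtain ⟨v, hv⟩ := IsAlgClosed.exists_pow_nat_eq ((w - c) ^ q) (n := p) (by omega)
  have hv0 : v ≠ 0 := by
    rintro rfl
    rw [zero_pow (by omega)] at hv
    exact pow_ne_zero q (sub_ne_zero.2 hw) hv.symm
  have hω := Complex.isPrimitiveRoot_exp p (by omega)
  set ω := Complex.exp (2 * Real.pi * Complex.I / p)
  set P : Polynomial ℂ := (Polynomial.X - Polynomial.C c) ^ q - Polynomial.C A
  have hinj : Set.InjOn (fun j : ℕ => v * ω ^ j) (Finset.range p : Set ℕ) := by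
    intro i hi j hj hij
    exact hω.pow_inj (by simpa using hi) (by simpa using hj) (mul_left_cancel₀ hv0 hij)
  have hdeg : P.natDegree = q := by
    rw [Polynomial.natDegree_sub_C, Polynomial.natDegree_pow, Polynomial.natDegree_X_sub_C, mul_one]
  have hP : P = 0 := by
    refine Polynomial.eq_zero_of_natDegree_lt_card_of_eval_eq_zero' P
      ((Finset.range p).image fun j => v * ω ^ j) ?_ ?_
    · intro y hy
      obtain ⟨j, -, rfl⟩ := Finset.mem_image.1 hy
      have hc : Corr p q c (v * ω ^ j) w := by
        rw [Corr, mul_pow, hv, ← pow_mul, mul_comm j, pow_mul, hω.pow_eq_one, one_pow, mul_one]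
      simp [P, h _ hc]
    · rw [Finset.card_image_of_injOn hinj, Finset.card_range, hdeg]
      exact hpq
  rw [hP] at hdeg
  simp at hdeg
  omega

/-- Topological transitivity at repelling periodic points. -/
theorem exists_reflTransGen_mem_ball (hq : 0 < q) (hpq : q < p) {x w : ℂ} {m ε : ℝ}
    (hx : Path p q c x x m) (hm : 1 < m) (hε : 0 < ε) (hw : w ≠ c) :
    ∃ b ∈ ball x ε, Relation.ReflTransGen (Corr p q c) b w := by
  -- The two test values are `(v₁ - c) ^ q` and `(v₂ - c) ^ q` for two preimages of `w`: attaining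
  -- either as `ζ ^ p` means `ζ → vᵢ → w`.
  obtain ⟨v₁, hv₁, -⟩ := exists_preimages_ne hq hpq hw 0
  obtain ⟨v₂, hv₂, hne⟩ := exists_preimages_ne hq hpq hw ((v₁ - c) ^ q)
  obtain ⟨b, hb, ζ, hbζ, h⟩ := exists_reflTransGen_pow_eq hq hpq hx hm (half_pos hε) hne
  refine ⟨b, closedBall_subset_ball (by linarith) hb, ?_⟩
  rcases h with h | h
  · exact (hbζ.tail (h.symm : Corr p q c ζ v₂)).tail hv₂
  · exact (hbζ.tail (h.symm : Corr p q c ζ v₁)).tail hv₁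

end

/-! ### Backward invariance of the Julia set -/

theorem norm_deriv_le_of_mapsTo_ball {T : ℂ → ℂ} {w w' y : ℂ} {R ε : ℝ} (hR : 0 < R)
    (hT : DifferentiableOn ℂ T (ball w R)) (hm : MapsTo T (ball w R) (closedBall w' (ε * R)))
    (hy : y ∈ closedBall w (R / 4)) : ‖deriv T y‖ ≤ 2 * ε := by
  have hsub : closedBall y (R / 2) ⊆ ball w R := by
    intro u hu
    rw [mem_ball]
    have h1 : dist u y ≤ R / 2 := hu
    have h2 : dist y w ≤ R / 4 := hy
    linarith [dist_triangle u y w]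
  have hd : DifferentiableOn ℂ (fun u => T u - w') (closedBall y (R / 2)) :=
    (hT.mono hsub).sub_const w'
  have := Complex.norm_deriv_le_of_forall_mem_sphere_norm_le (half_pos hR) (C := ε * R)
    (DifferentiableOn.diffContOnCl (hd.mono closure_ball_subset_closedBall)) fun z hz => by
      rw [← dist_eq_norm]
      exact hm (hsub (sphere_subset_closedBall hz))
  rw [deriv_sub_const] at this
  refine this.trans_eq ?_
  field_simp

/-- A fixed point theorem for holomorphic maps which strongly contract a disc. -/
theorem exists_fixedPoint_of_mapsTo_ball {T : ℂ → ℂ} {w : ℂ} {R ε : ℝ} (hR : 0 < R)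
    (hT : DifferentiableOn ℂ T (ball w R)) (hε : ε ≤ 1 / 8)
    (hm : MapsTo T (ball w R) (closedBall w (ε * R))) :
    ∃ y ∈ closedBall w (ε * R), T y = y ∧ ‖deriv T y‖ ≤ 1 / 4 := by
  have hsub : closedBall w (R / 4) ⊆ ball w R := closedBall_subset_ball (by linarith)
  have hεR : ε * R ≤ R / 4 := by nlinarith
  have hd : ∀ y ∈ closedBall w (R / 4), ‖deriv T y‖ ≤ 1 / 4 := fun y hy =>
    (norm_deriv_le_of_mapsTo_ball hR hT hm hy).trans (by linarith)
  have hmaps : MapsTo T (closedBall w (R / 4)) (closedBall w (R / 4)) := fun y hy =>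
    closedBall_subset_closedBall hεR (hm (hsub hy))
  have hcon : ContractingWith (1 / 4) (hmaps.restrict T _ _) := by
    refine ⟨by rw [← NNReal.coe_lt_coe]; norm_num, LipschitzWith.of_dist_le_mul fun a b => ?_⟩
    have := (convex_closedBall w (R / 4)).norm_image_sub_le_of_norm_deriv_le
      (fun y hy => hT.differentiableAt (isOpen_ball.mem_nhds (hsub hy))) hd b.2 a.2
    simpa [Subtype.dist_eq, dist_eq_norm] using this
  obtain ⟨y, hy, hfix, -⟩ := hcon.exists_fixedPoint' isClosed_closedBall.isComplete hmaps
    (mem_closedBall_self (by positivity)) (edist_ne_top _ _)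
  exact ⟨y, by rw [← hfix]; exact hm (hsub hy), hfix, hd y hy⟩

/-- A nonvanishing holomorphic function on a disc has holomorphic roots. -/
theorem exists_differentiableOn_root {F : ℂ → ℂ} {R : ℝ} (hR : 0 < R)
    (hF : DifferentiableOn ℂ F (ball 0 R)) (h0 : ∀ v ∈ ball (0 : ℂ) R, F v ≠ 0) {d : ℕ}
    (hd : d ≠ 0) :
    ∃ Y : ℂ → ℂ, DifferentiableOn ℂ Y (ball 0 R) ∧ ∀ v ∈ ball (0 : ℂ) R, Y v ^ d = F v := by
  -- `L` is a primitive of `F' / F`, so `F * exp (-L)` is constant.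
  obtain ⟨L, hL⟩ := DifferentiableOn.isExactOn_ball
    ((hF.deriv isOpen_ball).div hF h0)
  have hLd : DifferentiableOn ℂ L (ball 0 R) := fun z hz =>
    (hL z hz).differentiableAt.differentiableWithinAt
  set P : ℂ → ℂ := fun v => F v * Complex.exp (-L v)
  have hP : ∀ v ∈ ball (0 : ℂ) R, HasDerivAt P 0 v := by
    intro v hv
    have h1 := (hF.differentiableAt (isOpen_ball.mem_nhds hv)).hasDerivAt
    have h2 := h1.mul (hL v hv).neg.cexp
    refine h2.congr_deriv ?_
    have := h0 v hv
    simp only [Pi.div_apply]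
    field_simp
    ring
  have hconst : ∀ v ∈ ball (0 : ℂ) R, P v = P 0 := fun v hv =>
    isOpen_ball.is_const_of_deriv_eq_zero (convex_ball _ _).isPreconnected
      (fun z hz => (hP z hz).differentiableAt.differentiableWithinAt)
      (fun z hz => (hP z hz).deriv) hv (mem_ball_self hR)
  obtain ⟨k, hk⟩ := IsAlgClosed.exists_pow_nat_eq (P 0) (Nat.pos_of_ne_zero hd)
  refine ⟨fun v => k * Complex.exp (L v / d), ?_, fun v hv => ?_⟩
  · exact (hLd.div_const _).cexp.const_mul _
  · have hd' : (d : ℂ) ≠ 0 := by exact_mod_cast hd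
    rw [mul_pow, hk, ← Complex.exp_nat_mul, mul_div_cancel₀ _ hd', ← hconst v hv]
    simp only [P]
    rw [mul_assoc, ← Complex.exp_add, neg_add_cancel, Complex.exp_zero, mul_one]

/-! ### Repelling cycles obtained by closing up inverse branches -/

section

variable {p q : ℕ} {c : ℂ}

/-- Stop the orbit at its first visit to `0`. -/
theorem exists_path_of_reflTransGen_zero {b : ℂ} (h : Relation.ReflTransGen (Corr p q c) b 0) :
    ∃ m, Path p q c b 0 m := by
  induction h using Relation.ReflTransGen.head_induction_on with
  | refl => exact ⟨1, .nil 0⟩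
  | @head a b hab _ ih =>
    obtain ⟨m, hm⟩ := ih
    by_cases ha : a = 0
    · subst ha; exact ⟨1, .nil 0⟩
    · exact ⟨_, .cons ha hab hm⟩

/-- The only image of `0` is `c`, so what follows the last departure from `0` is a path starting at
`c`. -/
theorem exists_path_of_reflTransGen (hq : 0 < q) (hpq : q < p) {x y : ℂ}
    (h : Relation.ReflTransGen (Corr p q c) x y) :
    (∃ m, Path p q c x y m) ∨ ∃ m, Path p q c c y m := by
  induction h using Relation.ReflTransGen.head_induction_on with
  | refl => exact .inl ⟨1, .nil y⟩
  | @head a b hab _ ih =>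
    by_cases ha : a = 0
    · subst ha
      obtain rfl := hab.eq_of_zero hq hpq
      exact .inr (ih.elim id id)
    · exact ih.imp_left fun ⟨m, hm⟩ => ⟨_, .cons ha hab hm⟩

/-- A linearizing inverse branch at a repelling periodic point. -/
theorem Path.exists_contracting_inverse (hq : 0 < q) (hpq : q < p) {z : ℂ} {m : ℝ}
    (h : Path p q c z z m) (hm : 1 < m) :
    ∃ (g : ℂ → ℂ) (ρ κ : ℝ), 0 < ρ ∧ 0 < κ ∧ κ < 1 ∧ ∀ k : ℕ, ∀ v ∈ ball z ρ,
      IsInverseBranch p q c g^[k] v ∧ ‖g^[k] v - z‖ ≤ κ ^ k * ‖v - z‖ ∧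
      (v ≠ z → g^[k] v ≠ z) := by
  obtain ⟨g, hgz, hgm, hev⟩ := h.exists_inverse hq hpq
  have hg := hev.self_of_nhds.1
  have hlt : ‖deriv g z‖ < 1 := by
    by_contra! hle
    nlinarith
  obtain ⟨κ, hκ, hκ1⟩ := exists_between hlt
  have hκ0 : 0 < κ := (norm_nonneg _).trans_lt hκ
  have h1 : ∀ᶠ v in 𝓝 z, ‖dslope g z v‖ < κ :=
    (continuousAt_dslope_same.2 hg.differentiableAt).norm.eventually
      (gt_mem_nhds (by simpa only [dslope_same] using hκ))
  have h2 := hg.differentiableAt.hasDerivAt.eventually_ne hev.self_of_nhds.deriv_ne_zero (c := z)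
  rw [eventually_nhdsWithin_iff] at h2
  obtain ⟨ρ, hρ, hball⟩ := Metric.eventually_nhds_iff_ball.1 (hev.and (h1.and h2))
  have hstep : ∀ v ∈ ball z ρ, ‖g v - z‖ ≤ κ * ‖v - z‖ := by
    intro v hv
    have := sub_smul_dslope g z v
    rw [hgz, smul_eq_mul] at this
    rw [← this, norm_mul, mul_comm]
    exact mul_le_mul_of_nonneg_right (hball v hv).2.1.le (norm_nonneg _)
  have hmem : ∀ k : ℕ, ∀ v ∈ ball z ρ, ‖g^[k] v - z‖ ≤ κ ^ k * ‖v - z‖ → g^[k] v ∈ ball z ρ := by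
    intro k v hv hle
    rw [mem_ball, dist_eq_norm] at hv ⊢
    refine lt_of_le_of_lt (hle.trans ?_) hv
    exact mul_le_of_le_one_left (norm_nonneg _) (pow_le_one₀ hκ0.le hκ1.le)
  refine ⟨g, ρ, κ, hρ, hκ0, hκ1, fun k v hv => ?_⟩
  induction k with
  | zero => exact ⟨⟨analyticAt_id, 1, .nil v, by simp⟩, by simp, by simp⟩
  | succ k ih =>
    obtain ⟨i1, i2, i3⟩ := ih
    have hk := hmem k v hv i2
    rw [Function.iterate_succ']
    refine ⟨(hball _ hk).1.comp i1, ?_, fun hne => (hball _ hk).2.2 (i3 hne)⟩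
    refine (hstep _ hk).trans ?_
    rw [pow_succ', mul_assoc]
    gcongr

theorem exists_pow_mul_lt {κ : ℝ} (hκ : 0 < κ) (hκ1 : κ < 1) (ρ : ℝ) {σ : ℝ} (hσ : 0 < σ) :
    ∃ k : ℕ, κ ^ k * ρ < σ := by
  have := (tendsto_pow_atTop_nhds_zero_of_lt_one hκ.le hκ1).mul_const ρ
  rw [zero_mul] at this
  exact (this.eventually (gt_mem_nhds hσ)).exists

/-- Points homoclinic to a repelling cycle belong to the Julia set. -/
theorem mem_julia_of_homoclinic (hq : 0 < q) (hpq : q < p) {z w : ℂ} {m m' : ℝ}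
    (hz : Path p q c z z m) (hm : 1 < m) (hw : Path p q c w z m')
    (hb : ∀ ε > 0, ∃ b ∈ ball z ε, ∃ n, Path p q c b w n) : w ∈ julia p q c := by
  obtain ⟨g, ρ, κ, hρ, hκ, hκ1, hg⟩ := hz.exists_contracting_inverse hq hpq hm
  obtain ⟨γ, hγz, -, hγ⟩ := hw.exists_inverse hq hpq
  obtain ⟨b, hbρ, n, hbw⟩ := hb ρ hρ
  obtain ⟨β, hβw, -, hβ⟩ := hbw.exists_inverse hq hpq
  have hcl : IsClosed (julia p q c) := isClosed_closure
  refine hcl.closure_subset (Metric.mem_closure_iff.2 fun r hr => ?_)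
  have hβc := hβ.self_of_nhds.1.continuousAt.eventually
    (isOpen_ball.mem_nhds (by rwa [hβw] : β w ∈ ball z ρ))
  obtain ⟨R₀, hR₀, hball₀⟩ := Metric.eventually_nhds_iff_ball.1 (hβ.and hβc)
  set R := min R₀ r
  have hR : 0 < R := lt_min hR₀ hr
  have hball : ∀ v ∈ ball w R, IsInverseBranch p q c β v ∧ β v ∈ ball z ρ := fun v hv =>
    hball₀ v (ball_subset_ball (min_le_left _ _) hv)
  have hγc := hγ.self_of_nhds.1.continuousAt.eventually
    (closedBall_mem_nhds (γ z) (by positivity : 0 < 1 / 8 * R))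
  rw [hγz] at hγc
  obtain ⟨σ, hσ, hballσ⟩ := Metric.eventually_nhds_iff_ball.1 (hγ.and hγc)
  obtain ⟨k, hk⟩ := exists_pow_mul_lt hκ hκ1 ρ hσ
  have hgk : ∀ v ∈ ball z ρ, g^[k] v ∈ ball z σ := by
    intro v hv
    have hv' : ‖v - z‖ < ρ := by rwa [← dist_eq_norm]
    rw [mem_ball, dist_eq_norm]
    refine ((hg k v hv).2.1.trans ?_).trans_lt hk
    gcongr
  -- The loop read backwards: `β` goes from near `w` to near `z`, `g^[k]` winds `k` times round the
  -- cycle towards `z`, and `γ` returns to near `w`. Large `k` makes the composition contract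
  -- strongly, and its fixed point is a repelling periodic point near `w`.
  have hT : ∀ v ∈ ball w R, IsInverseBranch p q c (γ ∘ (g^[k] ∘ β)) v := fun v hv =>
    (hballσ _ (hgk _ (hball v hv).2)).1.comp (γ := g^[k] ∘ β)
      ((hg k _ (hball v hv).2).1.comp (hball v hv).1)
  obtain ⟨y, hy, hfix, hd⟩ := exists_fixedPoint_of_mapsTo_ball hR
    (fun v hv => (hT v hv).1.differentiableAt.differentiableWithinAt) le_rfl
    (fun v hv => (hballσ _ (hgk _ (hball v hv).2)).2)
  have hyR : dist y w ≤ 1 / 8 * R := hy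
  obtain ⟨-, M, hM, hM1⟩ := hT y (by rw [mem_ball]; linarith)
  rw [hfix] at hM
  refine ⟨y, hM.mem_julia hq hpq ?_, ?_⟩
  · have := hM.pos hq hpq
    nlinarith
  · rw [dist_comm]
    have : R ≤ r := min_le_right _ _
    linarith

/-- Cycles passing near the critical point which are closed up by a strong contraction. -/
theorem exists_mem_julia_of_inverse_branch (hq : 0 < q) (hpq : q < p) {N ν : ℂ → ℂ} {R ε : ℝ}
    {m : ℕ} (hm : q * m < p) (hR : 0 < R) (hR1 : R ≤ 1) (hε : 0 < ε) (hε8 : ε ≤ 1 / 8)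
    (hN : ∀ v ∈ ball (0 : ℂ) R, IsInverseBranch p q c N v)
    (hν : DifferentiableOn ℂ ν (ball 0 R)) (hNν : ∀ v ∈ ball (0 : ℂ) R, N v - c = v ^ m * ν v)
    (hν0 : ∀ v ∈ ball (0 : ℂ) R, ν v ≠ 0)
    (hle : ∀ v ∈ ball (0 : ℂ) R, ‖ν v‖ ≤ (ε * R) ^ (p - q * m)) :
    ∃ x ∈ julia p q c, ‖x‖ ≤ ε * R := by
  obtain ⟨d, hd⟩ : ∃ d, p = q * m + d := ⟨p - q * m, by omega⟩
  have hd0 : d ≠ 0 := by omega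
  have hdp : p - q * m = d := by omega
  rw [hdp] at hle
  have hpow : ∀ y ∈ ball (0 : ℂ) R, y ^ q ∈ ball (0 : ℂ) R := by
    intro y hy
    rw [mem_ball_zero_iff] at hy ⊢
    rw [norm_pow]
    exact (pow_le_of_le_one (norm_nonneg _) (hy.le.trans hR1) hq.ne').trans_lt hy
  have hF : DifferentiableOn ℂ (fun y => ν (y ^ q)) (ball 0 R) :=
    hν.comp (differentiableOn_id.pow q) hpow
  -- With `x = y ^ q`, the step `x → N x` holds as soon as `N x - c = y ^ p`. After cancelling `y ^
  -- (q * m)` this is `y ^ d = ν (y ^ q)`, which a fixed point of the root `Y` satisfies.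
  obtain ⟨Y, hY, hYd⟩ := exists_differentiableOn_root hR hF (fun v hv => hν0 _ (hpow v hv)) hd0
  have hεR : 0 < ε * R := by positivity
  obtain ⟨y, hy, hfix, hder⟩ := exists_fixedPoint_of_mapsTo_ball hR hY hε8 (fun v hv => by
    rw [mem_closedBall_zero_iff]
    have : ‖Y v‖ ^ d ≤ (ε * R) ^ d := by
      rw [← norm_pow, hYd v hv]
      exact hle _ (hpow v hv)
    exact (pow_le_pow_iff_left₀ (norm_nonneg _) hεR.le hd0).1 this)
  rw [mem_closedBall_zero_iff] at hy
  have hyR : y ∈ ball (0 : ℂ) R := by rw [mem_ball_zero_iff]; nlinarith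
  have hxR := hpow y hyR
  have hyν : y ^ d = ν (y ^ q) := by rw [← hYd y hyR, hfix]
  have hy0 : y ≠ 0 := by
    rintro rfl
    rw [zero_pow hd0] at hyν
    exact hν0 _ hxR hyν.symm
  have hx0 : y ^ q ≠ 0 := pow_ne_zero q hy0
  have hNx : N (y ^ q) - c = y ^ p := by
    rw [hNν _ hxR, ← hyν, ← pow_mul, ← pow_add, hd]
  have hcorr : Corr p q c (y ^ q) (N (y ^ q)) := by
    rw [Corr, hNx, ← pow_mul, ← pow_mul, mul_comm]
  obtain ⟨hNa, M, hM, hM1⟩ := hN _ hxR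
  have hpath := Path.cons hx0 hcorr hM
  refine ⟨y ^ q, hpath.mem_julia hq hpq ?_, ?_⟩
  · have hνd := (hν.differentiableAt (isOpen_ball.mem_nhds hxR)).hasDerivAt
    have hYdv := (hY.differentiableAt (isOpen_ball.mem_nhds hyR)).hasDerivAt
    -- logarithmic derivatives
    have e1 : (d : ℂ) * y ^ (d - 1) * deriv Y y = deriv ν (y ^ q) * (q * y ^ (q - 1)) := by
      have h1 : HasDerivAt (fun v => Y v ^ d) (d * Y y ^ (d - 1) * deriv Y y) y := hYdv.pow d
      have h2 : HasDerivAt (fun v => ν (v ^ q)) (deriv ν (y ^ q) * (q * y ^ (q - 1))) y :=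
        HasDerivAt.comp y hνd (hasDerivAt_pow q y)
      rw [hfix] at h1
      refine h1.unique (h2.congr_of_eventuallyEq ?_)
      filter_upwards [isOpen_ball.mem_nhds hyR] with v hv
      exact hYd v hv
    have e2 : (d : ℂ) * ν (y ^ q) * deriv Y y = q * (y ^ q * deriv ν (y ^ q)) := by
      calc (d : ℂ) * ν (y ^ q) * deriv Y y = y * (d * y ^ (d - 1) * deriv Y y) := by
            rw [← hyν]
            rw [show y ^ d = y * y ^ (d - 1) by rw [← pow_succ', Nat.sub_add_cancel (by omega)]]
            ring
        _ = y * (deriv ν (y ^ q) * (q * y ^ (q - 1))) := by rw [e1]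
        _ = q * ((y * y ^ (q - 1)) * deriv ν (y ^ q)) := by ring
        _ = _ := by rw [← pow_succ', Nat.sub_add_cancel hq]
    have e3 : deriv N (y ^ q) = m * (y ^ q) ^ (m - 1) * ν (y ^ q) +
        (y ^ q) ^ m * deriv ν (y ^ q) := by
      have h1 : HasDerivAt (fun v => v ^ m * ν v + c) _ (y ^ q) :=
        ((hasDerivAt_pow m (y ^ q)).mul hνd).add_const c
      refine HasDerivAt.deriv (h1.congr_of_eventuallyEq ?_)
      filter_upwards [isOpen_ball.mem_nhds hxR] with v hv
      rw [← hNν v hv]; ring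
    -- Here `‖deriv Y y‖ ≤ 1 / 4` makes the coefficient of `y ^ p` smaller than `p = q * m + d` in
    -- modulus. This is exactly what is needed for the expansion at `x` to exceed `‖deriv N x‖`.
    have e4 : (q : ℂ) * (y ^ q * deriv N (y ^ q)) = (q * m + d * deriv Y y) * y ^ p := by
      have h3 : (m : ℂ) * (y ^ q * (y ^ q) ^ (m - 1)) = m * (y ^ q) ^ m := by
        rcases Nat.eq_zero_or_pos m with rfl | hm0
        · simp
        · rw [← pow_succ', Nat.sub_add_cancel hm0]
      have h4 : y ^ p = (y ^ q) ^ m * ν (y ^ q) := by rw [← hNx, hNν _ hxR]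
      rw [h4, e3]
      linear_combination (q : ℂ) * ν (y ^ q) * h3 - (y ^ q) ^ m * e2
    have e5 : q * (‖y ^ q‖ * ‖deriv N (y ^ q)‖) ≤ (q * m + d * (1 / 4)) * ‖y ^ p‖ := by
      have := congrArg norm e4
      rw [norm_mul, norm_mul, norm_mul, Complex.norm_natCast] at this
      rw [this]
      gcongr
      refine (norm_add_le _ _).trans ?_
      rw [norm_mul, norm_mul, Complex.norm_natCast, Complex.norm_natCast, Complex.norm_natCast]
      gcongr
    rw [hcorr.expansion_eq hq hx0, hNx]
    have hq' : (0 : ℝ) < q := by exact_mod_cast hq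
    have hd' : (0 : ℝ) < d := by exact_mod_cast Nat.pos_of_ne_zero hd0
    have hp' : (p : ℝ) = q * m + d := by exact_mod_cast hd
    have hyp : 0 < ‖y ^ p‖ := norm_pos_iff.2 (pow_ne_zero p hy0)
    have hx' : 0 < ‖y ^ q‖ := norm_pos_iff.2 hx0
    have hMpos := hM.pos hq hpq
    have hlt : q * (‖y ^ q‖ * ‖deriv N (y ^ q)‖) < p * ‖y ^ p‖ := by
      refine e5.trans_lt ?_
      rw [hp']
      gcongr
      linarith
    have : p / q * (‖y ^ p‖ / ‖y ^ q‖) * M = p * ‖y ^ p‖ * M / (q * ‖y ^ q‖) := by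
      field_simp
    rw [this, lt_div_iff₀ (by positivity), one_mul]
    calc (q : ℝ) * ‖y ^ q‖ = q * (‖y ^ q‖ * ‖deriv N (y ^ q)‖) * M := by
          linear_combination (-(q : ℝ) * ‖y ^ q‖) * hM1
      _ < _ := by gcongr
  · rw [norm_pow]
    have hεR1 : ε * R ≤ 1 := by nlinarith
    exact (pow_le_of_le_one (norm_nonneg _) (hy.trans hεR1) hq.ne').trans hy

/-- The derivative of an inverse branch does not vanish, so `N - c` has at `0` a simple zero or
none, which gives `m = 1` or `m = 0`; `m = 1` is allowed because `q < p`. For a simple zero the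
Schwarz lemma bounds the quotient. -/
theorem exists_mem_julia_of_inverse_branch' (hq : 0 < q) (hpq : q < p) {N : ℂ → ℂ} {R ε : ℝ}
    (hR : 0 < R) (hR1 : R ≤ 1) (hε : 0 < ε) (hε8 : ε ≤ 1 / 8)
    (hN : ∀ v ∈ ball (0 : ℂ) R, IsInverseBranch p q c N v)
    (hNc : ∀ v ∈ ball (0 : ℂ) R, v ≠ 0 → N v ≠ c)
    (hle : ∀ v ∈ ball (0 : ℂ) R, ‖N v - c‖ ≤ (ε * R) ^ p) :
    ∃ x ∈ julia p q c, ‖x‖ ≤ ε * R := by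
  have hNd : DifferentiableOn ℂ N (ball 0 R) := fun v hv =>
    (hN v hv).1.differentiableAt.differentiableWithinAt
  by_cases h0 : N 0 = c
  · refine exists_mem_julia_of_inverse_branch hq hpq (m := 1) (ν := dslope N 0) (by omega) hR hR1 hε
      hε8 hN ?_ ?_ ?_ ?_
    · exact (Complex.differentiableOn_dslope (isOpen_ball.mem_nhds (mem_ball_self hR))).2 hNd
    · intro v hv
      have := sub_smul_dslope N 0 v
      rw [h0] at this
      simpa using this.symm
    · intro v hv
      by_cases hv0 : v = 0
      · rw [hv0, dslope_same]
        exact (hN 0 (mem_ball_self hR)).deriv_ne_zero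
      · rw [dslope_of_ne _ hv0, slope_def_field, h0]
        exact div_ne_zero (sub_ne_zero.2 (hNc v hv hv0)) (by simpa using hv0)
    · intro v hv
      have := Complex.norm_dslope_le_div_of_mapsTo_ball (R₂ := (ε * R) ^ p) hNd (fun u hu => by
        rw [h0, mem_closedBall, dist_eq_norm]; exact hle u hu) hv
      refine this.trans ?_
      rw [div_le_iff₀ hR]
      have h1 : ε * R ≤ 1 := by nlinarith
      calc (ε * R) ^ p ≤ (ε * R) ^ (p - q * 1 + 1) :=
            pow_le_pow_of_le_one (by positivity) h1 (by omega)
        _ = (ε * R) ^ (p - q * 1) * (ε * R) := pow_succ _ _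
        _ ≤ _ := by
          gcongr
          nlinarith
  · refine exists_mem_julia_of_inverse_branch hq hpq (m := 0) (ν := fun v => N v - c) (by omega) hR
      hR1 hε hε8 hN (hNd.sub_const c) (by simp) ?_ (by simpa using hle)
    intro v hv
    by_cases hv0 : v = 0
    · rw [hv0]; exact sub_ne_zero.2 h0
    · exact sub_ne_zero.2 (hNc v hv hv0)

/-- If a repelling periodic point is post-critical then the critical point is in the Julia set. -/
theorem zero_mem_julia_of_postcritical (hq : 0 < q) (hpq : q < p) {z : ℂ} {m m' : ℝ}
    (hz : Path p q c z z m) (hm : 1 < m) (hc : Path p q c c z m') : (0 : ℂ) ∈ julia p q c := by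
  have hz0 : z ≠ 0 := hz.ne_zero hm.ne'
  have hc0 : (0 : ℂ) ≠ c := by
    cases hc with
    | nil => exact hz0.symm
    | cons hc0 => exact hc0.symm
  obtain ⟨g, ρ, κ, hρ, hκ, hκ1, hg⟩ := hz.exists_contracting_inverse hq hpq hm
  obtain ⟨γ, hγz, -, hγ⟩ := hc.exists_inverse hq hpq
  obtain ⟨b, hbρ, hb⟩ := exists_reflTransGen_mem_ball hq hpq hz hm hρ hc0
  obtain ⟨n, hb0⟩ := exists_path_of_reflTransGen_zero hb
  obtain ⟨β, hβ0, -, hβ⟩ := hb0.exists_inverse hq hpq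
  have hcl : IsClosed (julia p q c) := isClosed_closure
  refine hcl.closure_subset (Metric.mem_closure_iff.2 fun r hr => ?_)
  have hβc := hβ.self_of_nhds.1.continuousAt.eventually
    (isOpen_ball.mem_nhds (by rwa [hβ0] : β 0 ∈ ball z ρ))
  have hβn := hβ.self_of_nhds.1.differentiableAt.hasDerivAt.eventually_ne
    hβ.self_of_nhds.deriv_ne_zero (c := z)
  rw [eventually_nhdsWithin_iff] at hβn
  obtain ⟨R₀, hR₀, hball₀⟩ := Metric.eventually_nhds_iff_ball.1 (hβ.and (hβc.and hβn))
  set R := min R₀ (min r 1)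
  have hR : 0 < R := lt_min hR₀ (lt_min hr one_pos)
  have hball : ∀ v ∈ ball (0 : ℂ) R, IsInverseBranch p q c β v ∧ β v ∈ ball z ρ ∧
      (v ∈ ({0}ᶜ : Set ℂ) → β v ≠ z) := fun v hv =>
    hball₀ v (ball_subset_ball (min_le_left _ _) hv)
  have hγc := hγ.self_of_nhds.1.continuousAt.eventually
    (closedBall_mem_nhds (γ z) (by positivity : 0 < (1 / 8 * R) ^ p))
  rw [hγz] at hγc
  have hγn := hγ.self_of_nhds.1.differentiableAt.hasDerivAt.eventually_ne
    hγ.self_of_nhds.deriv_ne_zero (c := c)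
  rw [eventually_nhdsWithin_iff] at hγn
  obtain ⟨σ, hσ, hballσ⟩ := Metric.eventually_nhds_iff_ball.1 (hγ.and (hγc.and hγn))
  obtain ⟨k, hk⟩ := exists_pow_mul_lt hκ hκ1 ρ hσ
  have hgk : ∀ v ∈ ball z ρ, g^[k] v ∈ ball z σ := by
    intro v hv
    have hv' : ‖v - z‖ < ρ := by rwa [← dist_eq_norm]
    rw [mem_ball, dist_eq_norm]
    refine ((hg k v hv).2.1.trans ?_).trans_lt hk
    gcongr
  -- Now the backward journey leads from near `0` to near `z`, then closer to `z`, then close to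
  -- `c`. Adding the critical step from near `0` to near `c` closes the loop.
  have hT : ∀ v ∈ ball (0 : ℂ) R, IsInverseBranch p q c (γ ∘ (g^[k] ∘ β)) v := fun v hv =>
    (hballσ _ (hgk _ (hball v hv).2.1)).1.comp (γ := g^[k] ∘ β)
      ((hg k _ (hball v hv).2.1).1.comp (hball v hv).1)
  obtain ⟨x, hx, hxR⟩ := exists_mem_julia_of_inverse_branch' hq hpq hR
    ((min_le_right _ _).trans (min_le_right _ _)) (by norm_num) le_rfl hT
    (fun v hv hv0 => (hballσ _ (hgk _ (hball v hv).2.1)).2.2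
      ((hg k _ (hball v hv).2.1).2.2 ((hball v hv).2.2 hv0)))
    (fun v hv => by
      rw [← dist_eq_norm]
      exact (hballσ _ (hgk _ (hball v hv).2.1)).2.1)
  refine ⟨x, hx, ?_⟩
  rw [dist_comm, dist_zero_right]
  have : R ≤ r := (min_le_right _ _).trans (min_le_left _ _)
  linarith

/-- The Julia set is backward invariant if it contains neither the critical point nor the critical
value. -/
theorem julia_backward_invariant (hq : 0 < q) (hpq : q < p) (h0 : (0 : ℂ) ∉ julia p q c)
    (hc : c ∉ julia p q c) {z w : ℂ} (hz : z ∈ julia p q c) (h : Corr p q c w z) :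
    w ∈ julia p q c := by
  have hcl : IsClosed (julia p q c) := isClosed_closure
  have key : ∀ {z w : ℂ} {m : ℝ}, 1 < m → Path p q c z z m → w ≠ 0 → Corr p q c w z →
      w ∈ julia p q c := by
    intro z w m hm hz hw0 hwz
    -- A post-critical `z` would put `0` in the Julia set. Hence the transitivity orbit from near
    -- `z` to `w` can be taken to avoid `0`: otherwise `c` would lead to `w` and on to `z`.
    have hpc : ∀ n, ¬ Path p q c c z n := fun n hn =>
      h0 (zero_mem_julia_of_postcritical hq hpq hz hm hn)
    have hwc : w ≠ c := by
      rintro rfl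
      exact hpc _ (.single hw0 hwz)
    refine mem_julia_of_homoclinic hq hpq hz hm (.single hw0 hwz) fun ε hε => ?_
    obtain ⟨b, hb, hbw⟩ := exists_reflTransGen_mem_ball hq hpq hz hm hε hwc
    refine ⟨b, hb, (exists_path_of_reflTransGen hq hpq hbw).resolve_right ?_⟩
    rintro ⟨n, hn⟩
    exact hpc _ (hn.trans (.single hw0 hwz))
  have hzc : z ≠ c := by rintro rfl; exact hc hz
  have hw0 : w ≠ 0 := h.ne_zero hq hpq hzc
  -- A local branch of the preimage through `w` carries repelling periodic points near `z` to points
  -- of the Julia set near `w`.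
  obtain ⟨b, hb, hbz, hbp⟩ := exists_analyticAt_root (n := p) (by omega)
    (a := fun v => (v - c) ^ q) (u := z) (x := w) ((analyticAt_id.sub analyticAt_const).pow q)
    h.symm hw0
  have hb0 : ∀ᶠ v in 𝓝 z, b v ≠ 0 := hb.continuousAt.eventually_ne (by rw [hbz]; exact hw0)
  have hfr := (mem_closure_iff_frequently.1 hz).and_eventually (hbp.and hb0)
  rw [← hbz]
  refine hcl.mem_of_frequently_of_tendsto (hfr.mono ?_) hb.continuousAt
  rintro v ⟨⟨n, ζ, hcyc, k, hk, rfl⟩, hbv, hbv0⟩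
  obtain ⟨m, hm, hpath⟩ := hcyc.exists_path hq hpq hk
  exact key hm hpath hbv0 hbv.symm

end

/-! ### The topology of the Cantor bundle -/

/-- The space of orbits in `Λ`. -/
def orbitSet (p q : ℕ) (c : ℂ) (Λ : Set ℂ) : Set (ℕ → ℂ) := {z | IsOrbitIn p q c Λ z}

/-- The shift on sequences. -/
def shift (z : ℕ → ℂ) : ℕ → ℂ := fun n => z (n + 1)

theorem continuous_shift : Continuous shift := continuous_pi fun n => continuous_apply (n + 1)

theorem iterate_shift (z : ℕ → ℂ) (k n : ℕ) : shift^[k] z n = z (n + k) := by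
  induction k generalizing z with
  | zero => rfl
  | succ k ih => rw [Function.iterate_succ_apply, ih]; exact congrArg z (by omega)

section

variable {p q : ℕ} {c : ℂ} {r δ : ℝ} {Λ : Set ℂ}

theorem IsOrbitIn.shift {z : ℕ → ℂ} (h : IsOrbitIn p q c Λ z) :
    IsOrbitIn p q c Λ (shift z) := fun n => h (n + 1)

theorem IsOrbitIn.iterate_shift {z : ℕ → ℂ} (h : IsOrbitIn p q c Λ z) (k : ℕ) :
    IsOrbitIn p q c Λ (BranchedJulia.shift^[k] z) := by
  induction k generalizing z with
  | zero => exact h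
  | succ k ih => exact ih h.shift

theorem isCompact_orbitSet (hΛ : IsCompact Λ) : IsCompact (orbitSet p q c Λ) := by
  refine (isCompact_univ_pi fun _ : ℕ => hΛ).of_isClosed_subset ?_ fun z hz n _ => (hz n).1
  have e : orbitSet p q c Λ = ⋂ n, ((fun z : ℕ → ℂ => z n) ⁻¹' Λ ∩
      {z | Corr p q c (z n) (z (n + 1))}) := by
    ext z
    simp [orbitSet, IsOrbitIn]
  rw [e]
  exact isClosed_iInter fun n => (hΛ.isClosed.preimage (continuous_apply n)).inter
    (isClosed_corr (continuous_apply n) (continuous_apply (n + 1)))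

theorem IsSemiInvariant.ne_zero (h : IsSemiInvariant p q c r Λ) (hr : 0 < r) {z : ℂ} (hz : z ∈ Λ) :
    z ≠ 0 :=
  norm_pos_iff.1 (hr.trans (h.mem_annulus z hz).1.1)

theorem IsSemiInvariant.ne (h : IsSemiInvariant p q c r Λ) (hr : 0 < r) {z : ℂ} (hz : z ∈ Λ) :
    z ≠ c :=
  sub_ne_zero.1 (norm_pos_iff.1 (hr.trans (h.mem_annulus z hz).2.1))

theorem norm_add_le_of_closedBall_subset {u : ℂ} (hδ : 0 < δ)
    (h : closedBall u δ ⊆ closedBall (0 : ℂ) 1) : ‖u‖ + δ ≤ 1 := by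
  by_cases hu : u = 0
  · have : (δ : ℂ) ∈ closedBall u δ := by simp [hu, abs_of_pos hδ]
    simpa [hu, abs_of_pos hδ] using h this
  · have hu' : 0 < ‖u‖ := norm_pos_iff.2 hu
    have h1 : u + (δ / ‖u‖ : ℝ) * u ∈ closedBall u δ := by
      rw [mem_closedBall, dist_eq_norm, add_sub_cancel_left, norm_mul, Complex.norm_real,
        Real.norm_of_nonneg (by positivity), div_mul_cancel₀ _ hu'.ne']
    have h2 := h h1
    rw [mem_closedBall_zero_iff] at h2
    have h3 : u + (δ / ‖u‖ : ℝ) * u = ((1 + δ / ‖u‖ : ℝ) : ℂ) * u := by push_cast; ring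
    rw [h3, norm_mul, Complex.norm_real, Real.norm_of_nonneg (by positivity)] at h2
    field_simp at h2
    linarith

theorem IsScale.norm_add_le (hs : IsScale p q c r δ Λ) (h : IsSemiInvariant p q c r Λ) {w : ℂ}
    (hw : w ∈ Λ) : r * ‖w‖ + δ ≤ 1 := by
  obtain ⟨z, hz, hzw⟩ := h.exists_preimage w hw
  have := norm_add_le_of_closedBall_subset hs.δ_pos (hs.forward_subset z hz w hw hzw)
  rwa [norm_mul, Complex.norm_real, Real.norm_of_nonneg hs.r_pos.le] at this

theorem IsScale.lt_one (hs : IsScale p q c r δ Λ) (h : IsSemiInvariant p q c r Λ)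
    (hne : Λ.Nonempty) : δ < 1 := by
  obtain ⟨w, hw⟩ := hne
  have h1 := hs.norm_add_le h hw
  have h2 := norm_pos_iff.2 (h.ne_zero hs.r_pos hw)
  have := mul_pos hs.r_pos h2
  linarith

theorem summable_bundle (hδ : 0 < δ) (hδ1 : δ < 1) {z : ℕ → ℂ} {M : ℝ} (hz : ∀ n, ‖z n‖ ≤ M) :
    Summable fun n : ℕ => (δ : ℂ) ^ n * z (n + 1) := by
  refine Summable.of_norm_bounded (g := fun n => δ ^ n * M)
    ((summable_geometric_of_lt_one hδ.le hδ1).mul_right M) fun n => ?_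
  rw [norm_mul, norm_pow, Complex.norm_real, Real.norm_of_nonneg hδ.le]
  gcongr
  exact hz _

/-- The self-similarity of the fibres: the second component of the bundle map inverts this affine
relation, which is why that map acts as the shift. -/
theorem bundlePoint_snd_eq (hδ : 0 < δ) (hδ1 : δ < 1) {z : ℕ → ℂ} {M : ℝ} (hz : ∀ n, ‖z n‖ ≤ M) :
    (bundlePoint r δ z).2 = r * z 1 + δ * (bundlePoint r δ (shift z)).2 := by
  simp only [bundlePoint, shift]
  rw [(summable_bundle hδ hδ1 hz).tsum_eq_zero_add, pow_zero, one_mul, mul_add, ← tsum_mul_left,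
    ← tsum_mul_left, ← tsum_mul_left]
  congr 2
  funext n
  rw [pow_succ]
  ring

theorem bundlePoint_snd_eq_sum (hδ : 0 < δ) (hδ1 : δ < 1) {z : ℕ → ℂ} {M : ℝ}
    (hz : ∀ n, ‖z n‖ ≤ M) (n : ℕ) :
    (bundlePoint r δ z).2 = r * ∑ k ∈ Finset.range n, (δ : ℂ) ^ k * z (k + 1) +
      δ ^ n * (bundlePoint r δ (shift^[n] z)).2 := by
  induction n with
  | zero => simp
  | succ n ih =>
    rw [ih, bundlePoint_snd_eq hδ hδ1 (z := shift^[n] z) (M := M)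
      (fun k => by rw [iterate_shift]; exact hz _), ← Function.iterate_succ_apply' shift,
      Finset.sum_range_succ, iterate_shift, pow_succ, add_comm 1 n]
    ring

theorem norm_bundlePoint_snd_le (hr : 0 < r) (hδ : 0 < δ) (hδ1 : δ < 1) {z : ℕ → ℂ}
    (hz : ∀ n, r * ‖z n‖ + δ ≤ 1) : ‖(bundlePoint r δ z).2‖ ≤ 1 := by
  simp only [bundlePoint]
  rw [← tsum_mul_left]
  have h1 : HasSum (fun n : ℕ => δ ^ n * (1 - δ)) 1 := by
    have := (hasSum_geometric_of_lt_one hδ.le hδ1).mul_right (1 - δ)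
    rwa [inv_mul_cancel₀ (by linarith)] at this
  refine tsum_of_norm_bounded h1 fun n => ?_
  rw [norm_mul, norm_mul, norm_pow, Complex.norm_real, Complex.norm_real,
    Real.norm_of_nonneg hδ.le, Real.norm_of_nonneg hr.le]
  have := hz (n + 1)
  calc r * (δ ^ n * ‖z (n + 1)‖) = δ ^ n * (r * ‖z (n + 1)‖) := by ring
    _ ≤ _ := by gcongr; linarith

/-- The bound for orbits in a set to which the bundle construction applies. -/
theorem norm_le_of_scale (hr : 0 < r) (hδ : 0 < δ) {w : ℂ} (h : r * ‖w‖ + δ ≤ 1) :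
    ‖w‖ ≤ 1 / r := by
  rw [le_div_iff₀ hr]
  linarith

/-- The second coordinate lies in the disc of radius `δ` about `r z₁`. The discs over the images of
`z₀` are disjoint, so `z₁` can be read off; subtracting and rescaling leaves the bundle point of the
shifted orbit. -/
theorem bundlePoint_injOn (hδ1 : δ < 1) (h : IsSemiInvariant p q c r Λ)
    (hs : IsScale p q c r δ Λ) : InjOn (bundlePoint r δ) (orbitSet p q c Λ) := by
  have hb : ∀ {z}, z ∈ orbitSet p q c Λ → ∀ n, r * ‖z n‖ + δ ≤ 1 := fun hz n =>
    hs.norm_add_le h (hz n).1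
  have hM : ∀ {z}, z ∈ orbitSet p q c Λ → ∀ n, ‖z n‖ ≤ 1 / r := fun hz n =>
    norm_le_of_scale hs.r_pos hs.δ_pos (hb hz n)
  have hmem : ∀ {z}, z ∈ orbitSet p q c Λ →
      (bundlePoint r δ z).2 ∈ closedBall ((r : ℂ) * z 1) δ := by
    intro z hz
    rw [mem_closedBall, dist_eq_norm, bundlePoint_snd_eq hs.δ_pos hδ1 (hM hz), add_sub_cancel_left,
      norm_mul, Complex.norm_real, Real.norm_of_nonneg hs.δ_pos.le]
    exact mul_le_of_le_one_right hs.δ_pos.le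
      (norm_bundlePoint_snd_le hs.r_pos hs.δ_pos hδ1 (hb (IsOrbitIn.shift hz)))
  have step : ∀ {z z'}, z ∈ orbitSet p q c Λ → z' ∈ orbitSet p q c Λ →
      bundlePoint r δ z = bundlePoint r δ z' →
      bundlePoint r δ (shift z) = bundlePoint r δ (shift z') := by
    intro z z' hz hz' heq
    have h0 : z 0 = z' 0 := congrArg Prod.fst heq
    have h2 := congrArg Prod.snd heq
    have h1 : z 1 = z' 1 := by
      by_contra hne
      refine (hs.forward_disjoint (z 0) (hz 0).1 (z 1) (hz 1).1 (z' 1) (hz' 1).1 (hz 0).2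
        (by rw [h0]; exact (hz' 0).2) hne).le_bot ⟨hmem hz, ?_⟩
      rw [h2]
      exact hmem hz'
    rw [bundlePoint_snd_eq hs.δ_pos hδ1 (hM hz), bundlePoint_snd_eq hs.δ_pos hδ1 (hM hz'), h1] at h2
    have h3 : (δ : ℂ) ≠ 0 := by exact_mod_cast hs.δ_pos.ne'
    exact Prod.ext h1 (mul_left_cancel₀ h3 (add_left_cancel h2))
  intro z hz z' hz' heq
  have : ∀ n, bundlePoint r δ (shift^[n] z) = bundlePoint r δ (shift^[n] z') := by
    intro n
    induction n with
    | zero => exact heq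
    | succ n ih =>
      rw [Function.iterate_succ_apply', Function.iterate_succ_apply']
      exact step (IsOrbitIn.iterate_shift hz n) (IsOrbitIn.iterate_shift hz' n) ih
  funext n
  have h1 : shift^[n] z 0 = shift^[n] z' 0 := congrArg Prod.fst (this n)
  simpa [iterate_shift] using h1

theorem continuousOn_bundlePoint (hδ : 0 < δ) (hδ1 : δ < 1) (M : ℝ) :
    ContinuousOn (bundlePoint r δ) {z | ∀ n, ‖z n‖ ≤ M} := by
  refine ContinuousOn.prodMk (continuous_apply 0).continuousOn (ContinuousOn.mul
    continuousOn_const ?_)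
  refine continuousOn_tsum (u := fun n => δ ^ n * M)
    (fun n => (continuous_const.mul (continuous_apply (n + 1))).continuousOn)
    ((summable_geometric_of_lt_one hδ.le hδ1).mul_right M) fun n z hz => ?_
  rw [norm_mul, norm_pow, Complex.norm_real, Real.norm_of_nonneg hδ.le]
  gcongr
  exact hz _

theorem orbitSet_subset_bounded (h : IsSemiInvariant p q c r Λ) (hs : IsScale p q c r δ Λ) :
    orbitSet p q c Λ ⊆ {z | ∀ n, ‖z n‖ ≤ 1 / r} := fun _ hz n =>
  norm_le_of_scale hs.r_pos hs.δ_pos (hs.norm_add_le h (hz n).1)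

theorem isCompact_image_bundlePoint (hδ1 : δ < 1) (h : IsSemiInvariant p q c r Λ)
    (hs : IsScale p q c r δ Λ) : IsCompact (bundlePoint r δ '' orbitSet p q c Λ) :=
  (isCompact_orbitSet h.isCompact).image_of_continuousOn
    ((continuousOn_bundlePoint hs.δ_pos hδ1 _).mono (orbitSet_subset_bounded h hs))

/-- The orbit witnessing membership in `𝒟_n⁺` may change with `n`, so a point of the bundle is a
priori only a limit of coded points. The set of coded points is compact, hence contains it. -/
theorem cantorBundle_eq (hδ1 : δ < 1) (h : IsSemiInvariant p q c r Λ)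
    (hs : IsScale p q c r δ Λ) :
    cantorBundle p q c r δ Λ = bundlePoint r δ '' orbitSet p q c Λ := by
  have key : ∀ z ∈ orbitSet p q c Λ, ∀ n, ‖(bundlePoint r δ z).2 -
      r * ∑ k ∈ Finset.range n, (δ : ℂ) ^ k * z (k + 1)‖ ≤ δ ^ n := by
    intro z hz n
    rw [bundlePoint_snd_eq_sum hs.δ_pos hδ1 (orbitSet_subset_bounded h hs hz) n,
      add_sub_cancel_left, norm_mul, norm_pow, Complex.norm_real, Real.norm_of_nonneg hs.δ_pos.le]
    refine mul_le_of_le_one_right (pow_nonneg hs.δ_pos.le n)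
      (norm_bundlePoint_snd_le hs.r_pos hs.δ_pos hδ1 fun k => ?_)
    exact hs.norm_add_le h (IsOrbitIn.iterate_shift hz n k).1
  ext x
  constructor
  · rintro ⟨hx, hn⟩
    choose! ζ hζ using hn
    refine (isCompact_image_bundlePoint hδ1 h hs).isClosed.mem_of_tendsto
      (f := fun n => bundlePoint r δ (ζ (n + 1))) (b := atTop) ?_
      (Eventually.of_forall fun n => ⟨_, (hζ (n + 1) (by omega)).1, rfl⟩)
    rw [tendsto_iff_dist_tendsto_zero]
    refine squeeze_zero (fun _ => dist_nonneg) (g := fun n => 2 * δ ^ (n + 1)) (fun n => ?_) ?_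
    · obtain ⟨h1, h2, h3⟩ := hζ (n + 1) (by omega)
      have h4 := key _ h1 (n + 1)
      rw [mem_closedBall, dist_eq_norm] at h3
      rw [Prod.dist_eq, max_le_iff]
      constructor
      · have : (bundlePoint r δ (ζ (n + 1))).1 = x.1 := h2
        rw [this, dist_self]
        have := pow_pos hs.δ_pos (n + 1)
        linarith
      · rw [dist_eq_norm, ← sub_sub_sub_cancel_right _ _
          (r * ∑ k ∈ Finset.range (n + 1), (δ : ℂ) ^ k * ζ (n + 1) (k + 1))]
        refine (norm_sub_le _ _).trans ?_
        linarith
    · have := ((tendsto_pow_atTop_nhds_zero_of_lt_one hs.δ_pos.le hδ1).comp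
        (tendsto_add_atTop_nat 1)).const_mul 2
      simpa using this
  · rintro ⟨z, hz, rfl⟩
    exact ⟨(hz 0).1, fun n _ => ⟨z, hz, rfl, by
      rw [mem_closedBall, dist_eq_norm]; exact key z hz n⟩⟩

theorem bundlePoint_mem (hδ1 : δ < 1) (h : IsSemiInvariant p q c r Λ) (hs : IsScale p q c r δ Λ)
    {z : ℕ → ℂ} (hz : IsOrbitIn p q c Λ z) : bundlePoint r δ z ∈ cantorBundle p q c r δ Λ := by
  rw [cantorBundle_eq hδ1 h hs]
  exact ⟨z, hz, rfl⟩

/-- The orbit determined by a point of the bundle. -/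
def orbitOf (p q : ℕ) (c : ℂ) (r δ : ℝ) (Λ : Set ℂ) : ℂ × ℂ → ℕ → ℂ :=
  Function.invFunOn (bundlePoint r δ) (orbitSet p q c Λ)

theorem orbitOf_mem (hδ1 : δ < 1) (h : IsSemiInvariant p q c r Λ) (hs : IsScale p q c r δ Λ)
    {x : ℂ × ℂ} (hx : x ∈ cantorBundle p q c r δ Λ) :
    IsOrbitIn p q c Λ (orbitOf p q c r δ Λ x) := by
  rw [cantorBundle_eq hδ1 h hs] at hx
  exact Function.invFunOn_mem hx

theorem bundlePoint_orbitOf (hδ1 : δ < 1) (h : IsSemiInvariant p q c r Λ)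
    (hs : IsScale p q c r δ Λ) {x : ℂ × ℂ} (hx : x ∈ cantorBundle p q c r δ Λ) :
    bundlePoint r δ (orbitOf p q c r δ Λ x) = x := by
  rw [cantorBundle_eq hδ1 h hs] at hx
  exact Function.invFunOn_eq hx

theorem orbitOf_bundlePoint (hδ1 : δ < 1) (h : IsSemiInvariant p q c r Λ)
    (hs : IsScale p q c r δ Λ) {z : ℕ → ℂ} (hz : IsOrbitIn p q c Λ z) :
    orbitOf p q c r δ Λ (bundlePoint r δ z) = z :=
  bundlePoint_injOn hδ1 h hs (orbitOf_mem hδ1 h hs (bundlePoint_mem hδ1 h hs hz)) hz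
    (bundlePoint_orbitOf hδ1 h hs (bundlePoint_mem hδ1 h hs hz))

theorem continuousOn_orbitOf (hδ1 : δ < 1) (h : IsSemiInvariant p q c r Λ)
    (hs : IsScale p q c r δ Λ) :
    ContinuousOn (orbitOf p q c r δ Λ) (cantorBundle p q c r δ Λ) := by
  rw [continuousOn_iff_isClosed]
  intro t ht
  refine ⟨bundlePoint r δ '' (orbitSet p q c Λ ∩ t), ?_, ?_⟩
  · exact (((isCompact_orbitSet h.isCompact).inter_right ht).image_of_continuousOn
      ((continuousOn_bundlePoint hs.δ_pos hδ1 _).mono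
        (inter_subset_left.trans (orbitSet_subset_bounded h hs)))).isClosed
  · ext x
    constructor
    · rintro ⟨hxt, hx⟩
      exact ⟨⟨_, ⟨orbitOf_mem hδ1 h hs hx, hxt⟩, bundlePoint_orbitOf hδ1 h hs hx⟩, hx⟩
    · rintro ⟨⟨z, ⟨hz, hzt⟩, rfl⟩, hx⟩
      refine ⟨?_, hx⟩
      rw [mem_preimage, orbitOf_bundlePoint hδ1 h hs hz]
      exact hzt

theorem isCompact_cantorBundle (hδ1 : δ < 1) (h : IsSemiInvariant p q c r Λ)
    (hs : IsScale p q c r δ Λ) : IsCompact (cantorBundle p q c r δ Λ) := by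
  rw [cantorBundle_eq hδ1 h hs]
  exact isCompact_image_bundlePoint hδ1 h hs

/-- A bundle map acts as the shift on the bundle. -/
theorem IsBundleMap.apply_bundlePoint {η : ℝ} {f : ℂ × ℂ → ℂ × ℂ}
    (hf : IsBundleMap p q c r δ Λ η f) (hη : 0 < η) (hδ1 : δ < 1) (h : IsSemiInvariant p q c r Λ)
    (hs : IsScale p q c r δ Λ) {z : ℕ → ℂ} (hz : IsOrbitIn p q c Λ z) :
    f (bundlePoint r δ z) = bundlePoint r δ (shift z) := by
  have h1 : (f (bundlePoint r δ z)).1 = z 1 := hf.branch z hz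
  refine Prod.ext h1 ?_
  rw [hf.snd_eq _ (self_subset_thickening hη _ (bundlePoint_mem hδ1 h hs hz)), h1,
    bundlePoint_snd_eq hs.δ_pos hδ1 (orbitSet_subset_bounded h hs hz)]
  have : (δ : ℂ) ≠ 0 := by exact_mod_cast hs.δ_pos.ne'
  field_simp
  ring

end

/-! ### Shadowing of orbits in a hyperbolic set -/

/-- The preimage of `v` under `𝐟_c` which continues the preimage `z` of `w` under `𝐟_{c₀}`. -/
def pullback (p q : ℕ) (c₀ z w c v : ℂ) : ℂ := z * ((v - c) / (w - c₀)) ^ (q / p : ℂ)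

section

variable {p q : ℕ} {c₀ : ℂ}

theorem pullback_corr (hp : p ≠ 0) {z w : ℂ} (h : Corr p q c₀ z w) (hw : w ≠ c₀) (c v : ℂ) :
    Corr p q c (pullback p q c₀ z w c v) v := by
  have hw' : w - c₀ ≠ 0 := sub_ne_zero.2 hw
  have hp' : (p : ℂ) ≠ 0 := by exact_mod_cast hp
  unfold Corr at h
  rw [Corr, pullback, mul_pow, ← Complex.cpow_mul_nat, div_mul_cancel₀ _ hp', Complex.cpow_natCast,
    ← h, div_pow, mul_div_cancel₀ _ (pow_ne_zero q hw')]

theorem pullback_self {z w : ℂ} (hw : w ≠ c₀) : pullback p q c₀ z w c₀ w = z := by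
  rw [pullback, div_self (sub_ne_zero.2 hw), Complex.one_cpow, mul_one]

/-- Constants for which the inverse branches of `𝐟_c` near a hyperbolic set of `𝐟_{c₀}` contract. -/
structure Shadowing (p q : ℕ) (c₀ : ℂ) (J : Set ℂ) (μ : ℂ → ℝ) (θ a b e τ : ℝ) : Prop where
  p_ne : p ≠ 0
  isCompact : IsCompact J
  continuousOn : ContinuousOn μ J
  ne : ∀ z ∈ J, z ≠ c₀
  a_pos : 0 < a
  le_μ : ∀ z ∈ J, a ≤ μ z
  μ_le : ∀ z ∈ J, μ z ≤ b
  b_pos : 0 < b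
  θ_pos : 0 < θ
  θ_lt : θ < 1
  e_pos : 0 < e
  τ_pos : 0 < τ
  small : θ * (b * τ) ≤ (1 - θ) * e
  small' : 2 * (θ * (b * τ) / (1 - θ)) * b ≤ e * a
  mem_slitPlane : ∀ w ∈ J, ∀ c v, ‖c - c₀‖ ≤ τ → μ w * ‖v - w‖ ≤ e →
    (v - c) / (w - c₀) ∈ Complex.slitPlane
  contract : ∀ z ∈ J, ∀ w ∈ J, Corr p q c₀ z w → ∀ c c' v v', ‖c - c₀‖ ≤ τ → ‖c' - c₀‖ ≤ τ →
    μ w * ‖v - w‖ ≤ e → μ w * ‖v' - w‖ ≤ e →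
    μ z * ‖pullback p q c₀ z w c v - pullback p q c₀ z w c' v'‖ ≤
      θ * (μ w * (‖v - v'‖ + ‖c - c'‖))
  unique : ∀ z ∈ J, ∀ w ∈ J, Corr p q c₀ z w → ∀ c u v, ‖c - c₀‖ ≤ τ → Corr p q c u v →
    μ z * ‖u - z‖ ≤ e → μ w * ‖v - w‖ ≤ e → u = pullback p q c₀ z w c v

/-- The derivative of `t ^ s` at `1` is `s`. The slack `k` will be absorbed by the expansion
constant of the metric. -/
theorem exists_cpow_contract {s k : ℝ} (hs : 0 < s) (hk : 1 < k) :
    ∃ η : ℝ, 0 < η ∧ η < 1 ∧ ∀ t t' : ℂ, ‖t - 1‖ ≤ η → ‖t' - 1‖ ≤ η →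
      ‖t ^ (s : ℂ) - t' ^ (s : ℂ)‖ ≤ s * k * ‖t - t'‖ := by
  have hc : ContinuousAt (fun t : ℂ => ‖(s : ℂ) * t ^ ((s : ℂ) - 1)‖) 1 := by
    refine (continuousAt_const.mul ?_).norm
    exact continuousAt_id.cpow continuousAt_const Complex.one_mem_slitPlane
  have hlt : ∀ᶠ t in 𝓝 (1 : ℂ), ‖(s : ℂ) * t ^ ((s : ℂ) - 1)‖ < s * k := by
    refine hc.eventually (gt_mem_nhds ?_)
    simp only [Complex.one_cpow, mul_one, Complex.norm_real, Real.norm_of_nonneg hs.le]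
    nlinarith
  have hsl : ∀ᶠ t in 𝓝 (1 : ℂ), t ∈ Complex.slitPlane :=
    Complex.isOpen_slitPlane.mem_nhds Complex.one_mem_slitPlane
  obtain ⟨η, hη, hball⟩ := Metric.eventually_nhds_iff_ball.1 (hlt.and hsl)
  refine ⟨min (η / 2) (1 / 2), by positivity, (min_le_right _ _).trans_lt (by norm_num),
    fun t t' ht ht' => ?_⟩
  have hd : ∀ t ∈ ball (1 : ℂ) η, HasDerivAt (fun t : ℂ => t ^ (s : ℂ))
      ((s : ℂ) * t ^ ((s : ℂ) - 1)) t := fun t ht => by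
    simpa using (hasDerivAt_id t).cpow_const (c := (s : ℂ)) (hball t ht).2
  have hin : ∀ t : ℂ, ‖t - 1‖ ≤ min (η / 2) (1 / 2) → t ∈ ball (1 : ℂ) η := fun t ht => by
    rw [mem_ball, dist_eq_norm]
    linarith [ht.trans (min_le_left _ _)]
  exact (convex_ball (1 : ℂ) η).norm_image_sub_le_of_norm_deriv_le
    (fun t ht => (hd t ht).differentiableAt)
    (fun t ht => by rw [(hd t ht).deriv]; exact (hball t ht).1.le) (hin t' ht') (hin t ht)

theorem exists_bounds_on_compact {J : Set ℂ} {μ : ℂ → ℝ} (hJ : IsCompact J)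
    (hμ : ContinuousOn μ J) (hpos : ∀ z ∈ J, 0 < μ z) :
    ∃ a b : ℝ, 0 < a ∧ 0 < b ∧ ∀ z ∈ J, a ≤ μ z ∧ μ z ≤ b := by
  obtain ⟨B, hB⟩ := hJ.bddAbove_image hμ
  obtain ⟨A, hA⟩ := hJ.bddAbove_image (hμ.inv₀ fun z hz => (hpos z hz).ne')
  refine ⟨1 / max A 1, max B 1, by positivity, by positivity, fun z hz => ⟨?_, ?_⟩⟩
  · have h1 : (μ z)⁻¹ ≤ max A 1 := (hA ⟨z, hz, rfl⟩).trans (le_max_left _ _)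
    rw [one_div]
    exact inv_le_of_inv_le₀ (hpos z hz) h1
  · exact (hB ⟨z, hz, rfl⟩).trans (le_max_left _ _)

/-- The expansion of the hyperbolic metric along a single step. -/
theorem hyperbolic_step (hq : 0 < q) (hpq : q < p) {V : Set ℂ} {μ : ℂ → ℝ} {κ : ℝ}
    (hμ : ∀ z ∈ V, 0 < μ z)
    (h : ∀ z ∈ V, ∀ φ : ℂ → ℂ, IsBranchAt p q c₀ φ z → φ z ∈ V → κ ≤ μ (φ z) * ‖deriv φ z‖ / μ z)
    {z w : ℂ} (hz : z ∈ V) (hw : w ∈ V) (hz0 : z ≠ 0) (hzw : Corr p q c₀ z w) :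
    κ * μ z ≤ μ w * expansion p q z := by
  obtain ⟨φ, hφ, hφz⟩ := exists_branch hq hz0 hzw
  have := h z hz φ hφ (hφz ▸ hw)
  rwa [hφz, hφ.norm_deriv hq hpq hz0, le_div_iff₀ (hμ z hz)] at this

/-- A preimage branch is `z * t ^ (q / p)` with `t = (v - c) / (w - c₀)` near `1`, and its
derivative at the unperturbed step is the inverse of the expansion. Hyperbolicity gives the
contraction factor `1 / κ`; it is relaxed to `θ = k / κ` with `1 < k < κ` to cover nearby points and
parameters. Only values of `μ` on `J` enter, so the estimates use a fixed weight along each orbit.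
-/
theorem exists_shadowing (hq : 0 < q) (hpq : q < p) {r : ℝ} (hr : 0 < r) {J V : Set ℂ}
    (hJ : IsSemiInvariant p q c₀ r J) {μ : ℂ → ℝ} {κ : ℝ} (hJV : J ⊆ V) (hμc : ContinuousOn μ V)
    (hμ : ∀ z ∈ V, 0 < μ z) (hκ : 1 < κ)
    (h : ∀ z ∈ V, ∀ φ : ℂ → ℂ, IsBranchAt p q c₀ φ z → φ z ∈ V →
      κ ≤ μ (φ z) * ‖deriv φ z‖ / μ z) :
    ∃ θ a b e τ : ℝ, Shadowing p q c₀ J μ θ a b e τ := by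
  obtain ⟨a, b, ha, hb, hab⟩ := exists_bounds_on_compact hJ.isCompact (hμc.mono hJV)
    fun z hz => hμ z (hJV hz)
  have hp0 : 0 < p := by omega
  have hpr : (0 : ℝ) < p := by exact_mod_cast hp0
  have hqr : (0 : ℝ) < q := by exact_mod_cast hq
  set k : ℝ := (1 + κ) / 2 with hk
  have hk1 : 1 < k := by linarith
  set θ : ℝ := k / κ with hθ
  have hκ0 : 0 < κ := by linarith
  have hθ0 : 0 < θ := by positivity
  have hθ1 : θ < 1 := by rw [hθ, div_lt_one hκ0]; linarith
  obtain ⟨η, hη, hη1, hcp⟩ := exists_cpow_contract (s := q / p) (by positivity) hk1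
  obtain ⟨σ, hσ, hσ1, hsep⟩ := exists_root_separation hp0
  -- the conditions on `e` and `τ`
  set e : ℝ := min (a * (η * r / 2)) (a * (σ * r / 8)) with he
  have he0 : 0 < e := by positivity
  have he1 : e ≤ a * (η * r / 2) := min_le_left _ _
  have he2 : e ≤ a * (σ * r / 8) := min_le_right _ _
  have h1θ : 0 < 1 - θ := by linarith
  -- The first bound keeps `t` within `η` of `1`, the second keeps pullbacks within `e` of the
  -- orbit, and the third ensures that distinct orbits have distinct shadows.
  set τ : ℝ := min (η * r / 2) (min ((1 - θ) * e / (θ * b)) (e * a * (1 - θ) / (2 * θ * b * b)))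
    with hτ
  have hτ0 : 0 < τ := by positivity
  have hτ1 : τ ≤ η * r / 2 := min_le_left _ _
  have hτ2 : τ ≤ (1 - θ) * e / (θ * b) := (min_le_right _ _).trans (min_le_left _ _)
  have hτ3 : τ ≤ e * a * (1 - θ) / (2 * θ * b * b) := (min_le_right _ _).trans (min_le_right _ _)
  have hsmall : θ * (b * τ) ≤ (1 - θ) * e := by
    rw [le_div_iff₀ (by positivity)] at hτ2; linarith
  have hwr : ∀ w ∈ J, r < ‖w - c₀‖ := fun w hw => (hJ.mem_annulus w hw).2.1
  have hzr : ∀ w ∈ J, r < ‖w‖ := fun w hw => (hJ.mem_annulus w hw).1.1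
  have hea : ∀ w ∈ J, ∀ v, μ w * ‖v - w‖ ≤ e → ‖v - w‖ ≤ e / a := by
    intro w hw v hv
    rw [le_div_iff₀ ha]
    have := mul_le_mul_of_nonneg_right (hab w hw).1 (norm_nonneg (v - w))
    linarith
  have hnear : ∀ w ∈ J, ∀ c v, ‖c - c₀‖ ≤ τ → μ w * ‖v - w‖ ≤ e →
      ‖(v - c) / (w - c₀) - 1‖ ≤ η := by
    intro w hw c v hc hv
    have hne : w - c₀ ≠ 0 := sub_ne_zero.2 (hJ.ne hr hw)
    rw [div_sub_one hne, norm_div, div_le_iff₀ (norm_pos_iff.2 hne)]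
    have h1 : ‖v - c - (w - c₀)‖ ≤ ‖v - w‖ + ‖c - c₀‖ := by
      rw [show v - c - (w - c₀) = (v - w) - (c - c₀) by ring]
      exact norm_sub_le _ _
    have h2 := hea w hw v hv
    have h3 : e / a ≤ η * r / 2 := by rw [div_le_iff₀ ha]; linarith
    have h4 := mul_le_mul_of_nonneg_left (hwr w hw).le hη.le
    linarith
  have hcon : ∀ z ∈ J, ∀ w ∈ J, Corr p q c₀ z w → ∀ c c' v v', ‖c - c₀‖ ≤ τ → ‖c' - c₀‖ ≤ τ →
      μ w * ‖v - w‖ ≤ e → μ w * ‖v' - w‖ ≤ e →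
      μ z * ‖pullback p q c₀ z w c v - pullback p q c₀ z w c' v'‖ ≤
        θ * (μ w * (‖v - v'‖ + ‖c - c'‖)) := by
    intro z hz w hw hzw c c' v v' hc hc' hv hv'
    have hne : w - c₀ ≠ 0 := sub_ne_zero.2 (hJ.ne hr hw)
    have hz0 := hJ.ne_zero hr hz
    have h1 := hcp _ _ (hnear w hw c v hc hv) (hnear w hw c' v' hc' hv')
    have h2 := hyperbolic_step hq hpq hμ h (hJV hz) (hJV hw) hz0 hzw
    rw [hzw.expansion_eq hq hz0] at h2
    have hzn : 0 < ‖z‖ := norm_pos_iff.2 hz0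
    have hwn : 0 < ‖w - c₀‖ := norm_pos_iff.2 hne
    have hs : ((q / p : ℝ) : ℂ) = (q / p : ℂ) := by push_cast; rfl
    rw [hs, ← sub_div, norm_div] at h1
    rw [pullback, pullback, ← mul_sub, norm_mul]
    have h3 : ‖v - c - (v' - c')‖ ≤ ‖v - v'‖ + ‖c - c'‖ := by
      rw [show v - c - (v' - c') = (v - v') - (c - c') by ring]
      exact norm_sub_le _ _
    have h4 : μ z * ‖z‖ * (q / p) / ‖w - c₀‖ ≤ μ w / κ := by
      rw [le_div_iff₀ hκ0, div_mul_eq_mul_div, div_le_iff₀ hwn]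
      calc μ z * ‖z‖ * (q / p) * κ = κ * μ z * (‖z‖ * (q / p)) := by ring
        _ ≤ μ w * (p / q * (‖w - c₀‖ / ‖z‖)) * (‖z‖ * (q / p)) := by gcongr
        _ = _ := by field_simp
    have hμw := hμ w (hJV hw)
    have hμz := hμ z (hJV hz)
    calc μ z * (‖z‖ * _) ≤ μ z * (‖z‖ * (q / p * k * (‖v - c - (v' - c')‖ / ‖w - c₀‖))) := by
          gcongr
      _ = (μ z * ‖z‖ * (q / p) / ‖w - c₀‖) * (k * ‖v - c - (v' - c')‖) := by ring
      _ ≤ μ w / κ * (k * (‖v - v'‖ + ‖c - c'‖)) := by gcongr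
      _ = _ := by rw [hθ]; ring
  refine ⟨θ, a, b, e, τ, ⟨hp0.ne', hJ.isCompact, hμc.mono hJV, fun z hz => hJ.ne hr hz,
    ha,
    fun z hz => (hab z hz).1, fun z hz => (hab z hz).2, hb, hθ0, hθ1, he0, hτ0, hsmall, ?_, ?_,
    hcon, ?_⟩⟩
  · rw [le_div_iff₀ (by positivity)] at hτ3
    rw [mul_assoc, div_mul_eq_mul_div, ← mul_div_assoc, div_le_iff₀ h1θ]
    linarith
  · intro w hw c v hc hv
    have h1 := (hnear w hw c v hc hv).trans_lt hη1
    refine Or.inl ?_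
    have h2 := (abs_le.1 (Complex.abs_re_le_norm ((v - c) / (w - c₀) - 1))).1
    rw [Complex.sub_re, Complex.one_re] at h2
    linarith
  · intro z hz w hw hzw c u v hc huv hu hv
    have hcorr := pullback_corr hp0.ne' hzw (hJ.ne hr hw) c v
    refine hsep _ _ (huv.symm.trans hcorr) ?_
    have h1 := hcon z hz w hw hzw c c₀ v w hc (by simpa using hτ0.le) hv (by simpa using he0.le)
    rw [pullback_self (hJ.ne hr hw)] at h1
    have hμw := hμ w (hJV hw)
    have h2 : μ z * ‖pullback p q c₀ z w c v - z‖ ≤ e := by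
      refine h1.trans ?_
      have h3 : μ w * (‖v - w‖ + ‖c - c₀‖) ≤ e + b * τ := by
        rw [mul_add]
        have := mul_le_mul (hab w hw).2 hc (norm_nonneg _) hb.le
        linarith
      have := mul_le_mul_of_nonneg_left h3 hθ0.le
      nlinarith
    have h4 := hea z hz _ h2
    have h5 := hea z hz _ hu
    have h6 : e / a ≤ σ * r / 8 := by rw [div_le_iff₀ ha]; linarith
    have h7 : ‖u - pullback p q c₀ z w c v‖ ≤ ‖u - z‖ + ‖pullback p q c₀ z w c v - z‖ := by
      rw [show u - pullback p q c₀ z w c v = (u - z) - (pullback p q c₀ z w c v - z) by ring]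
      exact norm_sub_le _ _
    have h8 : ‖z‖ ≤ ‖u‖ + ‖u - z‖ := by
      calc ‖z‖ = ‖u - (u - z)‖ := by congr 1; ring
        _ ≤ _ := norm_sub_le _ _
    have h9 := hzr z hz
    have h10 : r / 2 ≤ ‖u‖ := by nlinarith
    have h11 := mul_le_mul_of_nonneg_left h10 hσ.le
    have h12 := mul_pos hσ hr
    linarith

/-! ### Existence, uniqueness and parameter dependence of shadowing orbits -/

namespace Shadowing

variable {J : Set ℂ} {μ : ℂ → ℝ} {θ a b e τ : ℝ}

theorem μ_pos (S : Shadowing p q c₀ J μ θ a b e τ) {z : ℂ} (hz : z ∈ J) : 0 < μ z :=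
  S.a_pos.trans_le (S.le_μ z hz)

/-- Comparison of two approximate orbits. -/
theorem le_of_contract {θ β M : ℝ} (hθ : 0 < θ) (hθ1 : θ < 1) {d : ℕ → ℝ} (hM : ∀ n, d n ≤ M)
    (h : ∀ n, d n ≤ θ * d (n + 1) + β) (n : ℕ) : d n ≤ β / (1 - θ) := by
  have h1 : 0 < 1 - θ := by linarith
  have hfix : θ * (β / (1 - θ)) + β = β / (1 - θ) := by field_simp; ring
  have key : ∀ k n, d n - β / (1 - θ) ≤ θ ^ k * (M - β / (1 - θ)) := by
    intro k
    induction k with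
    | zero => intro n; simpa using hM n
    | succ k ih =>
      intro n
      have h2 := mul_le_mul_of_nonneg_left (ih (n + 1)) hθ.le
      have h3 := h n
      rw [pow_succ', mul_assoc]
      linarith
  have hlim := (tendsto_pow_atTop_nhds_zero_of_lt_one hθ.le hθ1).mul_const (M - β / (1 - θ))
  rw [zero_mul] at hlim
  have := ge_of_tendsto' hlim fun k => key k n
  linarith

/-- The successive approximations to the shadowing orbit. -/
def approx (p q : ℕ) (c₀ : ℂ) (z : ℕ → ℂ) (c : ℂ) : ℕ → ℕ → ℂ
  | 0 => z
  | k + 1 => fun n => pullback p q c₀ (z n) (z (n + 1)) c (approx p q c₀ z c k (n + 1))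

/-- The orbit of `𝐟_c` which shadows the orbit `z` of `𝐟_{c₀}`. -/
def _root_.BranchedJulia.shadow (p q : ℕ) (c₀ : ℂ) (z : ℕ → ℂ) (c : ℂ) : ℕ → ℂ :=
  fun n => limUnder atTop fun k => approx p q c₀ z c k n

variable {z : ℕ → ℂ} {c c' : ℂ}

theorem pullback_mem (S : Shadowing p q c₀ J μ θ a b e τ) {z w v : ℂ} (hz : z ∈ J) (hw : w ∈ J)
    (hzw : Corr p q c₀ z w) (hc : ‖c - c₀‖ ≤ τ) (hv : μ w * ‖v - w‖ ≤ e) :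
    μ z * ‖pullback p q c₀ z w c v - z‖ ≤ e := by
  have h1 := S.contract z hz w hw hzw c c₀ v w hc (by simpa using S.τ_pos.le) hv
    (by simpa using S.e_pos.le)
  rw [pullback_self (S.ne w hw)] at h1
  refine h1.trans ?_
  have h3 : μ w * (‖v - w‖ + ‖c - c₀‖) ≤ e + b * τ := by
    rw [mul_add]
    have := mul_le_mul (S.μ_le w hw) hc (norm_nonneg _) S.b_pos.le
    linarith
  have h4 := mul_le_mul_of_nonneg_left h3 S.θ_pos.le
  have h5 := S.small
  linarith

theorem approx_mem (S : Shadowing p q c₀ J μ θ a b e τ) (hz : IsOrbitIn p q c₀ J z)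
    (hc : ‖c - c₀‖ ≤ τ) (k n : ℕ) : μ (z n) * ‖approx p q c₀ z c k n - z n‖ ≤ e := by
  induction k generalizing n with
  | zero => simpa [approx] using S.e_pos.le
  | succ k ih => exact S.pullback_mem (hz n).1 (hz (n + 1)).1 (hz n).2 hc (ih (n + 1))

theorem dist_approx (S : Shadowing p q c₀ J μ θ a b e τ) (hz : IsOrbitIn p q c₀ J z)
    (hc : ‖c - c₀‖ ≤ τ) (k n : ℕ) :
    μ (z n) * ‖approx p q c₀ z c k n - approx p q c₀ z c (k + 1) n‖ ≤ e * θ ^ k := by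
  induction k generalizing n with
  | zero =>
    have := S.approx_mem hz hc 1 n
    rw [pow_zero, mul_one, norm_sub_rev]
    exact this
  | succ k ih =>
    have := S.contract _ (hz n).1 _ (hz (n + 1)).1 (hz n).2 c c _ _ hc hc
      (S.approx_mem hz hc k (n + 1)) (S.approx_mem hz hc (k + 1) (n + 1))
    rw [sub_self, norm_zero, add_zero] at this
    refine this.trans ?_
    rw [pow_succ]
    have := mul_le_mul_of_nonneg_left (ih (n + 1)) S.θ_pos.le
    linarith

theorem dist_approx' (S : Shadowing p q c₀ J μ θ a b e τ) (hz : IsOrbitIn p q c₀ J z)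
    (hc : ‖c - c₀‖ ≤ τ) (n k : ℕ) :
    dist (approx p q c₀ z c k n) (approx p q c₀ z c (k + 1) n) ≤ e / a * θ ^ k := by
  rw [dist_eq_norm, div_mul_eq_mul_div, le_div_iff₀ S.a_pos]
  have h1 := S.dist_approx hz hc k n
  have h2 := mul_le_mul_of_nonneg_right (S.le_μ _ (hz n).1)
    (norm_nonneg (approx p q c₀ z c k n - approx p q c₀ z c (k + 1) n))
  linarith

theorem tendsto_approx (S : Shadowing p q c₀ J μ θ a b e τ) (hz : IsOrbitIn p q c₀ J z)
    (hc : ‖c - c₀‖ ≤ τ) (n : ℕ) :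
    Tendsto (fun k => approx p q c₀ z c k n) atTop (𝓝 (shadow p q c₀ z c n)) :=
  (cauchySeq_of_le_geometric θ (e / a) S.θ_lt (S.dist_approx' hz hc n)).tendsto_limUnder

theorem dist_approx_shadow (S : Shadowing p q c₀ J μ θ a b e τ) (hz : IsOrbitIn p q c₀ J z)
    (hc : ‖c - c₀‖ ≤ τ) (k n : ℕ) :
    dist (approx p q c₀ z c k n) (shadow p q c₀ z c n) ≤ e / a * θ ^ k / (1 - θ) :=
  dist_le_of_le_geometric_of_tendsto θ (e / a) S.θ_lt (S.dist_approx' hz hc n)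
    (S.tendsto_approx hz hc n) k

theorem shadow_mem (S : Shadowing p q c₀ J μ θ a b e τ) (hz : IsOrbitIn p q c₀ J z)
    (hc : ‖c - c₀‖ ≤ τ) (n : ℕ) : μ (z n) * ‖shadow p q c₀ z c n - z n‖ ≤ e :=
  le_of_tendsto' (((S.tendsto_approx hz hc n).sub_const _).norm.const_mul _)
    fun k => S.approx_mem hz hc k n

theorem shadow_eq_pullback (S : Shadowing p q c₀ J μ θ a b e τ) (hz : IsOrbitIn p q c₀ J z)
    (hc : ‖c - c₀‖ ≤ τ) (n : ℕ) : shadow p q c₀ z c n =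
      pullback p q c₀ (z n) (z (n + 1)) c (shadow p q c₀ z c (n + 1)) := by
  refine tendsto_nhds_unique ((tendsto_add_atTop_iff_nat 1).2 (S.tendsto_approx hz hc n)) ?_
  have hsl := S.mem_slitPlane _ (hz (n + 1)).1 c _ hc (S.shadow_mem hz hc (n + 1))
  exact ((((S.tendsto_approx hz hc (n + 1)).sub_const c).div_const (z (n + 1) - c₀)).cpow
    tendsto_const_nhds hsl).const_mul (z n)

theorem shadow_corr (S : Shadowing p q c₀ J μ θ a b e τ) (hz : IsOrbitIn p q c₀ J z)
    (hc : ‖c - c₀‖ ≤ τ) (n : ℕ) :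
    Corr p q c (shadow p q c₀ z c n) (shadow p q c₀ z c (n + 1)) := by
  rw [S.shadow_eq_pullback hz hc n]
  exact pullback_corr S.p_ne (hz n).2 (S.ne _ (hz (n + 1)).1) _ _

/-- The weighted distances satisfy `d n ≤ θ * d (n + 1) + θ * b * ‖c - c'‖` and are bounded, so
iterating towards the future leaves only a geometric series. Uniqueness of shadows and their
Lipschitz dependence on `c` are both special cases. -/
theorem dist_of_orbits (S : Shadowing p q c₀ J μ θ a b e τ) (hz : IsOrbitIn p q c₀ J z)
    (hc : ‖c - c₀‖ ≤ τ) (hc' : ‖c' - c₀‖ ≤ τ) {y y' : ℕ → ℂ}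
    (hy : ∀ n, Corr p q c (y n) (y (n + 1))) (hy' : ∀ n, Corr p q c' (y' n) (y' (n + 1)))
    (hyz : ∀ n, μ (z n) * ‖y n - z n‖ ≤ e) (hyz' : ∀ n, μ (z n) * ‖y' n - z n‖ ≤ e) (n : ℕ) :
    μ (z n) * ‖y n - y' n‖ ≤ θ * (b * ‖c - c'‖) / (1 - θ) := by
  refine le_of_contract S.θ_pos S.θ_lt (M := 2 * e)
    (d := fun n => μ (z n) * ‖y n - y' n‖) (fun n => ?_) (fun n => ?_) n
  · have h1 : ‖y n - y' n‖ ≤ ‖y n - z n‖ + ‖y' n - z n‖ := by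
      rw [show y n - y' n = (y n - z n) - (y' n - z n) by ring]
      exact norm_sub_le _ _
    have h2 := mul_le_mul_of_nonneg_left h1 (S.μ_pos (hz n).1).le
    linarith [hyz n, hyz' n]
  · have e1 := S.unique _ (hz n).1 _ (hz (n + 1)).1 (hz n).2 c _ _ hc (hy n) (hyz n) (hyz (n + 1))
    have e2 := S.unique _ (hz n).1 _ (hz (n + 1)).1 (hz n).2 c' _ _ hc' (hy' n) (hyz' n)
      (hyz' (n + 1))
    have h3 := S.contract _ (hz n).1 _ (hz (n + 1)).1 (hz n).2 c c' _ _ hc hc' (hyz (n + 1))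
      (hyz' (n + 1))
    rw [← e1, ← e2] at h3
    refine h3.trans ?_
    rw [mul_add, mul_add]
    have := S.μ_le _ (hz (n + 1)).1
    have := S.θ_pos
    gcongr

theorem eq_shadow (S : Shadowing p q c₀ J μ θ a b e τ) (hz : IsOrbitIn p q c₀ J z)
    (hc : ‖c - c₀‖ ≤ τ) {y : ℕ → ℂ} (hy : ∀ n, Corr p q c (y n) (y (n + 1)))
    (hyz : ∀ n, μ (z n) * ‖y n - z n‖ ≤ e) : y = shadow p q c₀ z c := by
  funext n
  have := S.dist_of_orbits hz hc hc hy (S.shadow_corr hz hc) hyz (S.shadow_mem hz hc) n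
  rw [sub_self, norm_zero, mul_zero, mul_zero, zero_div] at this
  have h1 := S.μ_pos (hz n).1
  have h2 : ‖y n - shadow p q c₀ z c n‖ ≤ 0 := by
    by_contra! h
    nlinarith
  exact sub_eq_zero.1 (norm_le_zero_iff.1 h2)

theorem shadow_self (S : Shadowing p q c₀ J μ θ a b e τ) (hz : IsOrbitIn p q c₀ J z) :
    shadow p q c₀ z c₀ = z :=
  (S.eq_shadow hz (by simpa using S.τ_pos.le) (fun n => (hz n).2)
    (fun n => by simpa using S.e_pos.le)).symm

theorem shadow_shift (S : Shadowing p q c₀ J μ θ a b e τ) (hz : IsOrbitIn p q c₀ J z)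
    (hc : ‖c - c₀‖ ≤ τ) : shadow p q c₀ (shift z) c = shift (shadow p q c₀ z c) :=
  (S.eq_shadow hz.shift hc (fun n => S.shadow_corr hz hc (n + 1))
    (fun n => S.shadow_mem hz hc (n + 1))).symm

theorem shadow_iterate_shift (S : Shadowing p q c₀ J μ θ a b e τ) (hz : IsOrbitIn p q c₀ J z)
    (hc : ‖c - c₀‖ ≤ τ) (k : ℕ) :
    shadow p q c₀ (shift^[k] z) c = shift^[k] (shadow p q c₀ z c) := by
  induction k with
  | zero => rfl
  | succ k ih =>
    rw [Function.iterate_succ_apply', S.shadow_shift (hz.iterate_shift k) hc, ih,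
      Function.iterate_succ_apply']

/-- The Lipschitz constant of the motion. -/
theorem norm_shadow_sub_le (S : Shadowing p q c₀ J μ θ a b e τ) (hz : IsOrbitIn p q c₀ J z)
    (hc : ‖c - c₀‖ ≤ τ) (hc' : ‖c' - c₀‖ ≤ τ) (n : ℕ) :
    ‖shadow p q c₀ z c n - shadow p q c₀ z c' n‖ ≤ θ * b / (1 - θ) / a * ‖c - c'‖ := by
  have h1 := S.dist_of_orbits hz hc hc' (S.shadow_corr hz hc) (S.shadow_corr hz hc')
    (S.shadow_mem hz hc) (S.shadow_mem hz hc') n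
  have h2 := mul_le_mul_of_nonneg_right (S.le_μ _ (hz n).1)
    (norm_nonneg (shadow p q c₀ z c n - shadow p q c₀ z c' n))
  rw [div_mul_eq_mul_div, le_div_iff₀ S.a_pos]
  calc _ = a * ‖shadow p q c₀ z c n - shadow p q c₀ z c' n‖ := mul_comm _ _
    _ ≤ _ := h2.trans h1
    _ = _ := by ring

theorem norm_shadow_sub_self_le (S : Shadowing p q c₀ J μ θ a b e τ) (hz : IsOrbitIn p q c₀ J z)
    (hc : ‖c - c₀‖ ≤ τ) (n : ℕ) :
    ‖shadow p q c₀ z c n - z n‖ ≤ θ * b / (1 - θ) / a * ‖c - c₀‖ := by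
  have := S.norm_shadow_sub_le hz hc (c' := c₀) (by simpa using S.τ_pos.le) n
  rwa [S.shadow_self hz] at this

/-- If the shadows coincide, `small'` places `z'` within `e` of `z`. Both are orbits of `𝐟_{c₀}`, so
`z'` is the shadow of `z` at the parameter `c₀`, that is, `z` itself. -/
theorem shadow_injective (S : Shadowing p q c₀ J μ θ a b e τ) (hz : IsOrbitIn p q c₀ J z)
    {z' : ℕ → ℂ} (hz' : IsOrbitIn p q c₀ J z') (hc : ‖c - c₀‖ ≤ τ)
    (h : shadow p q c₀ z c = shadow p q c₀ z' c) : z = z' := by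
  rw [← S.shadow_self hz]
  refine (S.eq_shadow hz (by simpa using S.τ_pos.le) (fun n => (hz' n).2) fun n => ?_).symm
  have h1 := S.norm_shadow_sub_self_le hz hc n
  have h2 := S.norm_shadow_sub_self_le hz' hc n
  rw [← h] at h2
  have h3 : ‖z' n - z n‖ ≤ ‖shadow p q c₀ z c n - z n‖ + ‖shadow p q c₀ z c n - z' n‖ := by
    rw [show z' n - z n = (shadow p q c₀ z c n - z n) - (shadow p q c₀ z c n - z' n) by ring]
    exact norm_sub_le _ _
  have hθ : 0 < 1 - θ := by linarith [S.θ_lt]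
  have hK : 0 ≤ θ * b / (1 - θ) / a := by
    have := S.θ_pos; have := S.b_pos; have := S.a_pos; positivity
  have h4 := mul_le_mul_of_nonneg_left hc hK
  have h5 : ‖z' n - z n‖ ≤ 2 * (θ * b / (1 - θ) / a * τ) := by linarith
  have h6 := mul_le_mul (S.μ_le _ (hz n).1) h5 (norm_nonneg _) S.b_pos.le
  refine h6.trans ?_
  have h7 := S.small'
  rw [← div_le_iff₀ S.a_pos] at h7
  calc _ = 2 * (θ * (b * τ) / (1 - θ)) * b / a := by ring
    _ ≤ e := h7

theorem differentiableOn_approx (S : Shadowing p q c₀ J μ θ a b e τ) (hz : IsOrbitIn p q c₀ J z)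
    (k n : ℕ) : DifferentiableOn ℂ (fun c => approx p q c₀ z c k n) (ball c₀ τ) := by
  induction k generalizing n with
  | zero => exact differentiableOn_const _
  | succ k ih =>
    refine DifferentiableOn.const_mul (DifferentiableOn.cpow
      (((ih (n + 1)).sub differentiableOn_id).div_const _) (differentiableOn_const _)
      fun c hc => ?_) _
    have hc' : ‖c - c₀‖ ≤ τ := by rw [← dist_eq_norm]; exact (mem_ball.1 hc).le
    exact S.mem_slitPlane _ (hz (n + 1)).1 c _ hc' (S.approx_mem hz hc' k (n + 1))

theorem tendstoUniformlyOn_approx (S : Shadowing p q c₀ J μ θ a b e τ) {ι : Type*}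
    (ζ : ι → ℕ → ℂ) (γ : ι → ℂ) (n : ℕ) (s : Set ι) (hζ : ∀ i ∈ s, IsOrbitIn p q c₀ J (ζ i))
    (hγ : ∀ i ∈ s, ‖γ i - c₀‖ ≤ τ) :
    TendstoUniformlyOn (fun k i => approx p q c₀ (ζ i) (γ i) k n)
      (fun i => shadow p q c₀ (ζ i) (γ i) n) atTop s := by
  rw [Metric.tendstoUniformlyOn_iff]
  intro ε hε
  have h1 : Tendsto (fun k : ℕ => e / a * θ ^ k / (1 - θ)) atTop (𝓝 0) := by
    have := ((tendsto_pow_atTop_nhds_zero_of_lt_one S.θ_pos.le S.θ_lt).const_mul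
      (e / a)).div_const (1 - θ)
    simpa using this
  filter_upwards [h1.eventually (gt_mem_nhds hε)] with k hk i hi
  rw [dist_comm]
  exact (S.dist_approx_shadow (hζ i hi) (hγ i hi) k n).trans_lt hk

theorem differentiableOn_shadow (S : Shadowing p q c₀ J μ θ a b e τ) (hz : IsOrbitIn p q c₀ J z)
    (n : ℕ) : DifferentiableOn ℂ (fun c => shadow p q c₀ z c n) (ball c₀ τ) := by
  have h := S.tendstoUniformlyOn_approx (fun _ : ℂ => z) id n (ball c₀ τ) (fun _ _ => hz)
    fun c hc => by rw [← dist_eq_norm]; exact (mem_ball.1 hc).le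
  exact h.tendstoLocallyUniformlyOn.differentiableOn
    (Eventually.of_forall fun k => S.differentiableOn_approx hz k n) isOpen_ball

theorem continuousOn_shadow (S : Shadowing p q c₀ J μ θ a b e τ) (hc : ‖c - c₀‖ ≤ τ) :
    ContinuousOn (fun z => shadow p q c₀ z c) (orbitSet p q c₀ J) := by
  refine continuousOn_pi.2 fun n => ?_
  have h := S.tendstoUniformlyOn_approx (fun z : ℕ → ℂ => z) (fun _ => c) n (orbitSet p q c₀ J)
    (fun _ hz => hz) fun _ _ => hc
  refine h.continuousOn (Frequently.of_forall fun k => ?_)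
  induction k generalizing n with
  | zero => exact (continuous_apply n).continuousOn
  | succ k ih =>
    have ih' := ih (n + 1) (S.tendstoUniformlyOn_approx (fun z : ℕ → ℂ => z) (fun _ => c) (n + 1)
      (orbitSet p q c₀ J) (fun _ hz => hz) fun _ _ => hc)
    refine ContinuousOn.mul (continuous_apply n).continuousOn (ContinuousOn.cpow
      (ContinuousOn.div (ih'.sub continuousOn_const)
        ((continuous_apply (n + 1)).continuousOn.sub continuousOn_const) fun z hz => ?_)
      continuousOn_const fun z hz => ?_)
    · exact sub_ne_zero.2 (S.ne _ (hz (n + 1)).1)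
    · exact S.mem_slitPlane _ (hz (n + 1)).1 c _ hc (S.approx_mem hz hc k (n + 1))

/-- The neighbourhood of the hyperbolic set in which all orbits are shadowed. -/
def _root_.BranchedJulia.shadowNhd (J : Set ℂ) (μ : ℂ → ℝ) (e : ℝ) : Set ℂ :=
  {v | ∃ w ∈ J, μ w * ‖v - w‖ < e}

theorem _root_.BranchedJulia.isOpen_shadowNhd (J : Set ℂ) (μ : ℂ → ℝ) (e : ℝ) :
    IsOpen (shadowNhd J μ e) := by
  have : shadowNhd J μ e = ⋃ w ∈ J, {v | μ w * ‖v - w‖ < e} := by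
    ext v; simp [shadowNhd]
  rw [this]
  exact isOpen_biUnion fun w _ => isOpen_lt (by fun_prop) continuous_const

theorem subset_shadowNhd (S : Shadowing p q c₀ J μ θ a b e τ) : J ⊆ shadowNhd J μ e :=
  fun w hw => ⟨w, hw, by simpa using S.e_pos⟩

/-- Pulling back inside the neighbourhood of a backward invariant hyperbolic set. -/
theorem exists_preimage_near (S : Shadowing p q c₀ J μ θ a b e τ)
    (hJ : ∀ z w, w ∈ J → Corr p q c₀ z w → z ∈ J) (hc : ‖c - c₀‖ ≤ τ) {u v w : ℂ}
    (hw : w ∈ J) (hv : μ w * ‖v - w‖ < e) (h : Corr p q c u v) :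
    ∃ z ∈ J, Corr p q c₀ z w ∧ μ z * ‖u - z‖ < e := by
  have hsl := S.mem_slitPlane w hw c v hc hv.le
  have ht0 := Complex.slitPlane_ne_zero hsl
  have hw0 : w - c₀ ≠ 0 := sub_ne_zero.2 (S.ne w hw)
  have hp' : (p : ℂ) ≠ 0 := by exact_mod_cast S.p_ne
  set t := (v - c) / (w - c₀) with ht
  have hρ0 : t ^ (q / p : ℂ) ≠ 0 := by rw [Complex.cpow_ne_zero_iff]; exact Or.inl ht0
  -- Dividing by `t ^ (q / p)` undoes the pullback, so this is the preimage of `w` whose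
  -- continuation is exactly `u`; backward invariance puts it in `J`.
  have hzw : Corr p q c₀ (u / t ^ (q / p : ℂ)) w := by
    unfold Corr at h ⊢
    rw [div_pow, ← Complex.cpow_mul_nat, div_mul_cancel₀ _ hp', Complex.cpow_natCast, ← h, ht,
      div_pow]
    have : v - c ≠ 0 := fun h0 => ht0 (by rw [ht, h0, zero_div])
    field_simp
  have hz := hJ _ _ hw hzw
  refine ⟨_, hz, hzw, ?_⟩
  have hu : pullback p q c₀ (u / t ^ (q / p : ℂ)) w c v = u := by
    rw [pullback, div_mul_cancel₀ _ hρ0]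
  have h1 := S.contract _ hz w hw hzw c c₀ v w hc (by simpa using S.τ_pos.le) hv.le
    (by simpa using S.e_pos.le)
  rw [pullback_self (S.ne w hw), hu] at h1
  refine h1.trans_lt ?_
  have h3 : μ w * (‖v - w‖ + ‖c - c₀‖) < e + b * τ := by
    rw [mul_add]
    have := mul_le_mul (S.μ_le w hw) hc (norm_nonneg _) S.b_pos.le
    linarith
  have h4 := mul_lt_mul_of_pos_left h3 S.θ_pos
  have h5 := S.small
  linarith

theorem shadowNhd_backward (S : Shadowing p q c₀ J μ θ a b e τ)
    (hJ : ∀ z w, w ∈ J → Corr p q c₀ z w → z ∈ J) (hc : ‖c - c₀‖ ≤ τ) {u v : ℂ}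
    (hv : v ∈ shadowNhd J μ e) (h : Corr p q c u v) : u ∈ shadowNhd J μ e := by
  obtain ⟨w, hw, hvw⟩ := hv
  obtain ⟨z, hz, -, hzu⟩ := S.exists_preimage_near hJ hc hw hvw h
  exact ⟨z, hz, hzu⟩

/-- Every orbit in the neighbourhood is a shadow. -/
theorem exists_eq_shadow (S : Shadowing p q c₀ J μ θ a b e τ)
    (hJ : ∀ z w, w ∈ J → Corr p q c₀ z w → z ∈ J) (hc : ‖c - c₀‖ ≤ τ) {y : ℕ → ℂ}
    (hy : ∀ n, Corr p q c (y n) (y (n + 1))) (hyΩ : ∀ n, y n ∈ shadowNhd J μ e) :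
    ∃ z, IsOrbitIn p q c₀ J z ∧ y = shadow p q c₀ z c := by
  -- `K N` consists of the sequences in `J` that are orbits up to time `N` and stay close to `y`
  -- until then. Pulling back a point of `J` near `y N` shows that it is nonempty, and a point of
  -- the nested intersection is an orbit followed by `y` forever.
  let K : ℕ → Set (ℕ → ℂ) := fun N => {z | (∀ n, z n ∈ J) ∧
    (∀ n < N, Corr p q c₀ (z n) (z (n + 1))) ∧ ∀ n ≤ N, μ (z n) * ‖y n - z n‖ ≤ e}
  have hpi : IsCompact {z : ℕ → ℂ | ∀ n, z n ∈ J} := by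
    have := isCompact_univ_pi fun _ : ℕ => S.isCompact
    convert this using 1
    ext z; simp [Set.mem_pi]
  have hKc : ∀ N, IsCompact (K N) := by
    intro N
    refine hpi.of_isClosed_subset ?_ fun z hz => hz.1
    have e1 : K N = {z : ℕ → ℂ | ∀ n, z n ∈ J} ∩
        ((⋂ n, ⋂ (_ : n < N), {z | Corr p q c₀ (z n) (z (n + 1))}) ∩
        (⋂ n, ⋂ (_ : n ≤ N), {z : ℕ → ℂ | ∀ n, z n ∈ J} ∩
          (fun z => μ (z n) * ‖y n - z n‖) ⁻¹' Iic e)) := by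
      ext z
      simp only [K, mem_ofPred_eq, mem_inter_iff, mem_iInter, mem_preimage, mem_Iic]
      grind
    rw [e1]
    refine hpi.isClosed.inter (IsClosed.inter ?_ ?_)
    · exact isClosed_iInter fun n => isClosed_iInter fun _ =>
        isClosed_corr (continuous_apply n) (continuous_apply (n + 1))
    · refine isClosed_iInter fun n => isClosed_iInter fun _ => ?_
      refine ContinuousOn.preimage_isClosed_of_isClosed ?_ hpi.isClosed isClosed_Iic
      refine ContinuousOn.mul (S.continuousOn.comp (continuous_apply n).continuousOn
        fun z hz => hz n) ?_
      exact (continuous_const.sub (continuous_apply n)).norm.continuousOn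
  have hKn : ∀ N, (K N).Nonempty := by
    intro N
    obtain ⟨w, hw, hyw⟩ := hyΩ N
    have key : ∀ k ≤ N, ∃ z : ℕ → ℂ, (∀ n, z n ∈ J) ∧
        (∀ n, N - k ≤ n → n < N → Corr p q c₀ (z n) (z (n + 1))) ∧
        ∀ n, N - k ≤ n → n ≤ N → μ (z n) * ‖y n - z n‖ < e := by
      intro k
      induction k with
      | zero =>
        intro _
        refine ⟨fun _ => w, fun _ => hw, fun n h1 h2 => by omega, fun n h1 h2 => ?_⟩
        obtain rfl : n = N := by omega
        exact hyw
      | succ k ih =>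
        intro hk
        obtain ⟨z, hz, hzc, hzy⟩ := ih (by omega)
        have hidx : N - (k + 1) + 1 = N - k := by omega
        have hstep := hy (N - (k + 1))
        rw [hidx] at hstep
        obtain ⟨x, hx, hxc, hxy⟩ := S.exists_preimage_near hJ hc (hz (N - k))
          (hzy (N - k) le_rfl (by omega)) hstep
        refine ⟨Function.update z (N - (k + 1)) x, fun n => ?_, fun n h1 h2 => ?_,
          fun n h1 h2 => ?_⟩
        · by_cases hn : n = N - (k + 1)
          · subst hn; simpa using hx
          · simpa [hn] using hz n
        · by_cases hn : n = N - (k + 1)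
          · subst hn
            rw [Function.update_self, hidx, Function.update_of_ne (by omega)]
            exact hxc
          · rw [Function.update_of_ne hn, Function.update_of_ne (by omega)]
            exact hzc n (by omega) h2
        · by_cases hn : n = N - (k + 1)
          · subst hn; simpa using hxy
          · rw [Function.update_of_ne hn]
            exact hzy n (by omega) h2
    obtain ⟨z, hz, hzc, hzy⟩ := key N le_rfl
    exact ⟨z, hz, fun n hn => hzc n (by omega) hn, fun n hn => (hzy n (by omega) hn).le⟩
  obtain ⟨z, hz⟩ := IsCompact.nonempty_iInter_of_sequence_nonempty_isCompact_isClosed K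
    (fun N z hz => ⟨hz.1, fun n hn => hz.2.1 n (by omega), fun n hn => hz.2.2 n (by omega)⟩)
    hKn (hKc 0) fun N => (hKc N).isClosed
  rw [mem_iInter] at hz
  have hzo : IsOrbitIn p q c₀ J z := fun n => ⟨(hz 0).1 n, (hz (n + 1)).2.1 n (by omega)⟩
  exact ⟨z, hzo, S.eq_shadow hzo hc hy fun n => (hz n).2.2 n le_rfl⟩

end Shadowing

end

/-! ### The moved hyperbolic sets -/

/-- The set of all points of the shadows of the orbits in `J`. -/
def shadowSet (p q : ℕ) (c₀ : ℂ) (J : Set ℂ) (c : ℂ) : Set ℂ :=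
  (fun z => shadow p q c₀ z c 0) '' orbitSet p q c₀ J

/-- A connected compact exhaustion argument: a compact subset of a region is contained in a
relatively compact subregion. -/
theorem exists_subregion {J V : Set ℂ} (hJ : IsCompact J) (hV : IsOpen V) (hVc : IsPreconnected V)
    (hJV : J ⊆ V) :
    ∃ W K : Set ℂ, IsOpen W ∧ IsPreconnected W ∧ J ⊆ W ∧ IsCompact K ∧ W ⊆ K ∧ K ⊆ V := by
  rcases J.eq_empty_or_nonempty with rfl | ⟨z₀, hz₀⟩
  · exact ⟨∅, ∅, isOpen_empty, isPreconnected_empty, empty_subset _, isCompact_empty,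
      empty_subset _, empty_subset _⟩
  have hpc : IsPathConnected V := (hV.isConnected_iff_isPathConnected).1 ⟨⟨z₀, hJV hz₀⟩, hVc⟩
  have hloc : ∀ x ∈ J, ∃ W K : Set ℂ, IsOpen W ∧ IsPreconnected W ∧ z₀ ∈ W ∧ x ∈ W ∧
      IsCompact K ∧ W ⊆ K ∧ K ⊆ V := by
    intro x hx
    obtain ⟨γ, hγ⟩ := hpc.joinedIn z₀ (hJV hz₀) x (hJV hx)
    have hγc : IsCompact (range γ) := isCompact_range γ.continuous
    obtain ⟨O, hO, hγO, hOV, hOc⟩ := exists_open_between_and_isCompact_closure hγc hV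
      (range_subset_iff.2 hγ)
    have h0 : z₀ ∈ range γ := ⟨0, γ.source⟩
    have hsub : range γ ⊆ connectedComponentIn O z₀ :=
      (isPreconnected_range γ.continuous).subset_connectedComponentIn h0 hγO
    exact ⟨connectedComponentIn O z₀, closure O, hO.connectedComponentIn,
      isPreconnected_connectedComponentIn, hsub h0, hsub ⟨1, γ.target⟩, hOc,
      (connectedComponentIn_subset _ _).trans subset_closure, hOV⟩
  obtain ⟨W, K, hW, hWc, -, hJW, hK⟩ := hJ.induction_on (p := fun s => ∃ W K : Set ℂ, IsOpen W ∧
      IsPreconnected W ∧ z₀ ∈ W ∧ s ⊆ W ∧ IsCompact K ∧ W ⊆ K ∧ K ⊆ V)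
    (by
      obtain ⟨W, K, h1, h2, h3, -, h4⟩ := hloc z₀ hz₀
      exact ⟨W, K, h1, h2, h3, empty_subset _, h4⟩)
    (fun s t hst ⟨W, K, h1, h2, h3, h4, h5⟩ => ⟨W, K, h1, h2, h3, hst.trans h4, h5⟩)
    (fun s t ⟨W, K, h1, h2, h3, h4, h5, h6, h7⟩ ⟨W', K', h1', h2', h3', h4', h5', h6', h7'⟩ =>
      ⟨W ∪ W', K ∪ K', h1.union h1', h2.union z₀ h3 h3' h2', Or.inl h3, union_subset_union h4 h4',
        h5.union h5', union_subset_union h6 h6', union_subset h7 h7'⟩)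
    (fun x hx => by
      obtain ⟨W, K, h1, h2, h3, h4, h5⟩ := hloc x hx
      exact ⟨W, mem_nhdsWithin_of_mem_nhds (h1.mem_nhds h4), W, K, h1, h2, h3, subset_rfl, h5⟩)
  exact ⟨W, K, hW, hWc, hJW, hK⟩

/-- Stability of the hyperbolic metric on a smaller region. -/
theorem exists_stable_metric {p q : ℕ} {c₀ : ℂ} {J V : Set ℂ} {μ : ℂ → ℝ} {κ : ℝ}
    (hJ : IsCompact J) (hV : IsOpen V) (hVc : IsPreconnected V) (hJV : J ⊆ V)
    (hμc : ContinuousOn μ V) (hμ : ∀ z ∈ V, 0 < μ z) (hκ : 1 < κ)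
    (h : ∀ z ∈ V, ∀ φ : ℂ → ℂ, IsBranchAt p q c₀ φ z → φ z ∈ V →
      κ ≤ μ (φ z) * ‖deriv φ z‖ / μ z) :
    ∃ W : Set ℂ, IsOpen W ∧ IsPreconnected W ∧ J ⊆ W ∧ W ⊆ V ∧ ∃ κ' : ℝ, 1 < κ' ∧
      ∀ᶠ c in 𝓝 c₀, ∀ z ∈ W, ∀ φ : ℂ → ℂ, IsBranchAt p q c φ z → φ z ∈ W →
        κ' ≤ μ (φ z) * ‖deriv φ z‖ / μ z := by
  obtain ⟨W, K, hW, hWc, hJW, hK, hWK, hKV⟩ := exists_subregion hJ hV hVc hJV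
  obtain ⟨ρ, hρ, hρV⟩ := hK.exists_cthickening_subset_open hV hKV
  have hK1 : IsCompact (cthickening ρ K) := hK.cthickening
  obtain ⟨a, b, ha, hb, hab⟩ := exists_bounds_on_compact hK1 (hμc.mono hρV)
    fun z hz => hμ z (hρV hz)
  have hu := hK1.uniformContinuousOn_of_continuous (hμc.mono hρV)
  set κ' : ℝ := (1 + κ) / 2 with hκ'
  have hκ0 : 0 < κ := by linarith
  have hlt : 0 < 1 - κ' / κ := by
    rw [sub_pos, div_lt_one hκ0]; linarith
  obtain ⟨σ, hσ, hσu⟩ := Metric.uniformContinuousOn_iff.1 hu (a * (1 - κ' / κ)) (mul_pos ha hlt)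
  refine ⟨W, hW, hWc, hJW, hWK.trans hKV, κ', by linarith, ?_⟩
  filter_upwards [ball_mem_nhds c₀ (lt_min hρ hσ)] with c hc z hz φ hφ hφz
  rw [mem_ball, dist_eq_norm, lt_min_iff] at hc
  -- Branches of `𝐟_c` and `𝐟_{c₀}` differ by a translation. The derivative is unchanged, and only
  -- the value of `μ` at the image has to be compared.
  have hbr : IsBranchAt p q c₀ (fun x => φ x - (c - c₀)) z := by
    refine ⟨hφ.1.sub analyticAt_const, hφ.2.mono fun x hx => ?_⟩
    unfold Corr at hx ⊢
    rw [← hx]; ring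
  have hK0 : φ z ∈ cthickening ρ K := self_subset_cthickening _ (hWK hφz)
  have hK2 : φ z - (c - c₀) ∈ cthickening ρ K :=
    closedBall_subset_cthickening (hWK hφz) ρ (by
      rw [mem_closedBall, dist_eq_norm, sub_sub_cancel_left, norm_neg]; exact hc.1.le)
  have h1 := h z (hKV (hWK hz)) _ hbr (hρV hK2)
  rw [deriv_sub_const] at h1
  have h2 := hσu _ hK2 _ hK0 (by
    rw [dist_eq_norm, sub_sub_cancel_left, norm_neg]; exact hc.2)
  rw [Real.dist_eq] at h2
  have h3 := (abs_lt.1 h2).2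
  have h4 := (hab _ hK2).1
  have hz0 := hμ z (hKV (hWK hz))
  have h5 : κ' / κ * μ (φ z - (c - c₀)) ≤ μ (φ z) := by nlinarith
  have h6 : 0 < κ' / κ := by positivity
  calc κ' = κ' / κ * κ := by field_simp
    _ ≤ κ' / κ * (μ (φ z - (c - c₀)) * ‖deriv φ z‖ / μ z) := by gcongr
    _ = (κ' / κ * μ (φ z - (c - c₀))) * ‖deriv φ z‖ / μ z := by ring
    _ ≤ _ := by gcongr

/-- A closed relation which fails on a compact set fails near it. -/
theorem exists_thickening_not {J : Set ℂ} (hJ : IsCompact J) {c₀ : ℂ} {P : ℂ × ℂ × ℂ × ℂ → Prop}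
    (hP : IsClosed {x | P x}) (h : ∀ z ∈ J, ∀ w ∈ J, ∀ w' ∈ J, ¬ P (c₀, z, w, w')) :
    ∃ t > 0, ∀ c z w w', ‖c - c₀‖ < t → z ∈ thickening t J → w ∈ thickening t J →
      w' ∈ thickening t J → ¬ P (c, z, w, w') := by
  have hc : IsCompact (({c₀} : Set ℂ) ×ˢ (J ×ˢ (J ×ˢ J))) :=
    isCompact_singleton.prod (hJ.prod (hJ.prod hJ))
  obtain ⟨t, ht, hsub⟩ := hc.exists_thickening_subset_open hP.isOpen_compl (by
    rintro ⟨c, z, w, w'⟩ ⟨rfl, hz, hw, hw'⟩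
    exact h z hz w hw w' hw')
  refine ⟨t, ht, fun c z w w' hct hz hw hw' => ?_⟩
  obtain ⟨z₁, hz₁, hz₂⟩ := mem_thickening_iff.1 hz
  obtain ⟨w₁, hw₁, hw₂⟩ := mem_thickening_iff.1 hw
  obtain ⟨w₁', hw₁', hw₂'⟩ := mem_thickening_iff.1 hw'
  refine hsub (mem_thickening_iff.2 ⟨(c₀, z₁, w₁, w₁'), ⟨rfl, hz₁, hw₁, hw₁'⟩, ?_⟩)
  simp only [Prod.dist_eq, max_lt_iff]
  exact ⟨by rwa [dist_eq_norm], hz₂, hw₂, hw₂'⟩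

theorem isOpen_annulus (r : ℝ) : IsOpen (annulus r) :=
  (isOpen_lt continuous_const continuous_norm).inter (isOpen_lt continuous_norm continuous_const)

section

variable {p q : ℕ} {c₀ : ℂ} {J : Set ℂ} {μ : ℂ → ℝ} {θ a b e τ r δ : ℝ}

theorem IsOrbitIn.cons {Λ : Set ℂ} {c x : ℂ} {z : ℕ → ℂ} (hz : IsOrbitIn p q c Λ z) (hx : x ∈ Λ)
    (h : Corr p q c x (z 0)) : IsOrbitIn p q c Λ (fun n => Nat.casesOn n x z) := by
  rintro (_ | n)
  · exact ⟨hx, h⟩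
  · exact hz n

theorem exists_orbit {Λ : Set ℂ} {c x : ℂ} (hΛ : ∀ z ∈ Λ, ∃ w ∈ Λ, Corr p q c z w) (hx : x ∈ Λ) :
    ∃ z, IsOrbitIn p q c Λ z ∧ z 0 = x := by
  choose! g hg hg' using hΛ
  have hmem : ∀ n, g^[n] x ∈ Λ := by
    intro n
    induction n with
    | zero => exact hx
    | succ n ih => rw [Function.iterate_succ_apply']; exact hg _ ih
  exact ⟨fun n => g^[n] x, fun n => ⟨hmem n, by
    simpa only [Function.iterate_succ_apply'] using hg' _ (hmem n)⟩, rfl⟩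

theorem IsScale.forward_lt {c : ℂ} {Λ : Set ℂ} (hs : IsScale p q c r δ Λ) {z w w' : ℂ} (hz : z ∈ Λ)
    (hw : w ∈ Λ) (hw' : w' ∈ Λ) (h : Corr p q c z w) (h' : Corr p q c z w') (hne : w ≠ w') :
    2 * δ < r * ‖w - w'‖ := by
  have := (disjoint_closedBall_closedBall_iff hs.δ_pos.le hs.δ_pos.le).1
    (hs.forward_disjoint z hz w hw w' hw' h h' hne)
  rw [dist_eq_norm, ← mul_sub, norm_mul, Complex.norm_real, Real.norm_of_nonneg hs.r_pos.le] at this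
  linarith

theorem IsScale.backward_lt {c : ℂ} {Λ : Set ℂ} (hs : IsScale p q c r δ Λ) {z w w' : ℂ} (hz : z ∈ Λ)
    (hw : w ∈ Λ) (hw' : w' ∈ Λ) (h : Corr p q c w z) (h' : Corr p q c w' z) (hne : w ≠ w') :
    2 * δ < r * ‖w - w'‖ := by
  have := (disjoint_closedBall_closedBall_iff hs.δ_pos.le hs.δ_pos.le).1
    (hs.backward_disjoint z hz w hw w' hw' h h' hne)
  rw [dist_eq_norm, ← mul_sub, norm_mul, Complex.norm_real, Real.norm_of_nonneg hs.r_pos.le] at this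
  linarith

/-- In a nonempty backward invariant set the discs of the bundle are small. -/
theorem IsScale.lt_half (hq : 0 < q) (hpq : q < p) (hs : IsScale p q c₀ r δ J)
    (hJ : IsSemiInvariant p q c₀ r J) (hB : ∀ z w, w ∈ J → Corr p q c₀ z w → z ∈ J)
    (hne : J.Nonempty) : δ < 1 / 2 := by
  obtain ⟨z, hz⟩ := hne
  obtain ⟨w, hw, -⟩ := exists_preimages_ne hq hpq (hJ.ne hs.r_pos hz) 0
  obtain ⟨w', hw', hww'⟩ := exists_preimages_ne hq hpq (hJ.ne hs.r_pos hz) ((w - c₀) ^ q)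
  -- Two distinct preimages in `J` satisfy `2 * δ < r * ‖w - w'‖`, whereas `r * ‖w‖` and `r * ‖w'‖`
  -- are below `1 / 2`.
  have h1 := hs.backward_lt hz (hB _ _ hz hw) (hB _ _ hz hw') hw hw' (by rintro rfl; exact hww' rfl)
  have h2 := (hJ.mem_annulus _ (hB _ _ hz hw)).1.2
  have h3 := (hJ.mem_annulus _ (hB _ _ hz hw')).1.2
  have hr := hs.r_pos
  rw [lt_div_iff₀ (by positivity)] at h2 h3
  have h4 := mul_le_mul_of_nonneg_left (norm_sub_le w w') hr.le
  linarith

/-! ### Persistence of invariance, hyperbolicity and scale near the base parameter -/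

namespace Shadowing

theorem mem_shadowSet (S : Shadowing p q c₀ J μ θ a b e τ) {z : ℕ → ℂ} (hz : IsOrbitIn p q c₀ J z)
    {c : ℂ} (hc : ‖c - c₀‖ ≤ τ) (n : ℕ) : shadow p q c₀ z c n ∈ shadowSet p q c₀ J c := by
  refine ⟨shift^[n] z, hz.iterate_shift n, ?_⟩
  simp only [S.shadow_iterate_shift hz hc, iterate_shift, zero_add]

theorem isOrbitIn_shadow (S : Shadowing p q c₀ J μ θ a b e τ) {z : ℕ → ℂ}
    (hz : IsOrbitIn p q c₀ J z) {c : ℂ} (hc : ‖c - c₀‖ ≤ τ) :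
    IsOrbitIn p q c (shadowSet p q c₀ J c) (shadow p q c₀ z c) := fun n =>
  ⟨S.mem_shadowSet hz hc n, S.shadow_corr hz hc n⟩

theorem eventually_le (S : Shadowing p q c₀ J μ θ a b e τ) : ∀ᶠ c in 𝓝 c₀, ‖c - c₀‖ ≤ τ := by
  filter_upwards [closedBall_mem_nhds c₀ S.τ_pos] with c hc
  rwa [← dist_eq_norm]

theorem eventually_subset_thickening (S : Shadowing p q c₀ J μ θ a b e τ) {t : ℝ} (ht : 0 < t) :
    ∀ᶠ c in 𝓝 c₀, shadowSet p q c₀ J c ⊆ thickening t J := by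
  have h1 : Tendsto (fun c => θ * b / (1 - θ) / a * ‖c - c₀‖) (𝓝 c₀) (𝓝 0) := by
    have : Continuous fun c => θ * b / (1 - θ) / a * ‖c - c₀‖ := by fun_prop
    simpa using this.tendsto c₀
  filter_upwards [S.eventually_le, h1.eventually (gt_mem_nhds ht)] with c hc hlt
  rintro _ ⟨z, hz, rfl⟩
  rw [mem_thickening_iff]
  refine ⟨z 0, (hz 0).1, ?_⟩
  rw [dist_eq_norm]
  exact (S.norm_shadow_sub_self_le hz hc 0).trans_lt hlt

theorem eventually_subset (S : Shadowing p q c₀ J μ θ a b e τ) {O : Set ℂ} (hO : IsOpen O)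
    (hJO : J ⊆ O) : ∀ᶠ c in 𝓝 c₀, shadowSet p q c₀ J c ⊆ O := by
  obtain ⟨t, ht, hsub⟩ := S.isCompact.exists_thickening_subset_open hO hJO
  exact (S.eventually_subset_thickening ht).mono fun c hc => hc.trans hsub

theorem eventually_mem_annulus (S : Shadowing p q c₀ J μ θ a b e τ)
    (hJ : IsSemiInvariant p q c₀ r J) :
    ∀ᶠ c in 𝓝 c₀, ∀ y ∈ shadowSet p q c₀ J c, y ∈ annulus r ∧ y - c ∈ annulus r := by
  have h1 := S.eventually_subset (isOpen_annulus r) fun z hz => (hJ.mem_annulus z hz).1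
  have hO : IsOpen {z : ℂ | z - c₀ ∈ annulus r} :=
    (isOpen_annulus r).preimage (continuous_id.sub continuous_const)
  obtain ⟨t, ht, hsub⟩ := S.isCompact.exists_thickening_subset_open hO
    fun z hz => (hJ.mem_annulus z hz).2
  filter_upwards [h1, S.eventually_subset_thickening (half_pos ht), ball_mem_nhds c₀ (half_pos ht)]
    with c hc1 hc2 hc3 y hy
  refine ⟨hc1 hy, ?_⟩
  obtain ⟨z, hz, hyz⟩ := mem_thickening_iff.1 (hc2 hy)
  have : y - c + c₀ ∈ thickening t J := by
    rw [mem_thickening_iff]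
    refine ⟨z, hz, ?_⟩
    rw [mem_ball, dist_eq_norm] at hc3
    rw [dist_eq_norm] at hyz ⊢
    calc ‖y - c + c₀ - z‖ = ‖(y - z) - (c - c₀)‖ := by congr 1; ring
      _ ≤ ‖y - z‖ + ‖c - c₀‖ := norm_sub_le _ _
      _ < t := by linarith
  simpa using hsub this

theorem isCompact_shadowSet (S : Shadowing p q c₀ J μ θ a b e τ) {c : ℂ} (hc : ‖c - c₀‖ ≤ τ) :
    IsCompact (shadowSet p q c₀ J c) :=
  (isCompact_orbitSet S.isCompact).image_of_continuousOn
    ((continuous_apply 0).comp_continuousOn (S.continuousOn_shadow hc))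

theorem eventually_isSemiInvariant (S : Shadowing p q c₀ J μ θ a b e τ)
    (hJ : IsSemiInvariant p q c₀ r J) :
    ∀ᶠ c in 𝓝 c₀, IsSemiInvariant p q c r (shadowSet p q c₀ J c) := by
  filter_upwards [S.eventually_mem_annulus hJ, S.eventually_le] with c hca hc
  refine ⟨S.isCompact_shadowSet hc, hca, ?_, ?_⟩
  · rintro _ ⟨z, hz, rfl⟩
    exact ⟨_, S.mem_shadowSet hz hc 1, S.shadow_corr hz hc 0⟩
  · rintro _ ⟨z, hz, rfl⟩
    obtain ⟨x, hx, hxz⟩ := hJ.exists_preimage _ (hz 0).1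
    have hz' := IsOrbitIn.cons hz hx hxz
    refine ⟨_, S.mem_shadowSet hz' hc 0, ?_⟩
    have h1 := S.shadow_corr hz' hc 0
    have h2 := congrFun (S.shadow_shift hz' hc) 0
    have h3 : shift (fun n => Nat.casesOn n x z : ℕ → ℂ) = z := rfl
    rw [h3] at h2
    simp only [h2]
    exact h1

theorem eventually_isExpandingHyperbolic (S : Shadowing p q c₀ J μ θ a b e τ)
    (hJ : IsExpandingHyperbolic p q c₀ r J) :
    ∀ᶠ c in 𝓝 c₀, IsExpandingHyperbolic p q c r (shadowSet p q c₀ J c) := by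
  obtain ⟨hJs, V, ν, hV, hVc, hJV, hνc, hν, κ, hκ, h⟩ := hJ
  obtain ⟨W, hW, hWc, hJW, hWV, κ', hκ', hev⟩ :=
    exists_stable_metric hJs.isCompact hV hVc hJV hνc hν hκ h
  filter_upwards [hev, S.eventually_isSemiInvariant hJs, S.eventually_subset hW hJW]
    with c hc1 hc2 hc3
  exact ⟨hc2, W, ν, hW, hWc, hc3, hνc.mono hWV, fun z hz => hν z (hWV hz), κ', hκ', hc1⟩

/-- Distinctness is not a closed condition, so it is replaced by `σ * r ≤ ‖w - w'‖`, which root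
separation supplies in the annuli; failure of disjointness is then a closed relation that is
excluded on `J`, hence near it. The discs stay in the unit disc because `δ < 1 / 2` and `‖w‖ < 1 /
(2 * r)`. -/
theorem eventually_isScale (hq : 0 < q) (hpq : q < p) (S : Shadowing p q c₀ J μ θ a b e τ)
    (hJ : IsSemiInvariant p q c₀ r J) (hB : ∀ z w, w ∈ J → Corr p q c₀ z w → z ∈ J)
    (hs : IsScale p q c₀ r δ J) :
    ∀ᶠ c in 𝓝 c₀, IsScale p q c r δ (shadowSet p q c₀ J c) := by
  have hr := hs.r_pos
  have hδ := hs.δ_pos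
  obtain ⟨σ, hσ, -, hsep⟩ := exists_root_separation hq
  obtain ⟨σ', hσ', -, hsep'⟩ := exists_root_separation (n := p) (by omega)
  have hcf : IsClosed {x : ℂ × ℂ × ℂ × ℂ | Corr p q x.1 x.2.1 x.2.2.1 ∧
      Corr p q x.1 x.2.1 x.2.2.2 ∧ σ * r ≤ ‖x.2.2.1 - x.2.2.2‖ ∧
      r * ‖x.2.2.1 - x.2.2.2‖ ≤ 2 * δ} := by
    have h1 : IsClosed {x : ℂ × ℂ × ℂ × ℂ | (x.2.2.1 - x.1) ^ q = x.2.1 ^ p} :=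
      isClosed_eq (by fun_prop) (by fun_prop)
    have h2 : IsClosed {x : ℂ × ℂ × ℂ × ℂ | (x.2.2.2 - x.1) ^ q = x.2.1 ^ p} :=
      isClosed_eq (by fun_prop) (by fun_prop)
    have h3 : IsClosed {x : ℂ × ℂ × ℂ × ℂ | σ * r ≤ ‖x.2.2.1 - x.2.2.2‖} :=
      isClosed_le (by fun_prop) (by fun_prop)
    have h4 : IsClosed {x : ℂ × ℂ × ℂ × ℂ | r * ‖x.2.2.1 - x.2.2.2‖ ≤ 2 * δ} :=
      isClosed_le (by fun_prop) (by fun_prop)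
    exact h1.inter (h2.inter (h3.inter h4))
  have hcb : IsClosed {x : ℂ × ℂ × ℂ × ℂ | Corr p q x.1 x.2.2.1 x.2.1 ∧
      Corr p q x.1 x.2.2.2 x.2.1 ∧ σ' * r ≤ ‖x.2.2.1 - x.2.2.2‖ ∧
      r * ‖x.2.2.1 - x.2.2.2‖ ≤ 2 * δ} := by
    have h1 : IsClosed {x : ℂ × ℂ × ℂ × ℂ | (x.2.1 - x.1) ^ q = x.2.2.1 ^ p} :=
      isClosed_eq (by fun_prop) (by fun_prop)
    have h2 : IsClosed {x : ℂ × ℂ × ℂ × ℂ | (x.2.1 - x.1) ^ q = x.2.2.2 ^ p} :=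
      isClosed_eq (by fun_prop) (by fun_prop)
    have h3 : IsClosed {x : ℂ × ℂ × ℂ × ℂ | σ' * r ≤ ‖x.2.2.1 - x.2.2.2‖} :=
      isClosed_le (by fun_prop) (by fun_prop)
    have h4 : IsClosed {x : ℂ × ℂ × ℂ × ℂ | r * ‖x.2.2.1 - x.2.2.2‖ ≤ 2 * δ} :=
      isClosed_le (by fun_prop) (by fun_prop)
    exact h1.inter (h2.inter (h3.inter h4))
  have hne : ∀ {s : ℝ} {w w' : ℂ}, 0 < s → s * r ≤ ‖w - w'‖ → w ≠ w' := by
    rintro s w w' hs0 hle rfl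
    rw [sub_self, norm_zero] at hle
    nlinarith
  obtain ⟨t, ht, hF⟩ := exists_thickening_not (c₀ := c₀) S.isCompact hcf fun z hz w hw w' hw' hP =>
    absurd (hs.forward_lt hz hw hw' hP.1 hP.2.1 (hne hσ hP.2.2.1)) (not_lt.2 hP.2.2.2)
  obtain ⟨t', ht', hF'⟩ := exists_thickening_not (c₀ := c₀) S.isCompact hcb
    fun z hz w hw w' hw' hP =>
    absurd (hs.backward_lt hz hw hw' hP.1 hP.2.1 (hne hσ' hP.2.2.1)) (not_lt.2 hP.2.2.2)
  have hc4 : ∀ᶠ c in 𝓝 c₀, 4 * ‖c‖ * r < 1 :=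
    (by fun_prop : Continuous fun c : ℂ => 4 * ‖c‖ * r).continuousAt.eventually
      (gt_mem_nhds hs.r_mul_lt)
  filter_upwards [hc4, S.eventually_mem_annulus hJ, S.eventually_subset_thickening ht,
    S.eventually_subset_thickening ht', ball_mem_nhds c₀ ht, ball_mem_nhds c₀ ht']
    with c h4 hann hth hth' hct hct'
  rw [mem_ball, dist_eq_norm] at hct hct'
  have hsub : ∀ w ∈ shadowSet p q c₀ J c,
      closedBall ((r : ℂ) * w) δ ⊆ closedBall (0 : ℂ) 1 := by
    intro w hw
    have hδ2 : δ < 1 / 2 := by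
      obtain ⟨z, hz, -⟩ := hw
      exact hs.lt_half hq hpq hJ hB ⟨z 0, (hz 0).1⟩
    refine closedBall_subset_closedBall' ?_
    have h1 := (hann w hw).1.2
    rw [lt_div_iff₀ (by positivity)] at h1
    rw [dist_zero_right, norm_mul, Complex.norm_real, Real.norm_of_nonneg hr.le]
    linarith
  refine ⟨hr, hs.r_lt, h4, hδ, ?_, fun _ _ w hw _ => hsub w hw, ?_, fun _ _ w hw _ => hsub w hw⟩
  · intro z hz w hw w' hw' h h' hww'
    rw [disjoint_closedBall_closedBall_iff hδ.le hδ.le, dist_eq_norm, ← mul_sub, norm_mul,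
      Complex.norm_real, Real.norm_of_nonneg hr.le]
    by_contra! hle
    refine hF c z w w' hct (hth hz) (hth hw) (hth hw') ⟨h, h', ?_, by linarith⟩
    by_contra! hlt
    have h1 := (hann w hw).2.1
    refine hww' (sub_left_injective (hsep (w - c) (w' - c) (h.trans h'.symm) ?_))
    rw [sub_sub_sub_cancel_right]
    exact hlt.trans (mul_lt_mul_of_pos_left h1 hσ)
  · intro z hz w hw w' hw' h h' hww'
    rw [disjoint_closedBall_closedBall_iff hδ.le hδ.le, dist_eq_norm, ← mul_sub, norm_mul,
      Complex.norm_real, Real.norm_of_nonneg hr.le]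
    by_contra! hle
    refine hF' c z w w' hct' (hth' hz) (hth' hw) (hth' hw') ⟨h, h', ?_, by linarith⟩
    by_contra! hlt
    have h1 := (hann w hw).1.1
    exact hww' (hsep' w w' (h.symm.trans h') (hlt.trans (mul_lt_mul_of_pos_left h1 hσ')))

theorem hausdorffEDist_shadowSet_le (S : Shadowing p q c₀ J μ θ a b e τ) {u c : ℂ}
    (hu : ‖u - c₀‖ ≤ τ) (hc : ‖c - c₀‖ ≤ τ) :
    hausdorffEDist (shadowSet p q c₀ J u) (shadowSet p q c₀ J c) ≤
      ENNReal.ofReal (θ * b / (1 - θ) / a * ‖u - c‖) := by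
  refine hausdorffEDist_le_of_mem_edist ?_ ?_
  · rintro _ ⟨z, hz, rfl⟩
    refine ⟨_, ⟨z, hz, rfl⟩, ?_⟩
    rw [edist_dist, dist_eq_norm]
    exact ENNReal.ofReal_le_ofReal (S.norm_shadow_sub_le hz hu hc 0)
  · rintro _ ⟨z, hz, rfl⟩
    refine ⟨_, ⟨z, hz, rfl⟩, ?_⟩
    rw [edist_dist, dist_eq_norm, norm_sub_rev u]
    exact ENNReal.ofReal_le_ofReal (S.norm_shadow_sub_le hz hc hu 0)

end Shadowing

end

/-! ### Existence of the bundle map -/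

/-- The branch of `𝐟_c` near `z` which sends `z` to `w`. -/
def forwardBranch (p q : ℕ) (c z w u : ℂ) : ℂ := c + (w - c) * (u / z) ^ (p / q : ℂ)

section

variable {p q : ℕ} {c : ℂ} {r δ : ℝ} {Λ : Set ℂ}

theorem forwardBranch_corr (hq : 0 < q) {z w : ℂ} (hz : z ≠ 0) (h : Corr p q c z w) (u : ℂ) :
    Corr p q c u (forwardBranch p q c z w u) := by
  have hq' : (q : ℂ) ≠ 0 := by exact_mod_cast hq.ne'
  unfold Corr at h
  rw [Corr, forwardBranch, add_sub_cancel_left, mul_pow, h, ← Complex.cpow_mul_nat,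
    div_mul_cancel₀ _ hq', Complex.cpow_natCast, ← mul_pow, mul_div_cancel₀ _ hz]

theorem forwardBranch_self {z w : ℂ} (hz : z ≠ 0) : forwardBranch p q c z w z = w := by
  rw [forwardBranch, div_self hz, Complex.one_cpow, mul_one, add_sub_cancel]

theorem IsBundleMap.mono {η η' : ℝ} {f : ℂ × ℂ → ℂ × ℂ} (h : IsBundleMap p q c r δ Λ η f)
    (hle : η' ≤ η) : IsBundleMap p q c r δ Λ η' f where
  differentiableOn := h.differentiableOn.mono (thickening_mono hle _)
  corr x hx := h.corr x (thickening_mono hle _ hx)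
  snd_eq x hx := h.snd_eq x (thickening_mono hle _ hx)
  branch := h.branch

/-- Near a compact set, the branches determined by nearby points of the bundle agree. -/
theorem exists_branch_consistency (hq : 0 < q) (hδ1 : δ < 1)
    (h : IsSemiInvariant p q c r Λ) (hs : IsScale p q c r δ Λ) :
    ∃ η > 0, (∀ z ∈ Λ, ∀ u, dist u z < η → u / z ∈ Complex.slitPlane) ∧
      ∀ z z', IsOrbitIn p q c Λ z → IsOrbitIn p q c Λ z' → ∀ x : ℂ × ℂ,
        dist x (bundlePoint r δ z) < η → dist x (bundlePoint r δ z') < η →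
        forwardBranch p q c (z 0) (z 1) x.1 = forwardBranch p q c (z' 0) (z' 1) x.1 := by
  have hr := hs.r_pos
  obtain ⟨σ, hσ, hσ1, hsep⟩ := exists_root_separation hq
  have hcont : ContinuousAt (fun t : ℂ => t ^ (p / q : ℂ)) 1 :=
    continuousAt_id.cpow continuousAt_const Complex.one_mem_slitPlane
  set ε : ℝ := min (1 / 2) (σ * r ^ 2 / 4) with hε
  have hε0 : 0 < ε := by positivity
  have hε1 : ε ≤ 1 / 2 := min_le_left _ _
  have hε2 : ε ≤ σ * r ^ 2 / 4 := min_le_right _ _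
  have h1 := hcont.eventually (ball_mem_nhds _ hε0)
  simp only [Complex.one_cpow] at h1
  have h2 : ∀ᶠ t in 𝓝 (1 : ℂ), t ∈ Complex.slitPlane :=
    Complex.isOpen_slitPlane.mem_nhds Complex.one_mem_slitPlane
  obtain ⟨ε', hε', hball⟩ := Metric.eventually_nhds_iff_ball.1 (h1.and h2)
  have hB := isCompact_cantorBundle hδ1 h hs
  -- The second point of the orbit is a uniformly continuous function on the compact bundle. Two
  -- orbits coded near the same `x` therefore prescribe close images, and two roots of the same
  -- equation that are this close coincide.
  have hu := hB.uniformContinuousOn_of_continuous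
    ((continuous_apply 1).comp_continuousOn (continuousOn_orbitOf hδ1 h hs))
  obtain ⟨η₀, hη₀, hu0⟩ := Metric.uniformContinuousOn_iff.1 hu (σ * r / 8) (by positivity)
  have hin : ∀ z ∈ Λ, ∀ u, dist u z < ε' * r → u / z ∈ ball (1 : ℂ) ε' := by
    intro z hz u hu
    have hz0 := h.ne_zero hr hz
    rw [mem_ball, dist_eq_norm, div_sub_one hz0, norm_div, div_lt_iff₀ (norm_pos_iff.2 hz0),
      ← dist_eq_norm]
    exact hu.trans (mul_lt_mul_of_pos_left (h.mem_annulus z hz).1.1 hε')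
  refine ⟨min (ε' * r) (η₀ / 2), by positivity, fun z hz u hu =>
    (hball _ (hin z hz u (hu.trans_le (min_le_left _ _)))).2, ?_⟩
  intro z z' hz hz' x hx hx'
  have hd : ∀ {z}, IsOrbitIn p q c Λ z → dist x (bundlePoint r δ z) < min (ε' * r) (η₀ / 2) →
      r / 2 ≤ ‖forwardBranch p q c (z 0) (z 1) x.1 - c‖ ∧
      ‖forwardBranch p q c (z 0) (z 1) x.1 - z 1‖ ≤ σ * r / 8 := by
    intro z hz hx
    have h3 : dist x.1 (z 0) < ε' * r :=
      ((le_max_left _ _).trans_lt hx).trans_le (min_le_left _ _)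
    have h4 := (hball _ (hin _ (hz 0).1 _ h3)).1
    rw [dist_eq_norm] at h4
    set t := (x.1 / z 0) ^ (p / q : ℂ) with ht
    have h5 := (h.mem_annulus _ (hz 1).1).2
    have h6 : forwardBranch p q c (z 0) (z 1) x.1 - c = (z 1 - c) * t := by
      rw [forwardBranch]; ring
    have h7 : forwardBranch p q c (z 0) (z 1) x.1 - z 1 = (z 1 - c) * (t - 1) := by
      rw [forwardBranch]; ring
    rw [h6, h7, norm_mul, norm_mul]
    have h8 : 1 / 2 ≤ ‖t‖ := by
      have : ‖(1 : ℂ)‖ ≤ ‖t‖ + ‖t - 1‖ := by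
        calc ‖(1 : ℂ)‖ = ‖t - (t - 1)‖ := by congr 1; ring
          _ ≤ _ := norm_sub_le _ _
      rw [norm_one] at this
      linarith
    constructor
    · nlinarith [h5.1]
    · have h9 : ‖z 1 - c‖ ≤ 1 / (2 * r) := h5.2.le
      calc ‖z 1 - c‖ * ‖t - 1‖ ≤ 1 / (2 * r) * (σ * r ^ 2 / 4) := by
            gcongr
            exact h4.le.trans hε2
        _ = _ := by field_simp; ring
  obtain ⟨a1, a2⟩ := hd hz hx
  obtain ⟨b1, b2⟩ := hd hz' hx'
  have h10 : dist (bundlePoint r δ z) (bundlePoint r δ z') < η₀ := by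
    have := dist_triangle_left (bundlePoint r δ z) (bundlePoint r δ z') x
    have := min_le_right (ε' * r) (η₀ / 2)
    linarith
  have h11 := hu0 _ (bundlePoint_mem hδ1 h hs hz) _ (bundlePoint_mem hδ1 h hs hz') h10
  simp only [Function.comp, orbitOf_bundlePoint hδ1 h hs hz, orbitOf_bundlePoint hδ1 h hs hz',
    dist_eq_norm] at h11
  have c1 := forwardBranch_corr hq (h.ne_zero hr (hz 0).1) (hz 0).2 x.1
  have c2 := forwardBranch_corr hq (h.ne_zero hr (hz' 0).1) (hz' 0).2 x.1
  refine sub_left_injective (hsep _ _ (c1.trans c2.symm) ?_)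
  rw [sub_sub_sub_cancel_right]
  set A := forwardBranch p q c (z 0) (z 1) x.1
  set A' := forwardBranch p q c (z' 0) (z' 1) x.1
  have h12 : ‖A - A'‖ ≤ ‖A - z 1‖ + ‖z 1 - z' 1‖ + ‖A' - z' 1‖ := by
    rw [show A - A' = ((A - z 1) + (z 1 - z' 1)) - (A' - z' 1) by ring]
    exact (norm_sub_le _ _).trans (add_le_add_left (norm_add_le _ _) _)
  have h13 := mul_le_mul_of_nonneg_left a1 hσ.le
  have h14 := mul_pos hσ hr
  linarith

/-- An orbit is chosen arbitrarily for each point of the neighbourhood. By consistency the choice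
does not affect the value, so near each point a single branch represents the map, which makes it
holomorphic. -/
theorem exists_bundleMap (hq : 0 < q) (hδ1 : δ < 1)
    (h : IsSemiInvariant p q c r Λ) (hs : IsScale p q c r δ Λ) :
    ∃ η > 0, ∃ f, IsBundleMap p q c r δ Λ η f := by
  obtain ⟨η, hη, hsl, hcons⟩ := exists_branch_consistency hq hδ1 h hs
  set B := cantorBundle p q c r δ Λ with hBdef
  have hB := cantorBundle_eq hδ1 h hs
  have hw : ∀ x ∈ thickening η B, ∃ z, IsOrbitIn p q c Λ z ∧ dist x (bundlePoint r δ z) < η := by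
    intro x hx
    obtain ⟨y, hy, hxy⟩ := mem_thickening_iff.1 hx
    rw [hBdef, hB] at hy
    obtain ⟨z, hz, rfl⟩ := hy
    exact ⟨z, hz, hxy⟩
  choose! ζ hζ hζd using hw
  set F : ℂ × ℂ → ℂ := fun x => forwardBranch p q c (ζ x 0) (ζ x 1) x.1
  have hF : ∀ z, IsOrbitIn p q c Λ z → ∀ x, dist x (bundlePoint r δ z) < η →
      F x = forwardBranch p q c (z 0) (z 1) x.1 := by
    intro z hz x hx
    have hxB : x ∈ thickening η B :=
      mem_thickening_iff.2 ⟨_, bundlePoint_mem hδ1 h hs hz, hx⟩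
    exact hcons _ _ (hζ x hxB) hz x (hζd x hxB) hx
  have hFd : DifferentiableOn ℂ F (thickening η B) := by
    intro x hx
    refine DifferentiableAt.differentiableWithinAt ?_
    have hd := hζd x hx
    have h1 : F =ᶠ[𝓝 x] fun x' => forwardBranch p q c (ζ x 0) (ζ x 1) x'.1 := by
      filter_upwards [isOpen_ball.mem_nhds (mem_ball.2 hd)] with x' hx'
      exact hF _ (hζ x hx) x' hx'
    refine DifferentiableAt.congr_of_eventuallyEq ?_ h1
    have h2 := hsl _ (hζ x hx 0).1 x.1 ((le_max_left _ _).trans_lt hd)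
    have h3 : DifferentiableAt ℂ (fun x' : ℂ × ℂ => x'.1 / ζ x 0) x := by
      simp only [div_eq_mul_inv]
      exact differentiableAt_fst.mul_const _
    exact (differentiableAt_const _).add ((differentiableAt_const _).mul
      (h3.cpow (differentiableAt_const _) h2))
  refine ⟨η, hη, fun x => (F x, (δ : ℂ)⁻¹ * x.2 - (r : ℂ) * (δ : ℂ)⁻¹ * F x), ?_, ?_, ?_, ?_⟩
  · exact hFd.prodMk (((differentiableOn_const _).mul differentiableOn_snd).sub
      ((differentiableOn_const _).mul hFd))
  · intro x hx
    exact forwardBranch_corr hq (h.ne_zero hs.r_pos (hζ x hx 0).1) (hζ x hx 0).2 x.1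
  · intro x _
    rfl
  · intro z hz
    change F (bundlePoint r δ z) = z 1
    rw [hF z hz _ (by rwa [dist_self])]
    exact forwardBranch_self (h.ne_zero hs.r_pos (hz 0).1)

/-- Periodic orbits in an expanding hyperbolic set are repelling. -/
theorem mem_julia_of_periodic (hq : 0 < q) (hpq : q < p) (hr : 0 < r)
    (h : IsExpandingHyperbolic p q c r Λ) {y : ℕ → ℂ} (hy : IsOrbitIn p q c Λ y) {n : ℕ}
    (hn : 0 < n) (hper : y n = y 0) : y 0 ∈ julia p q c := by
  obtain ⟨hs, V, μ, -, -, hΛV, -, hμ, κ, hκ, hexp⟩ := h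
  -- The metric factors telescope and cancel round a closed orbit, leaving `κ ^ n` as a lower bound
  -- for the multiplier.
  have key : ∀ n, κ ^ n * μ (y 0) ≤ μ (y n) * ∏ k ∈ Finset.range n, expansion p q (y k) := by
    intro n
    induction n with
    | zero => simp
    | succ n ih =>
      have h1 := hyperbolic_step hq hpq hμ hexp (hΛV (hy n).1) (hΛV (hy (n + 1)).1)
        (hs.ne_zero hr (hy n).1) (hy n).2
      have h2 : 0 ≤ ∏ k ∈ Finset.range n, expansion p q (y k) :=
        Finset.prod_nonneg fun k _ => expansion_nonneg _
      have h3 : 0 < κ := by linarith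
      rw [Finset.prod_range_succ, pow_succ']
      calc κ * κ ^ n * μ (y 0) = κ * (κ ^ n * μ (y 0)) := by ring
        _ ≤ κ * (μ (y n) * ∏ k ∈ Finset.range n, expansion p q (y k)) := by gcongr
        _ = (κ * μ (y n)) * ∏ k ∈ Finset.range n, expansion p q (y k) := by ring
        _ ≤ (μ (y (n + 1)) * expansion p q (y n)) * ∏ k ∈ Finset.range n, expansion p q (y k) := by
          gcongr
        _ = _ := by ring
  have hpath := Path.of_seq (p := p) (q := q) (c := c) (z := y) 0 n fun k _ => by
    rw [zero_add]
    exact ⟨hs.ne_zero hr (hy k).1, (hy k).2⟩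
  simp only [zero_add, hper] at hpath
  refine hpath.mem_julia hq hpq ?_
  have h1 := key n
  rw [hper] at h1
  have h2 := hμ _ (hΛV (hy 0).1)
  have h3 : 1 < κ ^ n := one_lt_pow₀ hκ hn.ne'
  have h4 : 1 * μ (y 0) < μ (y 0) * ∏ k ∈ Finset.range n, expansion p q (y k) :=
    (mul_lt_mul_of_pos_right h3 h2).trans_le h1
  rw [mul_comm] at h4
  exact lt_of_mul_lt_mul_left h4 h2.le

/-- A cycle extended to a periodic sequence. -/
theorem exists_periodic_orbit {n : ℕ} (hn : 0 < n) {z : ℕ → ℂ} (hz : z n = z 0)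
    (h : ∀ k < n, Corr p q c (z k) (z (k + 1))) {k : ℕ} (hk : k ≤ n) :
    ∃ y : ℕ → ℂ, y 0 = z k ∧ (∀ i, ∃ j ≤ n, y i = z j) ∧ (∀ i, Corr p q c (y i) (y (i + 1))) ∧
      ∀ i, y (i + n) = y i := by
  refine ⟨fun i => z ((k + i) % n), ?_, fun i => ⟨_, (Nat.mod_lt _ hn).le, rfl⟩, fun i => ?_,
    fun i => ?_⟩
  · rcases hk.lt_or_eq with hk | rfl
    · simp [Nat.mod_eq_of_lt hk]
    · simp [hz]
  · have h1 := Nat.mod_lt (k + i) hn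
    have h2 := h _ h1
    have h3 : z ((k + (i + 1)) % n) = z ((k + i) % n + 1) := by
      rw [← add_assoc, Nat.add_mod (k + i) 1 n]
      by_cases hlt : (k + i) % n + 1 < n
      · congr 1
        rw [Nat.mod_eq_of_lt (a := 1) (by omega), Nat.mod_eq_of_lt hlt]
      · have h4 : (k + i) % n + 1 = n := by omega
        have h5 : ((k + i) % n + 1 % n) % n = 0 := by
          rw [Nat.add_mod_mod, h4, Nat.mod_self]
        rw [h5, h4, hz]
    simp only [h3]
    exact h2
  · simp only [← add_assoc, Nat.add_mod_right]

end

/-! ### The motion of the Cantor bundle -/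

/-- The periodic orbits in `J`. -/
def periodicOrbits (p q : ℕ) (c : ℂ) (J : Set ℂ) : Set (ℕ → ℂ) :=
  {z | IsOrbitIn p q c J z ∧ ∃ n, 0 < n ∧ shift^[n] z = z}

/-- The holomorphic motion of the Cantor bundle of `J` given by shadowing. -/
def bundleMotion (p q : ℕ) (c₀ : ℂ) (r δ : ℝ) (J : Set ℂ) (c : ℂ) (x : ℂ × ℂ) : ℂ × ℂ :=
  bundlePoint r δ (shadow p q c₀ (orbitOf p q c₀ r δ J x) c)

section

variable {p q : ℕ} {c₀ : ℂ} {J : Set ℂ} {μ : ℂ → ℝ} {θ a b e τ r δ : ℝ}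

theorem periodicOrbits_subset : periodicOrbits p q c₀ J ⊆ orbitSet p q c₀ J := fun _ hz => hz.1

theorem closure_periodicOrbits_subset (hJ : IsCompact J) :
    closure (periodicOrbits p q c₀ J) ⊆ orbitSet p q c₀ J :=
  closure_minimal periodicOrbits_subset (isCompact_orbitSet hJ).isClosed

theorem shift_mem_closure_periodicOrbits :
    MapsTo shift (closure (periodicOrbits p q c₀ J)) (closure (periodicOrbits p q c₀ J)) := by
  refine MapsTo.closure ?_ continuous_shift
  rintro z ⟨hz, n, hn, hper⟩
  refine ⟨hz.shift, n, hn, ?_⟩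
  rw [← Function.iterate_succ_apply, Function.iterate_succ_apply', hper]

theorem norm_bundlePoint_sub_le (hr : 0 < r) (hδ : 0 < δ) (hδ1 : δ < 1) {y y' : ℕ → ℂ} {M C : ℝ}
    (hy : ∀ n, ‖y n‖ ≤ M) (hy' : ∀ n, ‖y' n‖ ≤ M) (h : ∀ n, ‖y n - y' n‖ ≤ C) :
    ‖bundlePoint r δ y - bundlePoint r δ y'‖ ≤ (1 + r / (1 - δ)) * C := by
  have hδ' : 0 < 1 - δ := by linarith
  have hC : 0 ≤ C := (norm_nonneg _).trans (h 0)
  have h1 : ‖(bundlePoint r δ y).2 - (bundlePoint r δ y').2‖ ≤ r / (1 - δ) * C := by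
    simp only [bundlePoint]
    rw [← mul_sub, ← (summable_bundle hδ hδ1 hy).tsum_sub (summable_bundle hδ hδ1 hy'), norm_mul,
      Complex.norm_real, Real.norm_of_nonneg hr.le, div_mul_eq_mul_div, mul_div_assoc]
    refine mul_le_mul_of_nonneg_left ?_ hr.le
    have hg : HasSum (fun n : ℕ => δ ^ n * C) (C / (1 - δ)) := by
      have := (hasSum_geometric_of_lt_one hδ.le hδ1).mul_right C
      rwa [inv_mul_eq_div] at this
    refine tsum_of_norm_bounded hg fun n => ?_
    rw [← mul_sub, norm_mul, norm_pow, Complex.norm_real, Real.norm_of_nonneg hδ.le]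
    exact mul_le_mul_of_nonneg_left (h _) (by positivity)
  rw [Prod.norm_def, max_le_iff]
  constructor
  · have h2 : (bundlePoint r δ y - bundlePoint r δ y').1 = y 0 - y' 0 := rfl
    rw [h2]
    have : 0 ≤ r / (1 - δ) * C := by positivity
    linarith [h 0]
  · refine h1.trans ?_
    linarith

theorem differentiableOn_bundlePoint (hδ : 0 < δ) (hδ1 : δ < 1) {y : ℂ → ℕ → ℂ} {U : Set ℂ}
    (hU : IsOpen U) {M : ℝ} (hy : ∀ c ∈ U, ∀ n, ‖y c n‖ ≤ M)
    (hd : ∀ n, DifferentiableOn ℂ (fun c => y c n) U) :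
    DifferentiableOn ℂ (fun c => bundlePoint r δ (y c)) U := by
  refine (hd 0).prodMk (DifferentiableOn.const_mul ?_ _)
  refine Complex.differentiableOn_tsum_of_summable_norm (u := fun n => δ ^ n * M)
    ((summable_geometric_of_lt_one hδ.le hδ1).mul_right M) (fun n => (hd (n + 1)).const_mul _) hU
    fun n c hc => ?_
  rw [norm_mul, norm_pow, Complex.norm_real, Real.norm_of_nonneg hδ.le]
  exact mul_le_mul_of_nonneg_left (hy c hc _) (by positivity)

/-- A point whose orbit under a bundle map is periodic is determined by the first coordinates. -/
theorem eq_bundlePoint_of_periodic (hδ : 0 < δ) (hδ1 : δ < 1) {f : ℂ × ℂ → ℂ × ℂ} {x : ℂ × ℂ}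
    {n : ℕ} (hn : 0 < n) (hx : f^[n] x = x)
    (hf : ∀ k, (f^[k + 1] x).2 = (δ : ℂ)⁻¹ * (f^[k] x).2 - (r : ℂ) * (δ : ℂ)⁻¹ * (f^[k + 1] x).1)
    {M : ℝ} (hM : ∀ k, ‖(f^[k] x).1‖ ≤ M) : x = bundlePoint r δ fun k => (f^[k] x).1 := by
  set y : ℕ → ℂ := fun k => (f^[k] x).1 with hy
  have hδ0 : (δ : ℂ) ≠ 0 := by exact_mod_cast hδ.ne'
  have hper : shift^[n] y = y := by
    funext k
    rw [iterate_shift, hy]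
    simp only [Function.iterate_add_apply, hx]
  -- The error in the second coordinate is divided by `δ` at each step, yet it is periodic; since `δ
  -- < 1` it must vanish.
  set d : ℕ → ℂ := fun k => (f^[k] x).2 - (bundlePoint r δ (shift^[k] y)).2
  have hd : ∀ k, d k = δ * d (k + 1) := by
    intro k
    have h1 := bundlePoint_snd_eq (r := r) hδ hδ1 (z := shift^[k] y) (M := M) fun m => by
      rw [iterate_shift]; exact hM _
    simp only [d]
    rw [h1, iterate_shift, hf k,
      ← Function.iterate_succ_apply' shift, add_comm 1 k]
    simp only [hy]
    field_simp
    ring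
  have hdn : ∀ k, d 0 = (δ : ℂ) ^ k * d k := by
    intro k
    induction k with
    | zero => simp
    | succ k ih => rw [ih, hd k, pow_succ]; ring
  have h2 : d n = d 0 := by
    simp only [d, hx, hper, Function.iterate_zero, id]
  have h3 := hdn n
  rw [h2] at h3
  have h4 : d 0 = 0 := by
    by_contra hne
    have h5 : (δ : ℂ) ^ n = 1 := mul_right_cancel₀ hne (by rw [one_mul]; exact h3.symm)
    have h6 := congrArg norm h5
    rw [norm_pow, Complex.norm_real, Real.norm_of_nonneg hδ.le, norm_one] at h6
    exact (pow_lt_one₀ hδ.le hδ1 hn.ne').ne h6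
  exact Prod.ext rfl (sub_eq_zero.1 h4)

theorem fst_image_cantorBundle (hδ1 : δ < 1) (h : IsSemiInvariant p q c₀ r J)
    (hs : IsScale p q c₀ r δ J) : Prod.fst '' cantorBundle p q c₀ r δ J = J := by
  rw [cantorBundle_eq hδ1 h hs]
  ext z
  constructor
  · rintro ⟨_, ⟨y, hy, rfl⟩, rfl⟩
    exact (hy 0).1
  · intro hz
    obtain ⟨y, hy, hy0⟩ := exists_orbit h.exists_image hz
    exact ⟨_, ⟨y, hy, rfl⟩, hy0⟩

/-! ### Conjugacy, uniqueness and periodic points of the motion -/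

namespace Shadowing

theorem bundleMotion_bundlePoint (hδ1 : δ < 1) (h : IsSemiInvariant p q c₀ r J)
    (hs : IsScale p q c₀ r δ J) {z : ℕ → ℂ} (hz : IsOrbitIn p q c₀ J z) (c : ℂ) :
    bundleMotion p q c₀ r δ J c (bundlePoint r δ z) = bundlePoint r δ (shadow p q c₀ z c) := by
  rw [bundleMotion, orbitOf_bundlePoint hδ1 h hs hz]

theorem movedSet_bundleMotion (hδ1 : δ < 1) (h : IsSemiInvariant p q c₀ r J)
    (hs : IsScale p q c₀ r δ J) (c : ℂ) :
    movedSet (bundleMotion p q c₀ r δ J) (cantorBundle p q c₀ r δ J) c =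
      shadowSet p q c₀ J c := by
  rw [movedSet, cantorBundle_eq hδ1 h hs, image_image, image_image, shadowSet]
  refine image_congr fun z hz => ?_
  rw [bundleMotion_bundlePoint hδ1 h hs hz]
  rfl

theorem isBundleMotion (S : Shadowing p q c₀ J μ θ a b e τ) (hδ1 : δ < 1)
    (h : IsSemiInvariant p q c₀ r J) (hs : IsScale p q c₀ r δ J) {σ : ℝ} (hσ : 0 < σ)
    (hστ : σ ≤ τ) (hyp : ∀ c ∈ ball c₀ σ, IsExpandingHyperbolic p q c r (shadowSet p q c₀ J c))
    (hsc : ∀ c ∈ ball c₀ σ, IsScale p q c r δ (shadowSet p q c₀ J c)) {η : ℂ → ℝ}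
    {f : ℂ → ℂ × ℂ → ℂ × ℂ} (hη : ∀ c ∈ ball c₀ σ, 0 < η c)
    (hf : ∀ c ∈ ball c₀ σ, IsBundleMap p q c r δ (shadowSet p q c₀ J c) (η c) (f c)) :
    IsBundleMotion p q c₀ r δ J (ball c₀ σ) (bundleMotion p q c₀ r δ J) η f := by
  have hr := hs.r_pos
  have hδ := hs.δ_pos
  have hm := movedSet_bundleMotion (c₀ := c₀) hδ1 h hs
  have hB := cantorBundle_eq hδ1 h hs
  have hle : ∀ {c}, c ∈ ball c₀ σ → ‖c - c₀‖ ≤ τ := fun hc => by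
    rw [← dist_eq_norm]; exact (mem_ball.1 hc).le.trans hστ
  have hbp := fun {z : ℕ → ℂ} (hz : IsOrbitIn p q c₀ J z) c =>
    bundleMotion_bundlePoint hδ1 h hs hz c
  have hbd : ∀ {c}, c ∈ ball c₀ σ → ∀ {z}, IsOrbitIn p q c₀ J z → ∀ n,
      ‖shadow p q c₀ z c n‖ ≤ 1 / r := fun hc z hz =>
    orbitSet_subset_bounded (hyp _ hc).1 (hsc _ hc) (S.isOrbitIn_shadow hz (hle hc))
  have hfs : ∀ {c}, c ∈ ball c₀ σ → ∀ {z}, IsOrbitIn p q c₀ J z →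
      f c (bundlePoint r δ (shadow p q c₀ z c)) = bundlePoint r δ (shadow p q c₀ (shift z) c) :=
    fun {c} hc z hz => by
      rw [(hf c hc).apply_bundlePoint (hη c hc) hδ1 (hyp c hc).1 (hsc c hc)
        (S.isOrbitIn_shadow hz (hle hc)), S.shadow_shift hz (hle hc)]
  have h0 : c₀ ∈ ball c₀ σ := mem_ball_self hσ
  have hconj : ∀ c ∈ ball c₀ σ, ∀ z, IsOrbitIn p q c₀ J z →
      bundleMotion p q c₀ r δ J c (f c₀ (bundlePoint r δ z)) =
        f c (bundleMotion p q c₀ r δ J c (bundlePoint r δ z)) := by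
    intro c hc z hz
    have h1 := hfs h0 hz
    rw [S.shadow_self hz, S.shadow_self hz.shift] at h1
    rw [h1, hbp hz, hbp hz.shift, hfs hc hz]
  refine ⟨⟨isOpen_ball, ⟨⟨c₀, h0⟩, (convex_ball c₀ σ).isPreconnected⟩, h0, ?_, ?_, ?_⟩,
    ?_, ?_, ?_, hη, ?_, ?_, ?_, ?_, ?_⟩
  · rw [hB]
    rintro _ ⟨z, hz, rfl⟩
    rw [hbp hz, S.shadow_self hz]
  · rw [hB]
    rintro c hc _ ⟨z, hz, rfl⟩ _ ⟨z', hz', rfl⟩ heq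
    rw [hbp hz, hbp hz'] at heq
    rw [S.shadow_injective hz hz' (hle hc) (bundlePoint_injOn hδ1 (hyp c hc).1 (hsc c hc)
      (S.isOrbitIn_shadow hz (hle hc)) (S.isOrbitIn_shadow hz' (hle hc)) heq)]
  · rw [hB]
    rintro _ ⟨z, hz, rfl⟩
    simp only [hbp hz]
    exact differentiableOn_bundlePoint hδ hδ1 isOpen_ball (fun c hc => hbd hc hz)
      fun n => (S.differentiableOn_shadow hz n).mono (ball_subset_ball hστ)
  · intro c hc; rw [hm]; exact hyp c hc
  · intro c hc; rw [hm]; exact hsc c hc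
  · intro c hc
    simp only [hm]
    have hlim : Tendsto (fun u => ENNReal.ofReal (θ * b / (1 - θ) / a * ‖u - c‖))
        (𝓝[ball c₀ σ] c) (𝓝 0) := by
      have h1 : Continuous fun u => ENNReal.ofReal (θ * b / (1 - θ) / a * ‖u - c‖) :=
        ENNReal.continuous_ofReal.comp (by fun_prop)
      have h2 := (h1.tendsto c).mono_left (nhdsWithin_le_nhds (s := ball c₀ σ))
      simpa using h2
    refine tendsto_of_tendsto_of_tendsto_of_le_of_le' tendsto_const_nhds hlim
      (Eventually.of_forall fun _ => zero_le) ?_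
    filter_upwards [self_mem_nhdsWithin] with u hu
    exact S.hausdorffEDist_shadowSet_le (hle hu) (hle hc)
  · intro c hc; rw [hm]; exact hf c hc
  · intro c hc
    rw [hm, hB]
    rintro _ ⟨z, hz, rfl⟩
    rw [hbp hz]
    exact bundlePoint_mem hδ1 (hyp c hc).1 (hsc c hc) (S.isOrbitIn_shadow hz (hle hc))
  · intro c hc
    rw [hB]
    rintro _ ⟨_, ⟨z, hz, rfl⟩, rfl⟩
    rw [hbp hz, hfs hc hz]
    exact ⟨_, ⟨shift z, IsOrbitIn.shift hz, rfl⟩, hbp (IsOrbitIn.shift hz) c⟩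
  · rw [hB]
    rintro c hc _ ⟨z, hz, rfl⟩
    exact hconj c hc z hz
  · have hδ' : 0 < 1 - δ := by linarith
    have hθ' : 0 < 1 - θ := by linarith [S.θ_lt]
    have := S.θ_pos
    have := S.b_pos
    have := S.a_pos
    refine ⟨(1 + r / (1 - δ)) * (θ * b / (1 - θ) / a), by positivity, ?_⟩
    rw [hB]
    rintro u hu v hv _ ⟨z, hz, rfl⟩
    rw [hbp hz, hbp hz, mul_assoc]
    exact norm_bundlePoint_sub_le hr hδ hδ1 (hbd hu hz) (hbd hv hz)
      (S.norm_shadow_sub_le hz (hle hu) (hle hv))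

/-- Uniqueness of the motion. -/
theorem bundleMotion_unique (S : Shadowing p q c₀ J μ θ a b e τ) (hδ1 : δ < 1)
    (h : IsSemiInvariant p q c₀ r J) (hs : IsScale p q c₀ r δ J) {σ : ℝ}
    (hστ : σ ≤ τ) {h' : ℂ → ℂ × ℂ → ℂ × ℂ} {η' : ℂ → ℝ} {f' : ℂ → ℂ × ℂ → ℂ × ℂ}
    (H : IsBundleMotion p q c₀ r δ J (ball c₀ σ) h' η' f') {c : ℂ} (hc : c ∈ ball c₀ σ)
    {x : ℂ × ℂ} (hx : x ∈ cantorBundle p q c₀ r δ J) :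
    h' c x = bundleMotion p q c₀ r δ J c x := by
  have hx' := hx
  rw [cantorBundle_eq hδ1 h hs] at hx'
  obtain ⟨z, hz, rfl⟩ := hx'
  rw [bundleMotion_bundlePoint hδ1 h hs hz]
  have h0 := H.motion.base_mem
  have hmem : ∀ n, bundlePoint r δ (shift^[n] z) ∈ cantorBundle p q c₀ r δ J := fun n =>
    bundlePoint_mem hδ1 h hs (IsOrbitIn.iterate_shift hz n)
  have hmoved : movedSet h' (cantorBundle p q c₀ r δ J) c₀ = J := by
    rw [movedSet, image_congr H.motion.base, image_id', fst_image_cantorBundle hδ1 h hs]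
  have hf0 : ∀ n, f' c₀ (bundlePoint r δ (shift^[n] z)) = bundlePoint r δ (shift^[n + 1] z) := by
    intro n
    have := H.bundleMap c₀ h0
    rw [hmoved] at this
    rw [this.apply_bundlePoint (H.η_pos c₀ h0) hδ1 h hs (IsOrbitIn.iterate_shift hz n),
      Function.iterate_succ_apply']
  set X : ℂ → ℕ → ℂ × ℂ := fun c n => h' c (bundlePoint r δ (shift^[n] z)) with hX
  have hX0 : ∀ n, X c₀ n = bundlePoint r δ (shift^[n] z) := fun n => H.motion.base _ (hmem n)
  have hstep : ∀ c ∈ ball c₀ σ, ∀ n, X c (n + 1) = f' c (X c n) := by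
    intro c hc n
    simp only [hX]
    rw [← hf0 n, H.conj c hc _ (hmem n)]
  have horb : ∀ c ∈ ball c₀ σ, (∀ n, Corr p q c (X c n).1 (X c (n + 1)).1) ∧
      X c 0 = bundlePoint r δ fun n => (X c n).1 := by
    intro c hc
    have hsi := (H.hyperbolic c hc).1
    have hsc := H.scale c hc
    have h1 := H.mapsTo c hc (hmem 0)
    rw [cantorBundle_eq hδ1 hsi hsc] at h1
    obtain ⟨y, hy, hy0⟩ := h1
    have h2 : ∀ n, X c n = bundlePoint r δ (shift^[n] y) := by
      intro n
      induction n with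
      | zero => exact hy0.symm
      | succ n ih =>
        rw [hstep c hc, ih, (H.bundleMap c hc).apply_bundlePoint (H.η_pos c hc) hδ1 hsi hsc
          (IsOrbitIn.iterate_shift hy n), Function.iterate_succ_apply']
    have h3 : ∀ n, (X c n).1 = y n := by
      intro n
      rw [h2 n]
      simp only [bundlePoint, iterate_shift, zero_add]
    constructor
    · intro n
      rw [h3, h3]
      exact (hy n).2
    · simp only [h3]
      exact h2 0
  obtain ⟨C, hC, hlip⟩ := H.lipschitz
  -- The Lipschitz constant is uniform over the bundle, so one neighbourhood of `c₀` keeps the whole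
  -- orbit `X c` within `e` of `z`, where shadows are unique. The identity theorem then treats the
  -- other parameters.
  have hnear : ∀ᶠ c in 𝓝 c₀, ∀ n, (X c n).1 = shadow p q c₀ z c n := by
    have h1 : Tendsto (fun c => b * (C * ‖c - c₀‖)) (𝓝 c₀) (𝓝 0) := by
      have : Continuous fun c => b * (C * ‖c - c₀‖) := by fun_prop
      simpa using this.tendsto c₀
    filter_upwards [H.motion.isOpen.mem_nhds h0, S.eventually_le,
      h1.eventually (gt_mem_nhds S.e_pos)] with c hc hcτ hce n
    refine congrFun (S.eq_shadow hz hcτ (y := fun n => (X c n).1) (horb c hc).1 fun n => ?_) n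
    have h2 := hlip c hc c₀ h0 _ (hmem n)
    have h3 : ‖(X c n).1 - z n‖ ≤ C * ‖c - c₀‖ := by
      refine le_trans ?_ h2
      have h4 : (X c n).1 - z n = (X c n - X c₀ n).1 := by
        rw [hX0 n]
        simp only [bundlePoint, iterate_shift, zero_add, Prod.fst_sub]
      rw [h4]
      exact norm_fst_le _
    have := S.b_pos
    calc μ (z n) * ‖(X c n).1 - z n‖ ≤ b * (C * ‖c - c₀‖) := by
          gcongr
          exact S.μ_le _ (hz n).1
      _ ≤ e := hce.le
  have hall : ∀ n, (X c n).1 = shadow p q c₀ z c n := by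
    intro n
    have hd1 : DifferentiableOn ℂ (fun c => (X c n).1) (ball c₀ σ) :=
      (H.motion.holomorphic _ (hmem n)).fst
    have hd2 := (S.differentiableOn_shadow hz n).mono (ball_subset_ball hστ)
    exact (hd1.analyticOnNhd isOpen_ball).eqOn_of_preconnected_of_eventuallyEq
      (hd2.analyticOnNhd isOpen_ball) (convex_ball c₀ σ).isPreconnected h0
      (hnear.mono fun c hc => hc n) hc
  have h5 := (horb c hc).2
  simp only [hall] at h5
  exact h5

/-- The periodic points of the bundle map near the moved bundle are the moved periodic points. -/
theorem bundleJulia_eq (S : Shadowing p q c₀ J μ θ a b e τ)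
    (hB : ∀ z w, w ∈ J → Corr p q c₀ z w → z ∈ J) (hδ1 : δ < 1) {c : ℂ} (hc : ‖c - c₀‖ ≤ τ)
    (h : IsSemiInvariant p q c r (shadowSet p q c₀ J c))
    (hs : IsScale p q c r δ (shadowSet p q c₀ J c)) {ρ η : ℝ} (hρ : 0 < ρ) (hρη : ρ ≤ η)
    (hΩ : thickening ρ (shadowSet p q c₀ J c) ⊆ shadowNhd J μ e) {f : ℂ × ℂ → ℂ × ℂ}
    (hf : IsBundleMap p q c r δ (shadowSet p q c₀ J c) η f) :
    bundleJulia p q c r δ (shadowSet p q c₀ J c) ρ f =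
      (fun z => bundlePoint r δ (shadow p q c₀ z c)) '' closure (periodicOrbits p q c₀ J) := by
  have hK : IsCompact (closure (periodicOrbits p q c₀ J)) :=
    (isCompact_orbitSet S.isCompact).of_isClosed_subset isClosed_closure
      (closure_periodicOrbits_subset S.isCompact)
  have hcont : ContinuousOn (fun z => bundlePoint r δ (shadow p q c₀ z c))
      (closure (periodicOrbits p q c₀ J)) := by
    have h1 := (continuousOn_bundlePoint (r := r) hs.δ_pos hδ1 (1 / r)).comp
      ((S.continuousOn_shadow hc).mono (closure_periodicOrbits_subset S.isCompact))
      (fun z hz => orbitSet_subset_bounded h hs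
        (S.isOrbitIn_shadow (closure_periodicOrbits_subset S.isCompact hz) hc))
    exact h1
  rw [bundleJulia, mapJulia, image_closure_of_isCompact hK hcont]
  congr 1
  ext x
  constructor
  · rintro ⟨n, hn, hW, hx⟩
    have hη := hρ.trans_le hρη
    have hWη : ∀ k, f^[k] x ∈ thickening η (cantorBundle p q c r δ (shadowSet p q c₀ J c)) :=
      fun k => thickening_mono hρη _ (hW k)
    have hΩk : ∀ k, (f^[k] x).1 ∈ shadowNhd J μ e := by
      intro k
      apply hΩ
      obtain ⟨y, hy, hxy⟩ := mem_thickening_iff.1 (hW k)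
      exact mem_thickening_iff.2 ⟨y.1, hy.1, (le_max_left _ _).trans_lt hxy⟩
    have hcorr : ∀ k, Corr p q c (f^[k] x).1 (f^[k + 1] x).1 := by
      intro k
      rw [Function.iterate_succ_apply']
      exact hf.corr _ (hWη k)
    -- The projected cycle never leaves the shadowing neighbourhood, so it is a shadow; periodicity
    -- then forces the second coordinate to be the coded one.
    obtain ⟨z, hz, hyz⟩ := S.exists_eq_shadow hB hc hcorr hΩk
    have hx1 := eq_bundlePoint_of_periodic (r := r) hs.δ_pos hδ1 hn hx (fun k => by
      rw [Function.iterate_succ_apply']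
      exact hf.snd_eq _ (hWη k)) (M := 1 / r) (fun k => by
        rw [congrFun hyz k]
        exact orbitSet_subset_bounded h hs (S.isOrbitIn_shadow hz hc) k)
    rw [hyz] at hx1
    refine ⟨z, ⟨hz, n, hn, ?_⟩, hx1.symm⟩
    refine S.shadow_injective (hz.iterate_shift n) hz hc ?_
    rw [S.shadow_iterate_shift hz hc, ← hyz]
    funext k
    rw [iterate_shift, Function.iterate_add_apply, hx]
  · rintro ⟨z, ⟨hz, n, hn, hper⟩, rfl⟩
    have hy := S.isOrbitIn_shadow hz hc
    have hit : ∀ k, f^[k] (bundlePoint r δ (shadow p q c₀ z c)) =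
        bundlePoint r δ (shift^[k] (shadow p q c₀ z c)) := by
      intro k
      induction k with
      | zero => rfl
      | succ k ih =>
        rw [Function.iterate_succ_apply', ih,
          hf.apply_bundlePoint (hρ.trans_le hρη) hδ1 h hs (hy.iterate_shift k),
          Function.iterate_succ_apply']
    refine ⟨n, hn, fun k => ?_, ?_⟩
    · rw [hit]
      exact self_subset_thickening hρ _ (bundlePoint_mem hδ1 h hs (hy.iterate_shift k))
    · rw [hit, ← S.shadow_iterate_shift hz hc, hper]

/-- The part of the Julia set of `𝐟_c` close to `J` consists of shadows. -/
theorem image_closure_periodicOrbits_eq (hq : 0 < q) (hpq : q < p)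
    (S : Shadowing p q c₀ J μ θ a b e τ)
    (hB : ∀ z w, w ∈ J → Corr p q c₀ z w → z ∈ J) (hr : 0 < r) {c : ℂ} (hc : ‖c - c₀‖ ≤ τ)
    (h : IsExpandingHyperbolic p q c r (shadowSet p q c₀ J c))
    (hΩ : shadowSet p q c₀ J c ⊆ shadowNhd J μ e) :
    (fun z => shadow p q c₀ z c 0) '' closure (periodicOrbits p q c₀ J) =
      julia p q c ∩ shadowNhd J μ e := by
  have hK : IsCompact (closure (periodicOrbits p q c₀ J)) :=
    (isCompact_orbitSet S.isCompact).of_isClosed_subset isClosed_closure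
      (closure_periodicOrbits_subset S.isCompact)
  have hcont : ContinuousOn (fun z => shadow p q c₀ z c 0) (closure (periodicOrbits p q c₀ J)) :=
    (continuous_apply 0).comp_continuousOn
      ((S.continuousOn_shadow hc).mono (closure_periodicOrbits_subset S.isCompact))
  apply Subset.antisymm
  · refine subset_inter ?_ ?_
    · refine hcont.image_closure.trans (closure_minimal ?_ isClosed_closure)
      rintro _ ⟨z, ⟨hz, n, hn, hper⟩, rfl⟩
      refine mem_julia_of_periodic hq hpq hr h (S.isOrbitIn_shadow hz hc) hn ?_
      have h1 := congrFun (S.shadow_iterate_shift hz hc n) 0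
      rw [hper, iterate_shift, zero_add] at h1
      exact h1.symm
    · rintro _ ⟨z, hz, rfl⟩
      exact hΩ ⟨z, closure_periodicOrbits_subset S.isCompact hz, rfl⟩
  · rintro v ⟨hv, hvΩ⟩
    refine (hK.image_of_continuousOn hcont).isClosed.closure_subset_iff.2 ?_
      ((isOpen_shadowNhd J μ e).inter_closure ⟨hvΩ, hv⟩)
    rintro _ ⟨hkΩ, ⟨n, z, hcyc, k, hk, rfl⟩⟩
    obtain ⟨y, hy0, -, hyc, hyn⟩ := exists_periodic_orbit hcyc.1 hcyc.2.1 hcyc.2.2.1 hk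
    have hn := hcyc.1
    rw [← hy0] at hkΩ
    have hmul : ∀ m, y (m * n) = y 0 := by
      intro m
      induction m with
      | zero => simp
      | succ m ih => rw [Nat.succ_mul, hyn, ih]
    have hdown : ∀ i j, y (i + j) ∈ shadowNhd J μ e → y i ∈ shadowNhd J μ e := by
      intro i j
      induction j with
      | zero => exact id
      | succ j ih => exact fun hj => ih (S.shadowNhd_backward hB hc hj (hyc (i + j)))
    -- The neighbourhood is only known to be backward invariant: the index `i * n ≥ i` is a return
    -- to `y 0`, and from there one goes back to `i`.
    have hyΩ : ∀ i, y i ∈ shadowNhd J μ e := by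
      intro i
      have h1 : i ≤ i * n := Nat.le_mul_of_pos_right i hn
      refine hdown i (i * n - i) ?_
      rw [Nat.add_sub_cancel' h1, hmul]
      exact hkΩ
    obtain ⟨ζ, hζ, hyζ⟩ := S.exists_eq_shadow hB hc hyc hyΩ
    refine ⟨ζ, subset_closure ⟨hζ, n, hn, ?_⟩, ?_⟩
    · refine S.shadow_injective (hζ.iterate_shift n) hζ hc ?_
      rw [S.shadow_iterate_shift hζ hc, ← hyζ]
      funext i
      rw [iterate_shift, hyn]
    · simp only [← hyζ, hy0]

end Shadowing

end

/-! ### The degenerate case of an empty Julia set -/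

theorem cantorBundle_empty (p q : ℕ) (c : ℂ) (r δ : ℝ) : cantorBundle p q c r δ ∅ = ∅ := by
  ext x
  simp [cantorBundle]

theorem bundleJulia_empty (p q : ℕ) (c : ℂ) (r δ ρ : ℝ) (f : ℂ × ℂ → ℂ × ℂ) :
    bundleJulia p q c r δ ∅ ρ f = ∅ := by
  rw [bundleJulia, mapJulia, cantorBundle_empty, thickening_empty]
  have : {x : ℂ × ℂ | ∃ n : ℕ, 0 < n ∧ (∀ k, f^[k] x ∈ (∅ : Set (ℂ × ℂ))) ∧ f^[n] x = x} = ∅ := by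
    ext x
    simp
  rw [this, closure_empty]

/-- The motion of the empty set. -/
theorem isBundleMotion_empty {p q : ℕ} {c₀ : ℂ} {r δ σ : ℝ} (hs : IsScale p q c₀ r δ ∅)
    (hσ : 0 < σ) (hc : ∀ c ∈ ball c₀ σ, 4 * ‖c‖ * r < 1) :
    IsBundleMotion p q c₀ r δ ∅ (ball c₀ σ) (fun _ x => x) (fun _ => 1) (fun _ x => x) := by
  have hm : ∀ c, movedSet (fun _ x => x) (cantorBundle p q c₀ r δ ∅) c = ∅ := fun c => by
    simp [movedSet, cantorBundle_empty]
  have hB : ∀ c, cantorBundle p q c r δ ∅ = ∅ := fun c => cantorBundle_empty p q c r δ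
  constructor
  · exact ⟨isOpen_ball, ⟨⟨c₀, mem_ball_self hσ⟩, (convex_ball c₀ σ).isPreconnected⟩,
      mem_ball_self hσ, fun _ _ => rfl, fun _ _ _ _ _ _ h => h, fun _ _ => differentiableOn_const _⟩
  · intro c _
    rw [hm]
    exact ⟨⟨isCompact_empty, by simp, by simp, by simp⟩, ∅, fun _ => 1, isOpen_empty,
      isPreconnected_empty, subset_rfl, continuousOn_empty _, by simp, 2, by norm_num, by simp⟩
  · intro c hcU
    rw [hm]
    exact ⟨hs.r_pos, hs.r_lt, hc c hcU, hs.δ_pos, by simp, by simp, by simp, by simp⟩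
  · intro c _
    simp only [hm, hausdorffEDist_self]
    exact tendsto_const_nhds
  · intro c _
    exact one_pos
  · intro c _
    rw [hm]
    exact ⟨differentiableOn_id, by simp [hB, thickening_empty], by simp [hB, thickening_empty],
      fun z hz => absurd (hz 0).1 (notMem_empty _)⟩
  · intro c _
    rw [hm, hB, hB]
    exact mapsTo_empty _ _
  · intro c _
    rw [hB, image_empty]
    exact mapsTo_empty _ _
  · intro c _ x _
    rfl
  · exact ⟨1, one_pos, fun u _ v _ x hx => by simp [hB] at hx⟩

end

end BranchedJulia

/-! ### Assembly of the theorem -/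

theorem theorem3p4 (p q : ℕ) (hq : 2 ≤ q) (hpq : q < p) (c₀ : ℂ) (r δ : ℝ)
    (hJ : IsExpandingHyperbolic p q c₀ r (julia p q c₀))
    (hscale : IsScale p q c₀ r δ (julia p q c₀)) :
    ∃ (U : Set ℂ) (h : ℂ → ℂ × ℂ → ℂ × ℂ) (η : ℂ → ℝ) (f : ℂ → ℂ × ℂ → ℂ × ℂ),
      Bornology.IsBounded U ∧
      -- `h` is the unique motion of the Cantor bundle of `J_{c₀}` parameterized on `U`
      IsBundleMotion p q c₀ r δ (julia p q c₀) U h η f ∧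
      (∀ (h' : ℂ → ℂ × ℂ → ℂ × ℂ) (η' : ℂ → ℝ) (f' : ℂ → ℂ × ℂ → ℂ × ℂ),
        IsBundleMotion p q c₀ r δ (julia p q c₀) U h' η' f' →
        ∀ c ∈ U, ∀ x ∈ cantorBundle p q c₀ r δ (julia p q c₀), h' c x = h c x) ∧
      ∃ Ω : Set ℂ, IsOpen Ω ∧ julia p q c₀ ⊆ Ω ∧
        -- the domains of the bundle maps may be any smaller neighbourhoods of the bundles
        ∀ ρ : ℂ → ℝ, (∀ c ∈ U, 0 < ρ c ∧ ρ c ≤ η c) →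
          ∀ J : ℂ → Set (ℂ × ℂ),
          (∀ c, J c = bundleJulia p q c r δ
            (movedSet h (cantorBundle p q c₀ r δ (julia p q c₀)) c) (ρ c) (f c)) →
          (∀ c ∈ U, J c ⊆ cantorBundle p q c r δ
            (movedSet h (cantorBundle p q c₀ r δ (julia p q c₀)) c)) ∧
          (∀ c ∈ U, ∃ e : J c₀ ≃ₜ J c, ∀ x : J c₀, (e x : ℂ × ℂ) = h c x) ∧
          Set.MapsTo (f c₀) (J c₀) (J c₀) ∧
          IsBranchedHolomorphicMotion U (julia p q c₀) c₀ (inducedMotion h (J c₀)) ∧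
          ∀ c ∈ U, (⋃ z ∈ julia p q c₀, inducedMotion h (J c₀) c z) = julia p q c ∩ Ω ∧
            julia p q c ∩ Ω = Prod.fst '' J c := by
  have hq0 : 0 < q := by omega
  have hr := hscale.r_pos
  have hδ := hscale.δ_pos
  rcases (julia p q c₀).eq_empty_or_nonempty with hE | hne
  · rw [hE] at hscale ⊢
    have hc4 : ∀ᶠ c in 𝓝 c₀, 4 * ‖c‖ * r < 1 :=
      (by fun_prop : Continuous fun c : ℂ => 4 * ‖c‖ * r).continuousAt.eventually
        (gt_mem_nhds hscale.r_mul_lt)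
    obtain ⟨σ, hσ, hball⟩ := Metric.eventually_nhds_iff_ball.1 hc4
    have hM := isBundleMotion_empty hscale hσ hball
    refine ⟨ball c₀ σ, fun _ x => x, fun _ => 1, fun _ x => x, isBounded_ball, hM, ?_, ∅,
      isOpen_empty, subset_rfl, ?_⟩
    · intro h' η' f' _ c _ x hx
      simp [cantorBundle_empty] at hx
    · intro ρ _ J hJ
      have hJe : ∀ c, J c = ∅ := fun c => by
        rw [hJ c]
        simp [movedSet, cantorBundle_empty, bundleJulia_empty]
      refine ⟨fun c _ => by simp [hJe], fun c _ => ?_, by simp [hJe],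
        ⟨hM.motion.isOpen, hM.motion.isConnected, hM.motion.base_mem, by simp, by simp, ∅, by simp,
          by simp⟩, fun c _ => by simp [hJe]⟩
      have h1 : IsEmpty (J c₀) := by rw [hJe]; infer_instance
      have h2 : IsEmpty (J c) := by rw [hJe]; infer_instance
      exact ⟨Homeomorph.empty, fun x => isEmptyElim x⟩
  have hsi := hJ.1
  have hδ1 := hscale.lt_one hsi hne
  -- The annuli exclude `0` and `c₀` from the Julia set, which are the two conditions for backward
  -- invariance.
  have hB : ∀ z w, w ∈ julia p q c₀ → Corr p q c₀ z w → z ∈ julia p q c₀ := fun z w hw hzw =>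
    julia_backward_invariant hq0 hpq (fun h0 => hsi.ne_zero hr h0 rfl) (fun h0 => hsi.ne hr h0 rfl)
      hw hzw
  have hJ' := hJ
  obtain ⟨-, V, μ, -, -, hJV, hμc, hμ, κ, hκ, hexp⟩ := hJ'
  obtain ⟨θ, a, b, e, τ, S⟩ := exists_shadowing hq0 hpq hr hsi hJV hμc hμ hκ hexp
  obtain ⟨t, ht, htΩ⟩ := S.isCompact.exists_thickening_subset_open (isOpen_shadowNhd _ μ e)
    S.subset_shadowNhd
  obtain ⟨σ, hσ, hball⟩ := Metric.eventually_nhds_iff_ball.1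
    (S.eventually_le.and ((S.eventually_isExpandingHyperbolic hJ).and
      ((S.eventually_isScale hq0 hpq hsi hB hscale).and
        (S.eventually_subset_thickening (half_pos ht)))))
  set σ' := min σ τ
  have hσ' : 0 < σ' := lt_min hσ S.τ_pos
  have hstep : ∀ c ∈ ball c₀ σ', ‖c - c₀‖ ≤ τ ∧
      IsExpandingHyperbolic p q c r (shadowSet p q c₀ (julia p q c₀) c) ∧
      IsScale p q c r δ (shadowSet p q c₀ (julia p q c₀) c) ∧
      shadowSet p q c₀ (julia p q c₀) c ⊆ thickening (t / 2) (julia p q c₀) := fun c hc =>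
    hball c (ball_subset_ball (min_le_left _ _) hc)
  -- Each moved set lies within `t / 2` of `J_{c₀}`; with `η ≤ t / 2` the domain of the bundle map
  -- projects into the `t`-neighbourhood, hence into `Ω`, so periodic points found there are
  -- shadows.
  have hmaps : ∀ c, ∃ (η : ℝ) (f : ℂ × ℂ → ℂ × ℂ), c ∈ ball c₀ σ' → 0 < η ∧ η ≤ t / 2 ∧
      IsBundleMap p q c r δ (shadowSet p q c₀ (julia p q c₀) c) η f := by
    intro c
    by_cases hc : c ∈ ball c₀ σ'
    · obtain ⟨η, hη, f, hf⟩ := exists_bundleMap hq0 hδ1 (hstep c hc).2.1.1 (hstep c hc).2.2.1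
      exact ⟨min η (t / 2), f, fun _ => ⟨lt_min hη (half_pos ht), min_le_right _ _,
        hf.mono (min_le_left _ _)⟩⟩
    · exact ⟨1, id, fun h => absurd h hc⟩
  choose η f hηf using hmaps
  have h0 : c₀ ∈ ball c₀ σ' := mem_ball_self hσ'
  have hM := S.isBundleMotion hδ1 hsi hscale hσ' (min_le_right _ _) (fun c hc => (hstep c hc).2.1)
    (fun c hc => (hstep c hc).2.2.1) (fun c hc => (hηf c hc).1) (fun c hc => (hηf c hc).2.2)
  refine ⟨ball c₀ σ', bundleMotion p q c₀ r δ (julia p q c₀), η, f, isBounded_ball, hM,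
    fun h' η' f' H c hc x hx => S.bundleMotion_unique hδ1 hsi hscale (min_le_right _ _) H hc hx,
    shadowNhd (julia p q c₀) μ e, isOpen_shadowNhd _ _ _, S.subset_shadowNhd, ?_⟩
  intro ρ hρ J hJdef
  have hbp := fun {z : ℕ → ℂ} (hz : IsOrbitIn p q c₀ (julia p q c₀) z) c =>
    Shadowing.bundleMotion_bundlePoint hδ1 hsi hscale hz c
  have hsub := closure_periodicOrbits_subset (p := p) (q := q) (c₀ := c₀) hsi.isCompact
  have hthick : ∀ c ∈ ball c₀ σ', ∀ s ≤ t / 2,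
      thickening s (shadowSet p q c₀ (julia p q c₀) c) ⊆ shadowNhd (julia p q c₀) μ e := by
    intro c hc s hs
    refine (thickening_subset_of_subset s (hstep c hc).2.2.2).trans
      ((thickening_thickening_subset s (t / 2) _).trans ((thickening_mono ?_ _).trans htΩ))
    linarith
  have hJc : ∀ c ∈ ball c₀ σ', J c = (fun z => bundlePoint r δ (shadow p q c₀ z c)) ''
      closure (periodicOrbits p q c₀ (julia p q c₀)) := by
    intro c hc
    rw [hJdef c, Shadowing.movedSet_bundleMotion hδ1 hsi hscale]
    exact S.bundleJulia_eq hB hδ1 (hstep c hc).1 (hstep c hc).2.1.1 (hstep c hc).2.2.1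
      (hρ c hc).1 (hρ c hc).2 (hthick c hc _ ((hρ c hc).2.trans (hηf c hc).2.1)) (hηf c hc).2.2
  have hJ0 : J c₀ = bundlePoint r δ '' closure (periodicOrbits p q c₀ (julia p q c₀)) := by
    rw [hJc c₀ h0]
    exact image_congr fun z hz => by rw [S.shadow_self (hsub hz)]
  have hJim : ∀ c ∈ ball c₀ σ', bundleMotion p q c₀ r δ (julia p q c₀) c '' J c₀ = J c := by
    intro c hc
    rw [hJ0, hJc c hc, image_image]
    exact image_congr fun z hz => hbp (hsub hz) c
  have hJ0B : J c₀ ⊆ cantorBundle p q c₀ r δ (julia p q c₀) := by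
    rw [hJ0, cantorBundle_eq hδ1 hsi hscale]
    exact image_mono hsub
  have hfst : ∀ c ∈ ball c₀ σ', Prod.fst '' J c =
      julia p q c ∩ shadowNhd (julia p q c₀) μ e := by
    intro c hc
    rw [hJc c hc, image_image, ← S.image_closure_periodicOrbits_eq hq0 hpq hB hr (hstep c hc).1
      (hstep c hc).2.1 ((self_subset_thickening (half_pos ht) _).trans (hthick c hc _ le_rfl))]
    rfl
  have hinduced : ∀ c ∈ ball c₀ σ', (⋃ z ∈ julia p q c₀,
      inducedMotion (bundleMotion p q c₀ r δ (julia p q c₀)) (J c₀) c z) = Prod.fst '' J c := by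
    intro c hc
    rw [← hJim c hc]
    ext w
    simp only [inducedMotion, mem_iUnion, mem_ofPred_eq, mem_image]
    constructor
    · rintro ⟨z, -, x, hx, -, rfl⟩
      exact ⟨_, ⟨x, hx, rfl⟩, rfl⟩
    · rintro ⟨_, ⟨x, hx, rfl⟩, rfl⟩
      exact ⟨x.1, (hJ0B hx).1, x, hx, rfl, rfl⟩
  refine ⟨?_, ?_, ?_, ⟨hM.motion.isOpen, hM.motion.isConnected, h0, ?_, ?_, ?_⟩, ?_⟩
  · intro c hc
    rw [← hJim c hc]
    rintro _ ⟨x, hx, rfl⟩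
    exact hM.mapsTo c hc (hJ0B hx)
  · intro c hc
    have hK : IsCompact (J c₀) := by
      refine (isCompact_cantorBundle hδ1 hsi hscale).of_isClosed_subset ?_ hJ0B
      rw [hJdef c₀]
      exact isClosed_closure
    have hcont : ContinuousOn (bundleMotion p q c₀ r δ (julia p q c₀) c) (J c₀) := by
      have h1 := (continuousOn_bundlePoint (r := r) hδ hδ1 (1 / r)).comp
        ((S.continuousOn_shadow (hstep c hc).1).comp
          ((continuousOn_orbitOf hδ1 hsi hscale).mono hJ0B)
          fun x hx => orbitOf_mem hδ1 hsi hscale (hJ0B hx))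
        (fun x hx => orbitSet_subset_bounded (hstep c hc).2.1.1 (hstep c hc).2.2.1
          (S.isOrbitIn_shadow (orbitOf_mem hδ1 hsi hscale (hJ0B hx)) (hstep c hc).1))
      exact h1
    have hbij : BijOn (bundleMotion p q c₀ r δ (julia p q c₀) c) (J c₀) (J c) :=
      ⟨fun x hx => by rw [← hJim c hc]; exact ⟨x, hx, rfl⟩,
        (hM.motion.injOn c hc).mono hJ0B, (hJim c hc).ge⟩
    have : CompactSpace (J c₀) := isCompact_iff_compactSpace.1 hK
    have hcont' : Continuous (hbij.equiv _) :=
      hcont.domRestrict.subtype_mk fun x => hbij.mapsTo x.2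
    exact ⟨hcont'.homeoOfEquivCompactToT2, fun x => rfl⟩
  · rw [hJ0]
    rintro _ ⟨z, hz, rfl⟩
    have h1 := (hηf c₀ h0).2.2
    have h2 : shadowSet p q c₀ (julia p q c₀) c₀ = julia p q c₀ := by
      rw [← Shadowing.movedSet_bundleMotion hδ1 hsi hscale, movedSet, image_congr hM.motion.base,
        image_id', fst_image_cantorBundle hδ1 hsi hscale]
    rw [h2] at h1
    rw [h1.apply_bundlePoint (hηf c₀ h0).1 hδ1 hsi hscale (hsub hz)]
    exact ⟨_, shift_mem_closure_periodicOrbits hz, rfl⟩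
  · intro c _ z hz
    -- At `c₀` the identity `π J(f_c) = J_c ∩ Ω` shows that `π` maps `S` onto all of `J_{c₀}`, since
    -- `J_{c₀} ⊆ Ω`.
    have h1 : z ∈ Prod.fst '' J c₀ := by
      rw [hfst c₀ h0]
      exact ⟨hz, S.subset_shadowNhd hz⟩
    obtain ⟨x, hx, rfl⟩ := h1
    exact ⟨_, x, hx, rfl, rfl⟩
  · intro z hz
    have h1 : z ∈ Prod.fst '' J c₀ := by
      rw [hfst c₀ h0]
      exact ⟨hz, S.subset_shadowNhd hz⟩
    obtain ⟨x, hx, rfl⟩ := h1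
    ext w
    constructor
    · rintro ⟨y, hy, hyx, rfl⟩
      rw [hM.motion.base y (hJ0B hy), hyx]
      rfl
    · rintro rfl
      exact ⟨x, hx, rfl, by rw [hM.motion.base x (hJ0B hx)]⟩
  · refine ⟨(fun z c => shadow p q c₀ z c 0) '' closure (periodicOrbits p q c₀ (julia p q c₀)),
      ?_, ?_⟩
    · rintro _ ⟨z, hz, rfl⟩
      exact (S.differentiableOn_shadow (hsub hz) 0).mono (ball_subset_ball (min_le_right _ _))
    · ext ⟨c, w⟩
      constructor
      · rintro ⟨hc, z, hz, x, hx, -, hw⟩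
        rw [hJ0] at hx
        obtain ⟨y, hy, rfl⟩ := hx
        rw [hbp (hsub hy)] at hw
        exact ⟨hc, _, ⟨y, hy, rfl⟩, hw.symm⟩
      · rintro ⟨hc, _, ⟨y, hy, rfl⟩, hw⟩
        refine ⟨hc, y 0, (hsub hy 0).1, bundlePoint r δ y, ?_, rfl, ?_⟩
        · rw [hJ0]; exact ⟨y, hy, rfl⟩
        · rw [hbp (hsub hy)]; exact hw.symm
  · intro c hc
    rw [hinduced c hc, hfst c hc]
    exact ⟨rfl, rfl⟩
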